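/- Let $\nu:\mathbb{R}\to\mathbb{R}$ be an even function which is increasing on $[0,\infty)$, for which $\|(s,t)\|_\nu:=|t|\,\nu(s/t)$ (extended continuously to $t=0$) is a norm on $\mathbb{R}^2$, and which is normalised by $\nu(0)=1$; for instance $\nu(s)=\sqrt{1+s^2}$ or $\nu(s)=1+|s|$. Let $\Omega\subset\mathbb{R}^2$, and let $f,u:\Omega\to\mathbb{R}$ be smooth. For $p,q\in\Omega$ let $d(p,q)$ be the infimum, over all regular $C^1$ curves $c:[0,1]\to\Omega$ from $p$ to $q$, of $$L_\nu(c)=\int_0^1 \nu\!\left(\frac{(f\circ c)'(t)}{|c'(t)|}\right)|c'(t)|\,dt ,$$ and let $\mathcal{A}_p(\varrho)=\{q\in\Omega : d(p,q)\le\varrho\}$ be the amoeba of radius $\varrho$ about $p$. Put $$\tilde J_1(s)=\int_{-\pi/2}^{\pi/2}\frac{\nu'(s\cos\vartheta)}{\nu(s\cos\vartheta)^4}\,\sin^2\vartheta\,d\vartheta ,\qquad g(s)=1-\tfrac32\,s\,\tilde J_1(s).$$ Suppose that $f$ and $u$ are rotationally symmetric about the same centre $z$, i.e. on $\Omega$ they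 depend on the distance from $z$ only. Let $x$ be an interior point of $\Omega$ with $\nabla u(x)\ne0$, and suppose that $\nabla f(x)\neq 0$, or that $\nu$ is differentiable at $0$, or that both $\nabla f$ and its derivative $\mathrm{D}^2 f$ vanish at $x$. Then the vector field $g(|\nabla f|)\,\nabla u/|\nabla u|$ is differentiable at $x$, and one step of amoeba median filtering of $u$ with the amoebas generated from $f$ asymptotically approximates at $x$ a time step of size $\varrho^2/6$ of the explicit time discretisation of the geodesic active contour equation $$u_t=|\nabla u|\,\operatorname{div}\!\left(g(|\nabla f|)\,\frac{\nabla u}{|\nabla u|}\right).$$ That is, for all sufficiently small $\varrho>0$ the values of $u$ on $\mathcal{A}_x(\varrho)$ have a median with respect to area, and for any choice $\mu(\varrho)$ of such medians $$\lim_{\varrho\to0^+}\frac{\mu(\varrho)-u(x)}{\varrho^2/6}=|\nabla u(x)|\,\operatorname{div}\!\left(g(|\nabla f|)\,\frac{\nabla u}{|\nabla u|}\right)(x).$$ -/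

import Mathlib

open Real Set Filter Topology MeasureTheory
open scoped ContDiff Gradient

noncomputable section

/-- The image plane with its Euclidean structure. -/
abbrev Plane : Type := EuclideanSpace ℝ (Fin 2)

/-- The functions `ν` that generate amoeba metrics: even, increasing on the nonnegative half-line,
and such that `(s, t) ↦ |t| * ν (s / t)` is (the restriction to `t ≠ 0` of) a norm on the plane.
No differentiability is required, so that `ν s = √(1 + s ^ 2)` and `ν s = 1 + |s|` are included. -/
structure IsAmoebaProfile (ν : ℝ → ℝ) : Prop where
  even : ∀ s, ν (-s) = ν s
  monotoneOn : MonotoneOn ν (Ici 0)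
  isNorm : ∃ N : Seminorm ℝ (ℝ × ℝ), (∀ v, N v = 0 → v = 0) ∧
    ∀ s t : ℝ, t ≠ 0 → N (s, t) = |t| * ν (s / t)

/-- `c` is (the planar part of) a regular curve on the image graph of `f : Ω → ℝ` from `p` to `q`,
parametrised over `[0, 1]`. -/
structure IsRegularCurve (Ω : Set Plane) (p q : Plane) (c : ℝ → Plane) : Prop where
  contDiffOn : ContDiffOn ℝ 1 c (Icc 0 1)
  regular : ∀ t ∈ Icc (0 : ℝ) 1, derivWithin c (Icc 0 1) t ≠ 0
  mapsTo : MapsTo c (Icc 0 1) Ω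
  source : c 0 = p
  target : c 1 = q

/-- The amoeba length of the lift of the planar curve `c` to the image graph of `f`. -/
def amoebaLength (ν : ℝ → ℝ) (f : Plane → ℝ) (c : ℝ → Plane) : ℝ :=
  ∫ t in (0 : ℝ)..1,
    ν (derivWithin (fun τ => f (c τ)) (Icc 0 1) t / ‖derivWithin c (Icc 0 1) t‖) *
      ‖derivWithin c (Icc 0 1) t‖

/-- The amoeba distance: the infimum of the amoeba lengths of the regular curves in `Ω` from
`p` to `q` (it is `⊤` if there is no such curve). -/
def amoebaDist (ν : ℝ → ℝ) (Ω : Set Plane) (f : Plane → ℝ) (p q : Plane) : ENNReal :=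
  ⨅ (c : ℝ → Plane) (_ : IsRegularCurve Ω p q c), ENNReal.ofReal (amoebaLength ν f c)

/-- The amoeba of radius `ρ` about `p`: the structuring element of the amoeba filter. -/
def amoeba (ν : ℝ → ℝ) (Ω : Set Plane) (f : Plane → ℝ) (p : Plane) (ρ : ℝ) : Set Plane :=
  {q | q ∈ Ω ∧ amoebaDist ν Ω f p q ≤ ENNReal.ofReal ρ}

/-- `m` is a median of the values of `u` on `A` with respect to area: the parts of `A` with values
below and above `m` each have at most half of the area of `A`. -/
def IsMedianOn (u : Plane → ℝ) (A : Set Plane) (m : ℝ) : Prop :=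
  volume {q | q ∈ A ∧ u q < m} ≤ volume A / 2 ∧ volume {q | q ∈ A ∧ m < u q} ≤ volume A / 2

/-- At the point `x`, one step of amoeba median filtering of `u`, with the amoebas of radius `ρ`
generated from `f`, asymptotically approximates for `ρ → 0` an explicit time step of size
`τ = ρ ^ 2 / 6` of an evolution whose right-hand side has the value `R` at `x`: the medians exist
for all small `ρ`, and `(median - u x) / τ` tends to `R`, whichever medians are selected. -/
def AmoebaStepApproximates (ν : ℝ → ℝ) (Ω : Set Plane) (f u : Plane → ℝ) (x : Plane) (R : ℝ) :
    Prop :=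
  (∀ᶠ ρ : ℝ in 𝓝[>] 0, ∃ m, IsMedianOn u (amoeba ν Ω f x ρ) m) ∧
  ∀ μ : ℝ → ℝ, (∀ᶠ ρ : ℝ in 𝓝[>] 0, IsMedianOn u (amoeba ν Ω f x ρ) (μ ρ)) →
    Tendsto (fun ρ : ℝ => (μ ρ - u x) / (ρ ^ 2 / 6)) (𝓝[>] 0) (𝓝 R)

/-- The integral `∫_{-π/2}^{π/2} ν'(s cos ϑ) / ν(s cos ϑ)⁴ * sin² ϑ dϑ`. -/
def Jtilde₁ (ν : ℝ → ℝ) (s : ℝ) : ℝ :=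
  ∫ ϑ in (-(π / 2))..(π / 2), deriv ν (s * cos ϑ) / ν (s * cos ϑ) ^ 4 * sin ϑ ^ 2

/-- The edge-stopping function that belongs to `ν`. -/
def edgeStopping (ν : ℝ → ℝ) (s : ℝ) : ℝ := 1 - 3 / 2 * s * Jtilde₁ ν s

/-- The divergence of a vector field of the plane. -/
def divergence (V : Plane → Plane) (x : Plane) : ℝ :=
  ∑ i : Fin 2, (fderiv ℝ V x (EuclideanSpace.single i 1)) i

/-- The vector field `g(|∇f|) ∇u / |∇u|`. -/
def gacFlux (g : ℝ → ℝ) (f u : Plane → ℝ) (x : Plane) : Plane :=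
  (g ‖∇ f x‖ / ‖∇ u x‖) • ∇ u x

/-- The right-hand side `|∇u| div (g(|∇f|) ∇u / |∇u|)` of the geodesic active contour equation. -/
def gacRHS (g : ℝ → ℝ) (f u : Plane → ℝ) (x : Plane) : ℝ :=
  ‖∇ u x‖ * divergence (gacFlux g f u) x

/-- On `Ω`, the function `f` is rotationally symmetric about `z`: it depends on the distance from
`z` only. -/
def IsRotSymmOn (f : Plane → ℝ) (Ω : Set Plane) (z : Plane) : Prop :=
  ∀ p ∈ Ω, ∀ q ∈ Ω, dist p z = dist q z → f p = f q

end

/-! Let `r` be the distance of `x` from the centre, and let `F`, `U` be the derivatives of `f`, `u`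
along the ray through `x`. In the coordinates of `sectorMap` (`k` from the half squared radius `r ^
2 / 2 + r * k`, `y` as `r` times the angle) area is Lebesgue area, and `f` and `u` depend on `k`
alone. The level lines of `u` near `x` thus become the lines of constant `k`.

The amoeba distance is never computed, only trapped. From above it is bounded by the length of the
straight coordinate line (`amoebaDist_le`). From below, Jensen's inequality for the norm `N` bounds
it by the norm of the pair of the increment of `f` and the Euclidean chord (`le_amoebaLength`).
Scaled by `ρ`, these bounds become `upperLength` and `lowerLength`, and they agree up to and
including order `ρ`: the first-order terms along the line are affine in the parameter, so their mean
is their value at `1 / 2`, and the chord produces the same value. `IsFirstOrderLength` records this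
common expansion.

Cut the amoeba along `k = c * ρ ^ 2`. In polar coordinates each half is, up to this trapping, a
sublevel set of a function `s * ν (F r * cos ϑ) + O(ρ)`. By evenness of `ν` the halves agree at
leading order. At the next order their areas change by opposite multiples of the integral of
`deformation / ν ^ 2` (`tendsto_halfArea`), which integration by parts evaluates to `2 * (c - C)`
(`integral_deformation`). The halves therefore balance at `c = C`; any threshold `u x + κ * ρ ^ 2`
with `κ > U * C` has more than half of the amoeba below it (`eventually_half_lt`), and passing to
`-u` gives the opposite bound. This squeezes every choice of medians
(`amoebaStepApproximates_of_half_lt`). On the side of the equation, `gacRHS_radial` shows that the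
right-hand side is `6 * U * C`.

The profile `ν` is only Lipschitz. If `F r ≠ 0`, it is differentiable at `F r * cos ϑ` for almost
every `ϑ` (`ae_differentiableAt`), which suffices under the integrals. If `F r = 0`, either `ν` is
differentiable at `0`, or the first-order change of the slope vanishes and the chain rule holds
without differentiability (`hasDerivAt_comp`). Differentiability of `g` along the ray comes from
`edgeStopping_eq`, a formula without the derivative of `ν`. -/

/-- The norm of the plane that belongs to an amoeba profile normalised by `ν 0 = 1`. -/
structure IsProfileNorm (ν : ℝ → ℝ) (N : Seminorm ℝ (ℝ × ℝ)) : Prop where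
  even : ∀ s, ν (-s) = ν s
  zero : ν 0 = 1
  apply : ∀ s t : ℝ, t ≠ 0 → N (s, t) = |t| * ν (s / t)

theorem IsAmoebaProfile.exists_isProfileNorm {ν : ℝ → ℝ} (hν : IsAmoebaProfile ν)
    (hν0 : ν 0 = 1) : ∃ N, IsProfileNorm ν N := by
  obtain ⟨N, -, hN⟩ := hν.isNorm
  exact ⟨N, hν.even, hν0, hN⟩

/-! ### Elementary properties of the profile norm. -/

namespace IsProfileNorm

variable {ν : ℝ → ℝ} {N : Seminorm ℝ (ℝ × ℝ)}

theorem apply_pos (h : IsProfileNorm ν N) (s : ℝ) {t : ℝ} (ht : 0 < t) :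
    N (s, t) = t * ν (s / t) := by
  rw [h.apply s t ht.ne', abs_of_pos ht]

theorem apply_one (h : IsProfileNorm ν N) (s : ℝ) : N (s, 1) = ν s := by
  simp [h.apply s 1 one_ne_zero]

theorem neg_snd (h : IsProfileNorm ν N) (s t : ℝ) : N (s, -t) = N (s, t) := by
  rcases eq_or_ne t 0 with rfl | ht
  · simp
  · rw [h.apply s t ht, h.apply s (-t) (neg_ne_zero.2 ht), abs_neg, div_neg, h.even]

theorem neg_fst (h : IsProfileNorm ν N) (s t : ℝ) : N (-s, t) = N (s, t) := by
  rw [← map_neg_eq_map N (-s, t)]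
  simpa using h.neg_snd s t

theorem zero_fst (h : IsProfileNorm ν N) (t : ℝ) : N (0, t) = |t| := by
  rcases eq_or_ne t 0 with rfl | ht
  · rw [abs_zero]
    exact map_zero N
  · rw [h.apply 0 t ht, zero_div, h.zero, mul_one]

/-- The vector `(0, t)` is the mean of `(s, t)` and its mirror image, which have equal norm. This
puts amoebas inside Euclidean balls of the same radius and gives `1 ≤ ν`. -/
theorem abs_le (h : IsProfileNorm ν N) (s t : ℝ) : |t| ≤ N (s, t) := by
  have h1 := map_add_le_add N (s, t) (-s, t)
  rw [h.neg_fst, Prod.mk_add_mk, add_neg_cancel, h.zero_fst, ← two_mul t, abs_mul, abs_two] at h1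
  linarith

/-- Convexity: `(s, t)` lies on the segment between the mirror images `(s, t')` and `(s, -t')`,
which have equal norm. It allows arc length to be replaced by chord length. -/
theorem mono_snd (h : IsProfileNorm ν N) (s : ℝ) {t t' : ℝ} (ht : 0 ≤ t) (htt : t ≤ t') :
    N (s, t) ≤ N (s, t') := by
  rcases (ht.trans htt).eq_or_lt with h0 | h0
  · rw [le_antisymm (htt.trans h0.symm.le) ht, ← h0]
  have e : ((s, t) : ℝ × ℝ) = ((1 + t / t') / 2) • (s, t') + ((1 - t / t') / 2) • (s, -t') := by
    ext <;> simp <;> field_simp <;> ring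
  have h1 : t / t' ≤ 1 := (div_le_one h0).2 htt
  have h2 : 0 ≤ t / t' := by positivity
  have h3 := map_add_le_add N (((1 + t / t') / 2) • (s, t')) (((1 - t / t') / 2) • (s, -t'))
  rw [← e, map_smul_eq_mul, map_smul_eq_mul, h.neg_snd, Real.norm_of_nonneg (by linarith),
    Real.norm_of_nonneg (by linarith)] at h3
  linarith

theorem sub_le (h : IsProfileNorm ν N) (s t s' t' : ℝ) :
    |N (s, t) - N (s', t')| ≤ N (1, 0) * |s - s'| + |t - t'| := by
  have h1 : ∀ a b c d : ℝ, N (a, b) - N (c, d) ≤ N (1, 0) * |a - c| + |b - d| := by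
    intro a b c d
    have e : ((a, b) : ℝ × ℝ) = (c, d) + ((a - c) • (1, 0) + (0, b - d)) := by
      ext <;> simp
    have h3 := map_add_le_add N (c, d) ((a - c) • (1, 0) + (0, b - d))
    have h4 := map_add_le_add N ((a - c) • ((1, 0) : ℝ × ℝ)) (0, b - d)
    rw [map_smul_eq_mul, h.zero_fst, Real.norm_eq_abs] at h4
    rw [← e] at h3
    linarith
  rw [abs_sub_le_iff]
  refine ⟨h1 s t s' t', ?_⟩
  rw [abs_sub_comm s, abs_sub_comm t]
  exact h1 s' t' s t

theorem lipschitz (h : IsProfileNorm ν N) (s t : ℝ) : |ν s - ν t| ≤ N (1, 0) * |s - t| := by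
  simpa [h.apply_one] using h.sub_le s 1 t 1

theorem one_le (h : IsProfileNorm ν N) (s : ℝ) : 1 ≤ ν s := by
  simpa [h.apply_one] using h.abs_le s 1

theorem pos (h : IsProfileNorm ν N) (s : ℝ) : 0 < ν s := zero_lt_one.trans_le (h.one_le s)

theorem lipschitzWith (h : IsProfileNorm ν N) : LipschitzWith (N (1, 0)).toNNReal ν :=
  LipschitzWith.of_dist_le_mul fun s t => by
    rw [Real.coe_toNNReal _ (apply_nonneg N _), Real.dist_eq, Real.dist_eq]
    exact h.lipschitz s t

theorem continuous (h : IsProfileNorm ν N) : Continuous ν := h.lipschitzWith.continuous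

theorem norm_continuous (h : IsProfileNorm ν N) : Continuous N := by
  rw [continuous_iff_continuousAt]
  intro v
  rw [ContinuousAt, tendsto_iff_dist_tendsto_zero]
  have h1 : Tendsto (fun w : ℝ × ℝ => N (1, 0) * |w.1 - v.1| + |w.2 - v.2|) (𝓝 v) (𝓝 0) := by
    have : Continuous (fun w : ℝ × ℝ => N (1, 0) * |w.1 - v.1| + |w.2 - v.2|) := by fun_prop
    simpa using this.tendsto v
  exact squeeze_zero (fun _ => dist_nonneg) (fun w => h.sub_le w.1 w.2 v.1 v.2) h1

theorem deriv_abs_le (h : IsProfileNorm ν N) (s : ℝ) : |deriv ν s| ≤ N (1, 0) := by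
  have := norm_deriv_le_of_lipschitz h.lipschitzWith (x₀ := s)
  rwa [Real.coe_toNNReal _ (apply_nonneg N _), Real.norm_eq_abs] at this

theorem deriv_neg (h : IsProfileNorm ν N) (s : ℝ) : deriv ν (-s) = -deriv ν s := by
  have h1 := deriv_comp_neg ν s
  have h2 : (fun s => ν (-s)) = ν := funext h.even
  rw [h2] at h1
  linarith

/-- The chain rule for the outer function `ν`. No differentiability of `ν` is needed where the
inner derivative vanishes. -/
theorem hasDerivAt_comp (h : IsProfileNorm ν N) {p : ℝ → ℝ} {p' t : ℝ} (hp : HasDerivAt p p' t)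
    (hd : DifferentiableAt ℝ ν (p t) ∨ p' = 0) :
    HasDerivAt (fun τ => ν (p τ)) (deriv ν (p t) * p') t := by
  rcases hd with hd | rfl
  · exact hd.hasDerivAt.comp t hp
  · rw [mul_zero, hasDerivAt_iff_isLittleO]
    have h1 := hasDerivAt_iff_isLittleO.1 hp
    simp only [smul_zero, sub_zero] at h1 ⊢
    refine Asymptotics.IsBigO.trans_isLittleO ?_ h1
    exact Asymptotics.IsBigO.of_bound (N (1, 0)) (Eventually.of_forall fun τ => h.lipschitz _ _)

/-- `ν` is differentiable at `a cos ϑ` for almost every angle `ϑ`. -/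
theorem ae_differentiableAt (h : IsProfileNorm ν N) {a : ℝ} (ha : a ≠ 0) :
    ∀ᵐ ϑ : ℝ, ϑ ∈ Ioo (-(π / 2)) (π / 2) → DifferentiableAt ℝ ν (a * cos ϑ) := by
  have hl : LipschitzWith ((N (1, 0)).toNNReal * (‖a‖₊ * 1)) (fun ϑ => ν (a * cos ϑ)) := by
    refine h.lipschitzWith.comp ?_
    have h1 : LipschitzWith 1 cos := lipschitzWith_cos
    exact (lipschitzWith_smul a).comp h1
  have h0 : ∀ᵐ ϑ : ℝ, ϑ ≠ 0 := by simp [ae_iff]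
  filter_upwards [hl.ae_differentiableAt_real, h0] with ϑ h1 h2 h3
  -- Rademacher's theorem is applied to `ϑ ↦ ν (a cos ϑ)` itself. Differentiability is carried back
  -- to `ν` by composing with `arccos`, which is differentiable in the open interval; this is why `ϑ
  -- = 0`, where the cosine is `1`, is discarded.
  have key : ∀ ψ ∈ Ioo (0 : ℝ) (π / 2), DifferentiableAt ℝ (fun ϑ => ν (a * cos ϑ)) ψ →
      DifferentiableAt ℝ ν (a * cos ψ) := by
    intro ψ hψ hd
    have hlt : cos ψ < 1 := by
      have := cos_lt_cos_of_nonneg_of_le_pi le_rfl (by linarith [hψ.2, pi_pos]) hψ.1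
      simpa using this
    have hgt : 0 < cos ψ := cos_pos_of_mem_Ioo ⟨by linarith [hψ.1, pi_pos], hψ.2⟩
    have e : ψ = arccos (a * cos ψ / a) := by
      rw [mul_div_cancel_left₀ _ ha, arccos_cos hψ.1.le (by linarith [hψ.2, pi_pos])]
    have hda : DifferentiableAt ℝ (fun s => arccos (s / a)) (a * cos ψ) := by
      refine DifferentiableAt.comp (g := arccos) (f := fun s => s / a) _ ?_ (by fun_prop)
      rw [mul_div_cancel_left₀ _ ha]
      exact differentiableAt_arccos.2 ⟨by linarith, hlt.ne⟩
    have hcomp := DifferentiableAt.comp (g := fun ϑ => ν (a * cos ϑ))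
      (f := fun s => arccos (s / a)) (a * cos ψ) (by rwa [← e]) hda
    refine hcomp.congr_of_eventuallyEq ?_
    have h5 : ∀ᶠ s in 𝓝 (a * cos ψ), s / a ∈ Ioo (-1 : ℝ) 1 := by
      have : ContinuousAt (fun s : ℝ => s / a) (a * cos ψ) := by fun_prop
      refine this.eventually_mem (Ioo_mem_nhds ?_ ?_) <;> rw [mul_div_cancel_left₀ _ ha]
      · linarith
      · exact hlt
    filter_upwards [h5] with s hs
    simp only [Function.comp]
    rw [cos_arccos hs.1.le hs.2.le, mul_div_cancel₀ _ ha]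
  rcases lt_or_gt_of_ne h2 with h4 | h4
  · have h5 := key (-ϑ) ⟨by linarith, by linarith [h3.1]⟩ ?_
    · simpa using h5
    · have h6 := DifferentiableAt.comp (g := fun ϑ => ν (a * cos ϑ)) (f := fun ϑ => -ϑ) (-ϑ)
        (by simpa using h1) (by fun_prop)
      simpa [Function.comp_def] using h6
  · exact key ϑ ⟨h4, h3.2⟩ h1

end IsProfileNorm

/-! ### The lower bound for amoeba lengths, from Jensen's inequality. -/

/-- A seminorm of an interval integral is at most the integral of the seminorm. -/
theorem Seminorm.map_intervalIntegral_le {E : Type*} [NormedAddCommGroup E] [NormedSpace ℝ E]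
    [CompleteSpace E] (N : Seminorm ℝ E) (hN : Continuous N) {P : ℝ → E}
    (hP : ContinuousOn P (Icc 0 1)) : N (∫ t in (0 : ℝ)..1, P t) ≤ ∫ t in (0 : ℝ)..1, N (P t) := by
  have hsub : Ioc (0 : ℝ) 1 ⊆ Icc 0 1 := Ioc_subset_Icc_self
  rw [intervalIntegral.integral_of_le zero_le_one, intervalIntegral.integral_of_le zero_le_one]
  have : IsProbabilityMeasure (volume.restrict (Ioc (0 : ℝ) 1)) := ⟨by simp⟩
  refine ConvexOn.map_integral_le (s := univ) N.convexOn hN.continuousOn isClosed_univ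
    (by simp) ?_ ?_
  · exact (hP.integrableOn_compact isCompact_Icc).mono_set hsub
  · exact ((hN.comp_continuousOn hP).integrableOn_compact isCompact_Icc).mono_set hsub

namespace IsProfileNorm

variable {ν : ℝ → ℝ} {N : Seminorm ℝ (ℝ × ℝ)}

/-- The amoeba length of a curve dominates the norm of the increment of its lift. -/
theorem le_amoebaLength (h : IsProfileNorm ν N) {Ω : Set Plane} {f : Plane → ℝ}
    (hf : ContDiffOn ℝ 1 f Ω) {p q : Plane} {c : ℝ → Plane} (hc : IsRegularCurve Ω p q c) :
    N (f q - f p, ‖q - p‖) ≤ amoebaLength ν f c := by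
  have hfc : ContDiffOn ℝ 1 (fun τ => f (c τ)) (Icc 0 1) := hf.comp hc.contDiffOn hc.mapsTo
  have hud := uniqueDiffOn_Icc (zero_lt_one' ℝ)
  have d1 := hfc.continuousOn_derivWithin hud le_rfl
  have d2 := hc.contDiffOn.continuousOn_derivWithin hud le_rfl
  have i1 := intervalIntegral.integral_derivWithin_Icc_of_contDiffOn_Icc hfc zero_le_one
  have i2 := intervalIntegral.integral_derivWithin_Icc_of_contDiffOn_Icc hc.contDiffOn zero_le_one
  have ii : ∀ {E : Type} [NormedAddCommGroup E] (g : ℝ → E), ContinuousOn g (Icc 0 1) →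
      IntervalIntegrable g volume 0 1 := fun g hg =>
    ContinuousOn.intervalIntegrable (by rwa [uIcc_of_le zero_le_one])
  have e : amoebaLength ν f c = ∫ t in (0 : ℝ)..1,
      N (derivWithin (fun τ => f (c τ)) (Icc 0 1) t, ‖derivWithin c (Icc 0 1) t‖) := by
    refine intervalIntegral.integral_congr fun t ht => ?_
    rw [uIcc_of_le zero_le_one] at ht
    rw [h.apply_pos _ (norm_pos_iff.2 (hc.regular t ht)), mul_comm]
  rw [e]
  have j := N.map_intervalIntegral_le h.norm_continuous (d1.prodMk d2.norm)
  have e2 := integral_pair ((intervalIntegrable_iff_integrableOn_Ioc_of_le zero_le_one).1 (ii _ d1))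
    ((intervalIntegrable_iff_integrableOn_Ioc_of_le zero_le_one).1 (ii _ d2.norm))
  rw [intervalIntegral.integral_of_le zero_le_one, e2,
    ← intervalIntegral.integral_of_le zero_le_one,
    ← intervalIntegral.integral_of_le zero_le_one] at j
  -- Jensen yields the norm of the pair of the increment of `f` and the arc length; the chord is no
  -- longer than the arc.
  refine le_trans ?_ j
  rw [i1, hc.source, hc.target]
  refine h.mono_snd _ (norm_nonneg _) ?_
  rw [← hc.source, ← hc.target, ← i2]
  exact intervalIntegral.norm_integral_le_integral_norm zero_le_one

theorem ofReal_le_amoebaDist (h : IsProfileNorm ν N) {Ω : Set Plane} {f : Plane → ℝ}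
    (hf : ContDiffOn ℝ 1 f Ω) (p q : Plane) :
    ENNReal.ofReal (N (f q - f p, ‖q - p‖)) ≤ amoebaDist ν Ω f p q :=
  le_iInf₂ fun _ hc => ENNReal.ofReal_le_ofReal (h.le_amoebaLength hf hc)

theorem norm_le_of_mem_amoeba (h : IsProfileNorm ν N) {Ω : Set Plane} {f : Plane → ℝ}
    (hf : ContDiffOn ℝ 1 f Ω) {p q : Plane} {ρ : ℝ} (hρ : 0 ≤ ρ) (hq : q ∈ amoeba ν Ω f p ρ) :
    N (f q - f p, ‖q - p‖) ≤ ρ :=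
  (ENNReal.ofReal_le_ofReal_iff hρ).1 ((h.ofReal_le_amoebaDist hf p q).trans hq.2)

end IsProfileNorm

/-! ### Area-preserving polar coordinates and their metric. -/

/-- Area-preserving polar coordinates: the point with polar angle `y / r` and half squared radius
`r ^ 2 / 2 + r * k`. -/
noncomputable def sectorMap (r k y : ℝ) : ℂ :=
  (√(r ^ 2 + 2 * r * k) : ℝ) * Complex.exp ((y / r : ℝ) * Complex.I)

theorem norm_sectorMap (r k y : ℝ) : ‖sectorMap r k y‖ = √(r ^ 2 + 2 * r * k) := by
  rw [sectorMap, norm_mul, Complex.norm_exp_ofReal_mul_I, mul_one, Complex.norm_real,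
    Real.norm_of_nonneg (sqrt_nonneg _)]

theorem sectorMap_zero_right (r k : ℝ) : sectorMap r k 0 = (√(r ^ 2 + 2 * r * k) : ℝ) := by
  simp [sectorMap]

theorem sectorMap_zero {r : ℝ} (hr : 0 < r) : sectorMap r 0 0 = r := by
  simp [sectorMap, sqrt_sq hr.le]

theorem continuous_sectorMap (r : ℝ) : Continuous fun p : ℝ × ℝ => sectorMap r p.1 p.2 := by
  unfold sectorMap
  fun_prop

theorem sectorMap_radicand_pos {r k : ℝ} (hr : 0 < r) (hk : |k| < r / 4) :
    0 < r ^ 2 + 2 * r * k := by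
  have := (abs_lt.1 hk).1
  nlinarith

/-- The velocity of the curve that is a straight line in area-preserving polar coordinates. -/
theorem hasDerivAt_sectorMap_line {r k y t : ℝ} (hr : 0 < r) (hk : |t * k| < r / 4) :
    HasDerivAt (fun t : ℝ => sectorMap r (t * k) (t * y))
      (((r * k / √(r ^ 2 + 2 * r * (t * k)) : ℝ) + (√(r ^ 2 + 2 * r * (t * k)) * y / r : ℝ)
        * Complex.I) * Complex.exp ((t * y / r : ℝ) * Complex.I)) t := by
  have hpos := sectorMap_radicand_pos hr hk
  have h1 : HasDerivAt (fun t : ℝ => √(r ^ 2 + 2 * r * (t * k)))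
      (r * k / √(r ^ 2 + 2 * r * (t * k))) t := by
    have h := (((hasDerivAt_id t).mul_const k).const_mul (2 * r)).const_add (r ^ 2)
    have := h.sqrt (by simpa using hpos.ne')
    convert! this using 1
    simp only [id]
    field_simp
  have h2 : HasDerivAt (fun t : ℝ => t * y / r) (y / r) t := by
    simpa using ((hasDerivAt_id t).mul_const y).div_const r
  have h3 := h1.ofReal_comp.mul ((h2.ofReal_comp.mul_const Complex.I).cexp)
  unfold sectorMap
  convert! h3 using 1
  push_cast
  ring

/-- With `R` the radius, the radial speed is `r * k / R` and the angular one `R * y / r`; the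
rotation factor has modulus one, and `R ^ 2 / r ^ 2 = 1 + 2 * (t * k) / r`. -/
theorem norm_velocity_sectorMap_line {r k y t : ℝ} (hr : 0 < r) (hk : |t * k| < r / 4) :
    ‖((r * k / √(r ^ 2 + 2 * r * (t * k)) : ℝ) + (√(r ^ 2 + 2 * r * (t * k)) * y / r : ℝ)
        * Complex.I) * Complex.exp ((t * y / r : ℝ) * Complex.I)‖ =
      √(k ^ 2 / (1 + 2 * (t * k) / r) + (1 + 2 * (t * k) / r) * y ^ 2) := by
  have hpos := sectorMap_radicand_pos hr hk
  rw [norm_mul, Complex.norm_exp_ofReal_mul_I, mul_one, Complex.norm_add_mul_I]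
  congr 1
  rw [div_pow, div_pow, mul_pow, mul_pow, sq_sqrt hpos.le]
  have : 0 < r + 2 * (t * k) := by
    have e : r ^ 2 + 2 * r * (t * k) = r * (r + 2 * (t * k)) := by ring
    rw [e] at hpos
    exact pos_of_mul_pos_right hpos hr.le
  have e1 : r ^ 2 + 2 * r * (t * k) = r * (r + 2 * (t * k)) := by ring
  have e2 : 1 + 2 * (t * k) / r = (r + 2 * (t * k)) / r := by field_simp
  rw [e1, e2]
  field_simp

/-- A lower bound for the chords that start at the point with coordinates `(0, 0)`. -/
theorem le_norm_sectorMap_sub {r k y : ℝ} (hr : 0 < r) (hk : |k| < r / 4) (hy : |y| < r / 4) :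
    √((k ^ 2 + (1 + 2 * k / r) * (y ^ 2 * (1 - y ^ 2 / r ^ 2))) / (1 + k / r)) ≤
      ‖sectorMap r k y - r‖ := by
  have hpos := sectorMap_radicand_pos hr hk
  set R := √(r ^ 2 + 2 * r * k) with hR
  have hR2 : R ^ 2 = r ^ 2 + 2 * r * k := sq_sqrt hpos.le
  have hR0 : 0 < R := sqrt_pos.2 hpos
  have hk1 := abs_lt.1 hk
  have hrk : 0 < r + k := by linarith
  -- The law of cosines, written so that radial and angular parts can be estimated separately.
  have e0 : ‖sectorMap r k y - r‖ ^ 2 = (R - r) ^ 2 + 2 * R * r * (1 - cos (y / r)) := by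
    have : sectorMap r k y - r = (R * cos (y / r) - r : ℝ) + (R * sin (y / r) : ℝ) * Complex.I := by
      rw [sectorMap, Complex.exp_mul_I, ← hR]
      push_cast
      ring
    rw [this, Complex.norm_add_mul_I, sq_sqrt (by positivity)]
    linear_combination R ^ 2 * sin_sq_add_cos_sq (y / r)
  have hφ : |y / r| ≤ 1 := by
    rw [abs_div, abs_of_pos hr, div_le_one hr]
    linarith
  have e1 : (y / r) ^ 2 / 2 * (1 - y ^ 2 / r ^ 2) ≤ 1 - cos (y / r) := by
    have h1 := (abs_le.1 (cos_bound hφ)).2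
    have h4 : |y / r| ^ 4 = (y / r) ^ 4 := by rw [← abs_pow, abs_of_nonneg (by positivity)]
    rw [h4] at h1
    have : (y / r) ^ 2 / 2 * (1 - y ^ 2 / r ^ 2) = (y / r) ^ 2 / 2 - (y / r) ^ 4 / 2 := by
      field_simp
    rw [this]
    have : 0 ≤ (y / r) ^ 4 := by positivity
    linarith
  have e1' : 0 ≤ 1 - y ^ 2 / r ^ 2 := by
    rw [sub_nonneg, ← div_pow, sq_le_one_iff_abs_le_one]
    exact hφ
  -- This rests on `(R - r) * (R + r) = 2 * r * k` and `(R + r) ^ 2 ≤ 2 * (R ^ 2 + r ^ 2) = 4 * r *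
  -- (r + k)`.
  have e2 : k ^ 2 / (1 + k / r) ≤ (R - r) ^ 2 := by
    have h2 : (R - r) * (R + r) = 2 * r * k := by linear_combination hR2
    have h3 : k ^ 2 / (1 + k / r) = k ^ 2 * r / (r + k) := by field_simp
    rw [h3, div_le_iff₀ hrk]
    have h4 : 4 * r ^ 2 * k ^ 2 = (R - r) ^ 2 * (R + r) ^ 2 := by rw [← mul_pow, h2]; ring
    have h5 : (R + r) ^ 2 ≤ 4 * r * (r + k) := by nlinarith [sq_nonneg (R - r)]
    have h6 : 4 * r ^ 2 * k ^ 2 ≤ (R - r) ^ 2 * (4 * r * (r + k)) := by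
      rw [h4]
      exact mul_le_mul_of_nonneg_left h5 (sq_nonneg _)
    have h7 : r * (4 * (k ^ 2 * r)) ≤ r * (4 * ((R - r) ^ 2 * (r + k))) := by linarith
    have := le_of_mul_le_mul_left h7 hr
    linarith
  -- The left side is `R ^ 2 / (r * (r + k))`, and `R ≤ r + k` because `2 * r * R ≤ R ^ 2 + r ^ 2`.
  have e3 : (1 + 2 * k / r) / (1 + k / r) ≤ R / r := by
    have h3 : (1 + 2 * k / r) / (1 + k / r) = R ^ 2 / (r * (r + k)) := by
      rw [hR2]
      field_simp
    rw [h3, div_le_div_iff₀ (by positivity) hr]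
    have h5 : r * R ≤ r * (r + k) := by nlinarith [sq_nonneg (R - r)]
    nlinarith
  refine sqrt_le_iff.2 ⟨norm_nonneg _, ?_⟩
  rw [e0, add_div]
  refine add_le_add e2 ?_
  calc (1 + 2 * k / r) * (y ^ 2 * (1 - y ^ 2 / r ^ 2)) / (1 + k / r)
      = (1 + 2 * k / r) / (1 + k / r) * (y ^ 2 * (1 - y ^ 2 / r ^ 2)) := by ring
    _ ≤ R / r * (y ^ 2 * (1 - y ^ 2 / r ^ 2)) := by gcongr
    _ = 2 * R * r * ((y / r) ^ 2 / 2 * (1 - y ^ 2 / r ^ 2)) := by field_simp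
    _ ≤ 2 * R * r * (1 - cos (y / r)) := by gcongr

/-- Every point near `r` has small coordinates. -/
theorem exists_sectorMap_eq {r ρ : ℝ} {w : ℂ} (hr : 0 < r) (hρ : ρ ≤ r / 10)
    (hw : ‖w - r‖ ≤ ρ) : ∃ k y : ℝ, sectorMap r k y = w ∧ k ^ 2 + y ^ 2 ≤ 4 * ρ ^ 2 := by
  have hρ0 : 0 ≤ ρ := (norm_nonneg _).trans hw
  set R := ‖w‖ with hR
  have hRr : |R - r| ≤ ρ := by
    have := (abs_norm_sub_norm_le w r).trans hw
    rwa [Complex.norm_real, Real.norm_of_nonneg hr.le] at this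
  have hRl := abs_le.1 hRr
  have hR0 : 0 < R := by linarith
  refine ⟨(R ^ 2 - r ^ 2) / (2 * r), r * w.arg, ?_, ?_⟩
  · have e1 : r ^ 2 + 2 * r * ((R ^ 2 - r ^ 2) / (2 * r)) = R ^ 2 := by field_simp; ring
    rw [sectorMap, e1, sqrt_sq hR0.le, mul_div_cancel_left₀ _ hr.ne']
    exact Complex.norm_mul_exp_arg_mul_I w
  · have e0 : ‖w - r‖ ^ 2 = (R - r) ^ 2 + 2 * R * r * (1 - cos w.arg) := by
      have : w - r = (R * cos w.arg - r : ℝ) + (R * sin w.arg : ℝ) * Complex.I := by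
        conv_lhs => rw [← Complex.norm_mul_exp_arg_mul_I w, Complex.exp_mul_I]
        push_cast
        ring
      rw [this, Complex.norm_add_mul_I, sq_sqrt (by positivity)]
      linear_combination R ^ 2 * sin_sq_add_cos_sq w.arg
    -- A quadratic bound for the cosine valid on all of `[-π, π]`, so no prior smallness of the
    -- angle is needed.
    have e1 := cos_le_one_sub_mul_cos_sq (Complex.abs_arg_le_pi w)
    have e2 : (R - r) ^ 2 + 2 * R * r * (2 / π ^ 2 * w.arg ^ 2) ≤ ρ ^ 2 := by
      refine le_trans ?_ (pow_le_pow_left₀ (norm_nonneg _) hw 2)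
      rw [e0]
      gcongr
      linarith
    have hpi : π ^ 2 < 10 := by nlinarith [pi_lt_d2, pi_pos]
    have hpi' : (1 : ℝ) / 10 ≤ 1 / π ^ 2 := by gcongr
    have hA : 0 ≤ R * r * w.arg ^ 2 := by positivity
    have e3 : (R - r) ^ 2 + 4 / 10 * (R * r * w.arg ^ 2) ≤ ρ ^ 2 := by
      have : 2 * R * r * (2 / π ^ 2 * w.arg ^ 2) = 4 * (1 / π ^ 2 * (R * r * w.arg ^ 2)) := by
        ring
      rw [this] at e2
      have := mul_le_mul_of_nonneg_right hpi' hA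
      linarith
    have e4 : r ^ 2 * w.arg ^ 2 ≤ 10 / 9 * (R * r * w.arg ^ 2) := by
      have : r * (r * w.arg ^ 2) ≤ 10 / 9 * R * (r * w.arg ^ 2) :=
        mul_le_mul_of_nonneg_right (by linarith) (by positivity)
      linarith
    have e5 : ((R ^ 2 - r ^ 2) / (2 * r)) ^ 2 ≤ 441 / 400 * (R - r) ^ 2 := by
      have h1 : (R ^ 2 - r ^ 2) / (2 * r) = (R - r) * ((R + r) / (2 * r)) := by ring
      have h2 : (R + r) / (2 * r) ≤ 21 / 20 := by
        rw [div_le_iff₀ (by positivity)]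
        linarith
      have h3 : ((R + r) / (2 * r)) ^ 2 ≤ (21 / 20) ^ 2 := by gcongr
      rw [h1, mul_pow]
      nlinarith [sq_nonneg (R - r)]
    -- The factors `441 / 400` for the radial part and `(10 / 9) / (4 / 10) = 25 / 9` for the
    -- angular part both stay below `4`.
    rw [mul_pow]
    nlinarith [sq_nonneg (R - r)]

/-- The restriction of a rotationally symmetric function to a ray, in the radial coordinate of
`sectorMap`. -/
noncomputable def radialPart (f : Plane → ℝ) (z : Plane) (L : ℂ ≃ₗᵢ[ℝ] Plane) (r k : ℝ) : ℝ :=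
  f (z + L (sectorMap r k 0))

theorem IsRotSymmOn.eq_radialPart {f : Plane → ℝ} {Ω : Set Plane} {z : Plane}
    (hf : IsRotSymmOn f Ω z) (L : ℂ ≃ₗᵢ[ℝ] Plane) {r k y : ℝ}
    (h : z + L (sectorMap r k y) ∈ Ω) (h0 : z + L (sectorMap r k 0) ∈ Ω) :
    f (z + L (sectorMap r k y)) = radialPart f z L r k := by
  refine hf _ h _ h0 ?_
  simp [norm_sectorMap]

/-! ### The upper bound for amoeba distances, from coordinate lines. -/

namespace IsProfileNorm

variable {ν : ℝ → ℝ} {N : Seminorm ℝ (ℝ × ℝ)}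

/-- An upper bound for the amoeba distance: the length of the curve that is a straight line in
area-preserving polar coordinates. -/
theorem amoebaDist_le (h : IsProfileNorm ν N) {Ω : Set Plane} {f : Plane → ℝ} {z x : Plane}
    (hfz : IsRotSymmOn f Ω z) {L : ℂ ≃ₗᵢ[ℝ] Plane} {r δ : ℝ} (hr : 0 < r) (hL : L r = x - z)
    (hδr : δ ≤ r / 4) (hδ : ∀ k y, |k| < δ → |y| < δ → z + L (sectorMap r k y) ∈ Ω)
    (hfd : ∀ k, |k| < δ → DifferentiableAt ℝ (radialPart f z L r) k) {k y : ℝ}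
    (hk : |k| < δ) (hy : |y| < δ) (hky : k ≠ 0 ∨ y ≠ 0) :
    amoebaDist ν Ω f x (z + L (sectorMap r k y)) ≤ ENNReal.ofReal
      (∫ t in (0 : ℝ)..1, N (deriv (radialPart f z L r) (t * k) * k,
        √(k ^ 2 / (1 + 2 * (t * k) / r) + (1 + 2 * (t * k) / r) * y ^ 2))) := by
  have hmul : ∀ t ∈ Icc (0 : ℝ) 1, ∀ a, |a| < δ → |t * a| < δ := by
    intro t ht a ha
    rw [abs_mul, abs_of_nonneg ht.1]
    exact (mul_le_of_le_one_left (abs_nonneg a) ht.2).trans_lt ha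
  have hud := uniqueDiffOn_Icc (zero_lt_one' ℝ)
  have hpos : ∀ t ∈ Icc (0 : ℝ) 1, 0 < 1 + 2 * (t * k) / r := by
    intro t ht
    have h1 := abs_lt.1 (hmul t ht k hk)
    have : 1 + 2 * (t * k) / r = (r + 2 * (t * k)) / r := by field_simp
    rw [this]
    exact div_pos (by linarith) hr
  set c : ℝ → Plane := fun t => z + L (sectorMap r (t * k) (t * y)) with hc
  have hder : ∀ t ∈ Icc (0 : ℝ) 1, ∃ v : Plane, HasDerivAt c v t ∧
      ‖v‖ = √(k ^ 2 / (1 + 2 * (t * k) / r) + (1 + 2 * (t * k) / r) * y ^ 2) := by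
    intro t ht
    have h1 := (hmul t ht k hk).trans_le hδr
    refine ⟨_, ((L.toContinuousLinearEquiv.hasFDerivAt.comp_hasDerivAt t
      (hasDerivAt_sectorMap_line (y := y) hr h1)).const_add z), ?_⟩
    rw [← norm_velocity_sectorMap_line (y := y) hr h1]
    exact L.norm_map _
  have hnorm : ∀ t ∈ Icc (0 : ℝ) 1, ‖derivWithin c (Icc 0 1) t‖ =
      √(k ^ 2 / (1 + 2 * (t * k) / r) + (1 + 2 * (t * k) / r) * y ^ 2) := by
    intro t ht
    obtain ⟨v, hv, hvn⟩ := hder t ht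
    rw [hv.hasDerivWithinAt.derivWithin (hud t ht), hvn]
  -- Regularity of the curve is where the end point has to differ from `x`.
  have hspeed : ∀ t ∈ Icc (0 : ℝ) 1,
      0 < √(k ^ 2 / (1 + 2 * (t * k) / r) + (1 + 2 * (t * k) / r) * y ^ 2) := by
    intro t ht
    have := hpos t ht
    refine sqrt_pos.2 ?_
    rcases hky with h0 | h0 <;> positivity
  have hmaps : MapsTo c (Icc 0 1) Ω := fun t ht =>
    hδ _ _ (hmul t ht k hk) (hmul t ht y hy)
  have hcurve : IsRegularCurve Ω x (z + L (sectorMap r k y)) c := by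
    refine ⟨?_, ?_, hmaps, ?_, ?_⟩
    · intro t ht
      refine ContDiffAt.contDiffWithinAt ?_
      refine contDiffAt_const.add ?_
      refine L.toContinuousLinearEquiv.contDiff.contDiffAt.comp t ?_
      have h1 := sectorMap_radicand_pos hr ((hmul t ht k hk).trans_le hδr)
      refine ContDiffAt.mul ?_ ?_
      · refine Complex.ofRealCLM.contDiff.contDiffAt.comp t ?_
        exact ContDiffAt.sqrt (by fun_prop) h1.ne'
      · refine ContDiffAt.cexp (ContDiffAt.mul ?_ contDiffAt_const)
        exact Complex.ofRealCLM.contDiff.contDiffAt.comp t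
          ((contDiffAt_id.mul contDiffAt_const).div_const r)
    · intro t ht h0
      have h1 := hnorm t ht
      rw [h0, norm_zero] at h1
      exact (hspeed t ht).ne h1
    · simp [hc, sectorMap_zero hr, hL]
    · simp [hc]
  refine (iInf₂_le c hcurve).trans (ENNReal.ofReal_le_ofReal (le_of_eq ?_))
  refine intervalIntegral.integral_congr fun t ht => ?_
  rw [uIcc_of_le zero_le_one] at ht
  have h1 : derivWithin (fun τ => f (c τ)) (Icc 0 1) t = deriv (radialPart f z L r) (t * k) * k := by
    have e : ∀ τ ∈ Icc (0 : ℝ) 1, f (c τ) = radialPart f z L r (τ * k) := fun τ hτ =>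
      hfz.eq_radialPart L (hmaps hτ)
        (hδ _ _ (hmul τ hτ k hk) (by simpa using (abs_nonneg k).trans_lt hk))
    rw [derivWithin_congr e (e t ht)]
    have h2 := (hfd _ (hmul t ht k hk)).hasDerivAt.comp t ((hasDerivAt_id t).mul_const k)
    rw [one_mul] at h2
    exact h2.hasDerivWithinAt.derivWithin (hud t ht)
  simp only [h1, hnorm t ht]
  rw [h.apply_pos _ (hspeed t ht), mul_comm]

end IsProfileNorm

/-! ### Areas in the scaled chart. -/

/-- Polar coordinates in the plane of the scaled and shifted coordinates of `sectorMap`. -/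
noncomputable def amoebaChart (r σ c ρ : ℝ) (p : ℝ × ℝ) : ℂ :=
  sectorMap r (ρ * (σ * (p.1 * cos p.2) + c * ρ)) (ρ * (p.1 * sin p.2))

/-- The chart is a composition of polar coordinates, a product map and inverse polar coordinates, up
to an isometry. The Jacobians multiply to `σ * ρ ^ 2 * s`, with `s` the inner radius: the outer
radius `g₁` cancels against the derivative of the square root. -/
theorem volume_amoebaChart_image {r σ c ρ : ℝ} (hr : 0 < r) (hσ : |σ| = 1) (hρ : 0 < ρ)
    {S : Set (ℝ × ℝ)} (hS : MeasurableSet S) (hS0 : S ⊆ Ioi 0 ×ˢ Ioo (-π) π)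
    (hS1 : ∀ p ∈ S, |ρ * (σ * (p.1 * cos p.2) + c * ρ)| < r / 4)
    (hS2 : ∀ p ∈ S, |ρ * (p.1 * sin p.2)| < r / 4) (z : Plane) (L : ℂ ≃ₗᵢ[ℝ] Plane) :
    volume ((fun p => z + L (amoebaChart r σ c ρ p)) '' S) =
      ∫⁻ p in S, ENNReal.ofReal (ρ ^ 2 * p.1) := by
  have hσ0 : σ ≠ 0 := by
    rintro rfl
    simp at hσ
  set g₁ : ℝ → ℝ := fun X => √(r ^ 2 + 2 * r * (ρ * (σ * X + c * ρ))) with hg₁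
  set g₂ : ℝ → ℝ := fun Y => ρ * Y / r with hg₂
  have e1 : ∀ p : ℝ × ℝ, amoebaChart r σ c ρ p = Complex.measurableEquivRealProd.symm
      (polarCoord.symm (Prod.map g₁ g₂ (polarCoord.symm p))) := by
    intro p
    rw [Complex.measurableEquivRealProd_symm_polarCoord_symm_apply, Complex.polarCoord_symm_apply,
      amoebaChart, sectorMap, Complex.exp_mul_I]
    simp [hg₁, hg₂]
  have hpos : ∀ p ∈ S, 0 < r ^ 2 + 2 * r * (ρ * (σ * (p.1 * cos p.2) + c * ρ)) := fun p hp =>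
    sectorMap_radicand_pos hr (hS1 p hp)
  have e2 : (fun p => z + L (amoebaChart r σ c ρ p)) '' S =
      (fun q => z + q) '' (L '' (Complex.measurableEquivRealProd.symm ''
        ((fun p => polarCoord.symm (Prod.map g₁ g₂ (polarCoord.symm p))) '' S))) := by
    simp only [image_image, e1]
  have e3 : volume ((fun p => z + L (amoebaChart r σ c ρ p)) '' S) =
      volume ((fun p => polarCoord.symm (Prod.map g₁ g₂ (polarCoord.symm p))) '' S) := by
    rw [e2, image_add_left, measure_preimage_add, ← L.coe_toMeasurableEquiv,
      MeasurableEquiv.image_eq_preimage_symm,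
      (L.measurePreserving.symm L.toMeasurableEquiv).measure_preimage_equiv,
      MeasurableEquiv.image_eq_preimage_symm, MeasurableEquiv.symm_symm,
      Complex.volume_preserving_equiv_real_prod.measure_preimage_equiv]
  rw [e3]
  have hd : ∀ p ∈ S, HasFDerivAt (fun p => polarCoord.symm (Prod.map g₁ g₂ (polarCoord.symm p)))
      ((fderivPolarCoordSymm (Prod.map g₁ g₂ (polarCoord.symm p))).comp
        (((ContinuousLinearMap.toSpanSingleton ℝ (r * ρ * σ / g₁ (p.1 * cos p.2))).prodMap
          (ContinuousLinearMap.toSpanSingleton ℝ (ρ / r))).comp (fderivPolarCoordSymm p))) p := by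
    intro p hp
    have h1 : HasDerivAt g₁ (r * ρ * σ / g₁ (p.1 * cos p.2)) (p.1 * cos p.2) := by
      have h := ((((hasDerivAt_id (p.1 * cos p.2)).const_mul σ).add_const (c * ρ)).const_mul
        ρ).const_mul (2 * r) |>.const_add (r ^ 2)
      have := h.sqrt (by simpa using (hpos p hp).ne')
      convert! this using 1
      simp only [id, hg₁]
      field_simp
    have h2 : HasDerivAt g₂ (ρ / r) (p.1 * sin p.2) := by
      simpa using ((hasDerivAt_id (p.1 * sin p.2)).const_mul ρ).div_const r
    have h3 : HasFDerivAt (Prod.map g₁ g₂) _ (polarCoord.symm p) :=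
      HasFDerivAt.prodMap (polarCoord.symm p) h1.hasFDerivAt h2.hasFDerivAt
    exact (hasFDerivAt_polarCoord_symm _).comp p (h3.comp p (hasFDerivAt_polarCoord_symm p))
  have hmem : ∀ p ∈ S, Prod.map g₁ g₂ (polarCoord.symm p) ∈ polarCoord.target := by
    intro p hp
    refine ⟨sqrt_pos.2 (hpos p hp), ?_⟩
    have h1 := hS2 p hp
    have h2 : |ρ * (p.1 * sin p.2) / r| < π := by
      rw [abs_div, abs_of_pos hr, div_lt_iff₀ hr]
      nlinarith [pi_gt_three]
    exact abs_lt.1 h2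
  have hinj : InjOn (fun p => polarCoord.symm (Prod.map g₁ g₂ (polarCoord.symm p))) S := by
    intro p hp q hq hpq
    have h1 := polarCoord.symm.injOn (hmem p hp) (hmem q hq) hpq
    refine polarCoord.symm.injOn (hS0 hp) (hS0 hq) ?_
    rw [Prod.ext_iff] at h1
    obtain ⟨h2, h3⟩ := h1
    simp only [Prod.map, polarCoord_symm_apply, hg₁, hg₂] at h2 h3
    rw [sqrt_inj (hpos p hp).le (hpos q hq).le] at h2
    simp only [polarCoord_symm_apply]
    ext
    · simp only
      have h4 : (2 * r * ρ * σ) * (p.1 * cos p.2) = (2 * r * ρ * σ) * (q.1 * cos q.2) := by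
        linear_combination h2
      exact mul_left_cancel₀ (by positivity) h4
    · simp only
      field_simp at h3
      exact h3
  rw [← lintegral_abs_det_fderiv_eq_addHaar_image volume hS
    (fun p hp => (hd p hp).hasFDerivWithinAt) hinj]
  refine setLIntegral_congr_fun hS fun p hp => ?_
  have hs : 0 < p.1 := (hS0 hp).1
  have hg : 0 < g₁ (p.1 * cos p.2) := sqrt_pos.2 (hpos p hp)
  have hdet : ((fderivPolarCoordSymm (Prod.map g₁ g₂ (polarCoord.symm p))).comp
        (((ContinuousLinearMap.toSpanSingleton ℝ (r * ρ * σ / g₁ (p.1 * cos p.2))).prodMap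
          (ContinuousLinearMap.toSpanSingleton ℝ (ρ / r))).comp (fderivPolarCoordSymm p))).det =
      g₁ (p.1 * cos p.2) * ((r * ρ * σ / g₁ (p.1 * cos p.2) * (ρ / r)) * p.1) := by
    have hA : ∀ A B : ℝ × ℝ →L[ℝ] ℝ × ℝ, (A.comp B).det = A.det * B.det := fun A B =>
      LinearMap.det_comp _ _
    rw [hA, hA, det_fderivPolarCoordSymm, det_fderivPolarCoordSymm]
    congr 2
    have : ∀ a b : ℝ, ((ContinuousLinearMap.toSpanSingleton ℝ a).prodMap
        (ContinuousLinearMap.toSpanSingleton ℝ b)).det = a * b := by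
      intro a b
      have := LinearMap.det_prodMap (LinearMap.toSpanSingleton ℝ ℝ a)
        (LinearMap.toSpanSingleton ℝ ℝ b)
      rw [LinearMap.det_ring, LinearMap.det_ring] at this
      simp only [LinearMap.toSpanSingleton_apply, one_smul] at this
      exact this
    exact this _ _
  have h5 : g₁ (p.1 * cos p.2) * ((r * ρ * σ / g₁ (p.1 * cos p.2) * (ρ / r)) * p.1) =
      σ * (ρ ^ 2 * p.1) := by
    field_simp
  rw [hdet, h5, abs_mul, hσ, one_mul, abs_of_nonneg (by positivity)]

/-! ### First-order expansion of areas of perturbed sublevel sets. -/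

theorem integral_indicator_Iic_sub_indicator_Iic (a : ℝ) :
    ∫ τ : ℝ, ((Iic a).indicator (fun _ => (1 : ℝ)) τ - (Iic 0).indicator (fun _ => (1 : ℝ)) τ) =
      a := by
  rcases le_total 0 a with h | h
  · have e : (fun τ : ℝ => (Iic a).indicator (fun _ => (1 : ℝ)) τ -
        (Iic 0).indicator (fun _ => (1 : ℝ)) τ) = (Ioc 0 a).indicator fun _ => (1 : ℝ) := by
      ext τ
      simp only [indicator, mem_Iic, mem_Ioc]
      split_ifs <;> grind
    rw [e, integral_indicator measurableSet_Ioc]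
    simp [h]
  · have e : (fun τ : ℝ => (Iic a).indicator (fun _ => (1 : ℝ)) τ -
        (Iic 0).indicator (fun _ => (1 : ℝ)) τ) = (Ioc a 0).indicator fun _ => (-1 : ℝ) := by
      ext τ
      simp only [indicator, mem_Iic, mem_Ioc]
      split_ifs <;> grind
    rw [e, integral_indicator measurableSet_Ioc]
    simp [h]

section Sublevel

/-- The difference of the sublevel weights of a perturbed and of the unperturbed radial
function `s ↦ n * s`. -/
noncomputable def sublevelDefect (D : ℝ → ℝ) (n s : ℝ) : ℝ :=
  (if 0 < s ∧ s < 3 ∧ D s ≤ 1 then s else 0) - (if 0 < s ∧ s ≤ 1 / n then s else 0)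

variable {D : ℝ → ℝ} {n K ρ : ℝ}

theorem measurable_sublevelDefect (hD : Measurable D) : Measurable (sublevelDefect D n) := by
  refine Measurable.sub ?_ ?_
  · refine Measurable.ite ?_ measurable_id measurable_const
    exact measurableSet_Ioi.inter (measurableSet_Iio.inter (measurableSet_le hD measurable_const))
  · exact Measurable.ite measurableSet_Ioc measurable_id measurable_const

/-- The unperturbed function has slope `n ≥ 1` and crosses the level `1` at `1 / n`. At a distance
beyond `K * ρ` from there, an error of `K * ρ` cannot change the side. -/
theorem sublevelDefect_eq_zero (hn : 1 ≤ n) (hK : 0 ≤ K) (hρ : 0 ≤ ρ)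
    (hb : ∀ s ∈ Ioo (0 : ℝ) 3, |D s - s * n| ≤ K * ρ) {s : ℝ} (hs : K * ρ < |s - 1 / n|) :
    sublevelDefect D n s = 0 := by
  have hn0 : 0 < n := by linarith
  have h1 : 1 / n ≤ 1 := by rw [div_le_one hn0]; exact hn
  have hKρ : 0 ≤ K * ρ := mul_nonneg hK hρ
  unfold sublevelDefect
  by_cases hs0 : 0 < s
  swap
  · simp [hs0]
  by_cases hs3 : s < 3
  swap
  · have : ¬ s ≤ 1 / n := by linarith
    rw [if_neg (by tauto), if_neg (by tauto), sub_zero]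
  have hb' := abs_le.1 (hb s ⟨hs0, hs3⟩)
  have e : 1 / n * n = 1 := by field_simp
  rcases lt_abs.1 hs with h | h
  · have h2 : ¬ s ≤ 1 / n := by linarith
    have h3 : ¬ D s ≤ 1 := by nlinarith
    rw [if_neg (by tauto), if_neg (by tauto), sub_zero]
  · have h2 : s ≤ 1 / n := by linarith
    have h3 : D s ≤ 1 := by nlinarith
    rw [if_pos ⟨hs0, hs3, h3⟩, if_pos ⟨hs0, h2⟩, sub_self]

theorem abs_sublevelDefect_le (hn : 1 ≤ n) (s : ℝ) : |sublevelDefect D n s| ≤ 3 := by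
  have h1 : 1 / n ≤ 1 := by rw [div_le_one (by linarith)]; exact hn
  unfold sublevelDefect
  split_ifs <;> rw [abs_le] <;> constructor <;> linarith

/-- Blowing up the transition zone at scale `ρ` gives an integrable bound independent of `ρ`, as
dominated convergence requires. -/
theorem abs_sublevelDefect_scaled_le (hn : 1 ≤ n) (hK : 0 ≤ K) (hρ : 0 < ρ)
    (hb : ∀ s ∈ Ioo (0 : ℝ) 3, |D s - s * n| ≤ K * ρ) (τ : ℝ) :
    |sublevelDefect D n (1 / n + ρ * τ)| ≤ (Icc (-K) K).indicator (fun _ => (3 : ℝ)) τ := by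
  by_cases hτ : τ ∈ Icc (-K) K
  · rw [indicator_of_mem hτ]
    exact abs_sublevelDefect_le hn _
  · rw [indicator_of_notMem hτ, sublevelDefect_eq_zero hn hK hρ.le hb, abs_zero]
    rw [add_sub_cancel_left, abs_mul, abs_of_pos hρ, mul_comm]
    refine mul_lt_mul_of_pos_left ?_ hρ
    rw [← not_le, abs_le]
    exact hτ

/-- The substitution `s = 1 / n + ρ * τ` absorbs the division by `ρ`; the subtracted constant is the
integral of `s` over the unperturbed interval. -/
theorem integral_sublevel_sub_div (hn : 1 ≤ n) (hD : Measurable D) (hρ : 0 < ρ) :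
    ((∫ s in Ioo (0 : ℝ) 3, if D s ≤ 1 then s else 0) - 1 / (2 * n ^ 2)) / ρ =
      ∫ τ, sublevelDefect D n (1 / n + ρ * τ) := by
  have hn0 : 0 < n := by linarith
  have h1 : 1 / n ≤ 1 := by rw [div_le_one hn0]; exact hn
  have e1 : (∫ s in Ioo (0 : ℝ) 3, if D s ≤ 1 then s else 0) =
      ∫ s, if 0 < s ∧ s < 3 ∧ D s ≤ 1 then s else 0 := by
    rw [← integral_indicator measurableSet_Ioo]
    congr 1
    ext s
    simp only [indicator, mem_Ioo]
    split_ifs <;> tauto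
  have e2 : 1 / (2 * n ^ 2) = ∫ s, if 0 < s ∧ s ≤ 1 / n then s else 0 := by
    have : (fun s : ℝ => if 0 < s ∧ s ≤ 1 / n then s else 0) =
        (Ioc 0 (1 / n)).indicator fun s => s := by
      ext s
      simp [indicator]
    rw [this, integral_indicator measurableSet_Ioc, ← intervalIntegral.integral_of_le (by positivity),
      integral_id]
    field_simp
    simp
  have i1 : Integrable fun s : ℝ => if 0 < s ∧ s < 3 ∧ D s ≤ 1 then s else 0 := by
    have hm : MeasurableSet {s : ℝ | 0 < s ∧ s < 3 ∧ D s ≤ 1} :=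
      measurableSet_Ioi.inter (measurableSet_Iio.inter (measurableSet_le hD measurable_const))
    have : (fun s : ℝ => if 0 < s ∧ s < 3 ∧ D s ≤ 1 then s else 0) =
        {s : ℝ | 0 < s ∧ s < 3 ∧ D s ≤ 1}.indicator fun s => s := by
      ext s
      simp [indicator]
    rw [this, integrable_indicator_iff hm]
    refine IntegrableOn.mono_set (t := Icc 0 3) ?_ fun s hs => ⟨hs.1.le, hs.2.1.le⟩
    exact continuous_id.integrableOn_Icc
  have i2 : Integrable fun s : ℝ => if 0 < s ∧ s ≤ 1 / n then s else 0 := by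
    have : (fun s : ℝ => if 0 < s ∧ s ≤ 1 / n then s else 0) =
        (Ioc 0 (1 / n)).indicator fun s => s := by
      ext s
      simp [indicator]
    rw [this, integrable_indicator_iff measurableSet_Ioc]
    exact continuous_id.integrableOn_Ioc
  have e3 : ∫ τ, sublevelDefect D n (1 / n + ρ * τ) = ρ⁻¹ * ∫ s, sublevelDefect D n s := by
    rw [Measure.integral_comp_mul_left (fun t => sublevelDefect D n (1 / n + t)),
      integral_add_left_eq_self, abs_of_pos (inv_pos.2 hρ), smul_eq_mul]
  rw [e1, e2, e3, ← integral_sub i1 i2, div_eq_inv_mul]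
  rfl

theorem abs_integral_sublevel_sub_div_le (hn : 1 ≤ n) (hK : 0 ≤ K) (hD : Measurable D)
    (hρ : 0 < ρ) (hb : ∀ s ∈ Ioo (0 : ℝ) 3, |D s - s * n| ≤ K * ρ) :
    |((∫ s in Ioo (0 : ℝ) 3, if D s ≤ 1 then s else 0) - 1 / (2 * n ^ 2)) / ρ| ≤ 6 * K := by
  rw [integral_sublevel_sub_div hn hD hρ, ← Real.norm_eq_abs]
  refine (norm_integral_le_of_norm_le (g := (Icc (-K) K).indicator fun _ => (3 : ℝ)) ?_
    (Eventually.of_forall fun τ => abs_sublevelDefect_scaled_le hn hK hρ hb τ)).trans ?_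
  · rw [integrable_indicator_iff measurableSet_Icc]
    exact continuous_const.integrableOn_Icc
  · rw [integral_indicator measurableSet_Icc, setIntegral_const, smul_eq_mul, measureReal_def,
      Real.volume_Icc, ENNReal.toReal_ofReal (by linarith)]
    linarith

/-- First-order expansion of the weighted length of a sublevel set. -/
theorem tendsto_integral_sublevel {D : ℝ → ℝ → ℝ} {E : ℝ} (hn : 1 ≤ n) (hK : 0 ≤ K)
    (hD : ∀ ρ, Measurable (D ρ))
    (hb : ∀ᶠ ρ in 𝓝[>] (0 : ℝ), ∀ s ∈ Ioo (0 : ℝ) 3, |D ρ s - s * n| ≤ K * ρ)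
    (hl : ∀ τ, Tendsto (fun ρ => (D ρ (1 / n + ρ * τ) - 1) / ρ) (𝓝[>] 0) (𝓝 (n * τ + E))) :
    Tendsto (fun ρ => ((∫ s in Ioo (0 : ℝ) 3, if D ρ s ≤ 1 then s else 0) - 1 / (2 * n ^ 2)) / ρ)
      (𝓝[>] 0) (𝓝 (-(E / n ^ 2))) := by
  have hn0 : 0 < n := by linarith
  have h1 : 1 / n ≤ 1 := by rw [div_le_one hn0]; exact hn
  have h1' : 0 < 1 / n := by positivity
  have hpos : ∀ᶠ ρ in 𝓝[>] (0 : ℝ), 0 < ρ := eventually_mem_nhdsWithin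
  -- In the blown-up variable the end of the sublevel interval moves from `0` to `-(E / n)`, and the
  -- weight `s` becomes the constant `1 / n`.
  have hlim : -(E / n ^ 2) = ∫ τ : ℝ, ((Iic (-(E / n))).indicator (fun _ => (1 : ℝ)) τ -
      (Iic 0).indicator (fun _ => (1 : ℝ)) τ) * (1 / n) := by
    rw [integral_mul_const, integral_indicator_Iic_sub_indicator_Iic]
    field_simp
  rw [hlim]
  have key : Tendsto (fun ρ => ∫ τ, sublevelDefect (D ρ) n (1 / n + ρ * τ)) (𝓝[>] 0)
      (𝓝 (∫ τ : ℝ, ((Iic (-(E / n))).indicator (fun _ => (1 : ℝ)) τ -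
        (Iic 0).indicator (fun _ => (1 : ℝ)) τ) * (1 / n))) := by
    refine tendsto_integral_filter_of_dominated_convergence
      ((Icc (-K) K).indicator fun _ => (3 : ℝ)) ?_ ?_ ?_ ?_
    · refine Eventually.of_forall fun ρ => Measurable.aestronglyMeasurable ?_
      exact (measurable_sublevelDefect (hD ρ)).comp (by fun_prop)
    · filter_upwards [hb, hpos] with ρ h2 h3
      exact Eventually.of_forall fun τ => abs_sublevelDefect_scaled_le hn hK h3 h2 τ
    · rw [integrable_indicator_iff measurableSet_Icc]
      exact continuous_const.integrableOn_Icc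
    -- At `τ = -(E / n)` the limit of the scaled defect is zero and does not decide membership; away
    -- from it the sign is eventually constant.
    · have n0 : ∀ᵐ τ : ℝ, τ ≠ 0 := by simp [ae_iff]
      have n1 : ∀ᵐ τ : ℝ, τ ≠ -(E / n) := by simp [ae_iff]
      filter_upwards [n0, n1] with τ hτ0 hτ1
      have hs : Tendsto (fun ρ : ℝ => 1 / n + ρ * τ) (𝓝[>] 0) (𝓝 (1 / n)) := by
        have : Continuous fun ρ : ℝ => 1 / n + ρ * τ := by fun_prop
        simpa using (this.tendsto 0).mono_left nhdsWithin_le_nhds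
      have hs0 := hs.eventually (Ioo_mem_nhds h1' (show 1 / n < 3 by linarith))
      have ev1 : ∀ᶠ ρ in 𝓝[>] (0 : ℝ), (if D ρ (1 / n + ρ * τ) ≤ 1 then (1 : ℝ) else 0) =
          (Iic (-(E / n))).indicator (fun _ => (1 : ℝ)) τ := by
        rcases lt_or_gt_of_ne hτ1 with h2 | h2
        · have h3 : n * τ + E < 0 := by
            have := mul_lt_mul_of_pos_left h2 hn0
            have e : n * -(E / n) = -E := by field_simp
            linarith
          filter_upwards [(hl τ).eventually (Iio_mem_nhds h3), hpos] with ρ h4 h5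
          have h6 := mul_neg_of_neg_of_pos h4 h5
          rw [div_mul_cancel₀ _ h5.ne'] at h6
          rw [indicator_of_mem (show τ ∈ Iic (-(E / n)) from h2.le), if_pos (by linarith)]
        · have h3 : 0 < n * τ + E := by
            have := mul_lt_mul_of_pos_left h2 hn0
            have e : n * -(E / n) = -E := by field_simp
            linarith
          filter_upwards [(hl τ).eventually (Ioi_mem_nhds h3), hpos] with ρ h4 h5
          have h6 := mul_pos (mem_Ioi.1 h4) h5
          rw [div_mul_cancel₀ _ h5.ne'] at h6
          rw [indicator_of_notMem (show τ ∉ Iic (-(E / n)) from not_le.2 h2),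
            if_neg (by linarith)]
      have ev2 : ∀ᶠ ρ in 𝓝[>] (0 : ℝ), (if 1 / n + ρ * τ ≤ 1 / n then (1 : ℝ) else 0) =
          (Iic 0).indicator (fun _ => (1 : ℝ)) τ := by
        filter_upwards [hpos] with ρ h5
        have : 1 / n + ρ * τ ≤ 1 / n ↔ τ ≤ 0 := by
          rw [add_le_iff_nonpos_right, mul_nonpos_iff_pos_imp_nonpos]
          exact ⟨fun h => h.1 h5, fun h => ⟨fun _ => h, fun _ => h5.le.trans' (by linarith)⟩⟩
        simp only [this, indicator, mem_Iic]
      have hconv := hs.const_mul ((Iic (-(E / n))).indicator (fun _ => (1 : ℝ)) τ -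
        (Iic 0).indicator (fun _ => (1 : ℝ)) τ)
      refine hconv.congr' ?_
      filter_upwards [ev1, ev2, hs0] with ρ h2 h3 h4
      rw [← h2, ← h3]
      unfold sublevelDefect
      have h5 := h4.1
      have h6 := h4.2
      simp only [h5, h6, true_and]
      split_ifs <;> ring
  refine key.congr' ?_
  filter_upwards [hpos] with ρ h2
  exact (integral_sublevel_sub_div hn (hD ρ) h2).symm

/-- First-order expansion of the weighted area of a sublevel set. -/
theorem tendsto_integral_integral_sublevel {α : Type*} [MeasurableSpace α] {μ : Measure α}
    [IsFiniteMeasure μ] {D : ℝ → α → ℝ → ℝ} {n E : α → ℝ} (hn : ∀ ϑ, 1 ≤ n ϑ)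
    (hnm : Measurable n) (hK : 0 ≤ K) (hD : ∀ ρ, Measurable fun p : α × ℝ => D ρ p.1 p.2)
    (hb : ∀ᶠ ρ in 𝓝[>] (0 : ℝ), ∀ ϑ, ∀ s ∈ Ioo (0 : ℝ) 3, |D ρ ϑ s - s * n ϑ| ≤ K * ρ)
    (hl : ∀ᵐ ϑ ∂μ, ∀ τ, Tendsto (fun ρ => (D ρ ϑ (1 / n ϑ + ρ * τ) - 1) / ρ) (𝓝[>] 0)
      (𝓝 (n ϑ * τ + E ϑ))) :
    Tendsto (fun ρ => ∫ ϑ, ((∫ s in Ioo (0 : ℝ) 3, if D ρ ϑ s ≤ 1 then s else 0) -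
      1 / (2 * n ϑ ^ 2)) / ρ ∂μ) (𝓝[>] 0) (𝓝 (-∫ ϑ, E ϑ / n ϑ ^ 2 ∂μ)) := by
  rw [← integral_neg]
  refine tendsto_integral_filter_of_dominated_convergence (fun _ => 6 * K) ?_ ?_
    (integrable_const _) ?_
  · refine Eventually.of_forall fun ρ => ?_
    have h1 : StronglyMeasurable fun p : α × ℝ => if D ρ p.1 p.2 ≤ 1 then p.2 else 0 :=
      (Measurable.ite (measurableSet_le (hD ρ) measurable_const) measurable_snd
        measurable_const).stronglyMeasurable
    have h2 : StronglyMeasurable fun ϑ => ∫ s in Ioo (0 : ℝ) 3, if D ρ ϑ s ≤ 1 then s else 0 :=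
      h1.integral_prod_right'
    have h3 : Measurable fun ϑ => 1 / (2 * n ϑ ^ 2) := by fun_prop
    exact ((h2.measurable.sub h3).div_const ρ).aestronglyMeasurable
  · filter_upwards [hb, eventually_mem_nhdsWithin] with ρ h1 h2
    exact Eventually.of_forall fun ϑ => abs_integral_sublevel_sub_div_le (hn ϑ) hK
      ((hD ρ).comp measurable_prodMk_left) h2 (h1 ϑ)
  · filter_upwards [hl] with ϑ h1
    refine tendsto_integral_sublevel (hn ϑ) hK (fun ρ => (hD ρ).comp measurable_prodMk_left) ?_ h1
    filter_upwards [hb] with ρ h2 using h2 ϑ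

end Sublevel

/-! ### First-order expansion of the upper and lower scaled lengths. -/

theorem abs_sqrt_sub_sqrt_le (a b c d : ℝ) :
    |√(a ^ 2 + b ^ 2) - √(c ^ 2 + d ^ 2)| ≤ |a - c| + |b - d| := by
  rw [← Complex.norm_add_mul_I, ← Complex.norm_add_mul_I]
  refine (abs_norm_sub_norm_le _ _).trans ?_
  have e : (a + b * Complex.I - (c + d * Complex.I) : ℂ) = (a - c : ℝ) + (b - d : ℝ) * Complex.I := by
    push_cast
    ring
  rw [e]
  refine (norm_add_le _ _).trans ?_
  rw [norm_mul, Complex.norm_I, mul_one, Complex.norm_real, Complex.norm_real, Real.norm_eq_abs,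
    Real.norm_eq_abs]

theorem abs_sqrt_sub_one_le {α : ℝ} (hα : 0 ≤ α) : |√α - 1| ≤ |α - 1| := by
  have h : α - 1 = (√α - 1) * (√α + 1) := by linear_combination -sq_sqrt hα
  rw [h, abs_mul]
  refine le_mul_of_one_le_right (abs_nonneg _) ?_
  rw [abs_of_nonneg (by positivity)]
  linarith [sqrt_nonneg α]

theorem abs_sqrt_weighted_sub_le {α β X Y X₀ Y₀ : ℝ} (hα : 0 ≤ α) (hβ : 0 ≤ β) :
    |√(α * X ^ 2 + β * Y ^ 2) - √(X₀ ^ 2 + Y₀ ^ 2)| ≤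
      |α - 1| * |X| + |X - X₀| + (|β - 1| * |Y| + |Y - Y₀|) := by
  have e : α * X ^ 2 + β * Y ^ 2 = (√α * X) ^ 2 + (√β * Y) ^ 2 := by
    rw [mul_pow, mul_pow, sq_sqrt hα, sq_sqrt hβ]
  rw [e]
  refine (abs_sqrt_sub_sqrt_le _ _ _ _).trans ?_
  have h : ∀ {γ Z Z₀ : ℝ}, 0 ≤ γ → |√γ * Z - Z₀| ≤ |γ - 1| * |Z| + |Z - Z₀| := by
    intro γ Z Z₀ hγ
    have e : √γ * Z - Z₀ = (√γ - 1) * Z + (Z - Z₀) := by ring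
    rw [e]
    refine (abs_add_le _ _).trans ?_
    rw [abs_mul]
    have := mul_le_mul_of_nonneg_right (abs_sqrt_sub_one_le hγ) (abs_nonneg Z)
    linarith
  exact add_le_add (h hα) (h hβ)

/-- Differentiation at `0` under the integral sign, for an integrand that is constant at `0`. -/
theorem hasDerivAt_integral_zero_of_bound {G : ℝ → ℝ → ℝ} {G' : ℝ → ℝ} {G₀ C : ℝ}
    (hm : ∀ ρ, Measurable (G ρ)) (h0 : ∀ t, G 0 t = G₀)
    (hb : ∀ᶠ ρ in 𝓝 (0 : ℝ), ∀ t ∈ Icc (0 : ℝ) 1, |G ρ t - G₀| ≤ C * |ρ|)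
    (hd : ∀ t ∈ Icc (0 : ℝ) 1, HasDerivAt (fun ρ => G ρ t) (G' t) 0) :
    HasDerivAt (fun ρ => ∫ t in (0 : ℝ)..1, G ρ t) (∫ t in (0 : ℝ)..1, G' t) 0 := by
  have hsub : uIoc (0 : ℝ) 1 ⊆ Icc 0 1 := by
    rw [uIoc_of_le zero_le_one]
    exact Ioc_subset_Icc_self
  rw [hasDerivAt_iff_tendsto_slope]
  have hb' : ∀ᶠ ρ in 𝓝[≠] (0 : ℝ), ∀ t ∈ Icc (0 : ℝ) 1, |G ρ t - G₀| ≤ C * |ρ| :=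
    hb.filter_mono nhdsWithin_le_nhds
  have key : Tendsto (fun ρ => ∫ t in (0 : ℝ)..1, ρ⁻¹ * (G ρ t - G₀)) (𝓝[≠] 0)
      (𝓝 (∫ t in (0 : ℝ)..1, G' t)) := by
    refine intervalIntegral.tendsto_integral_filter_of_dominated_convergence (fun _ => C) ?_ ?_
      intervalIntegrable_const ?_
    · exact Eventually.of_forall fun ρ =>
        (((hm ρ).sub_const G₀).const_mul ρ⁻¹).aestronglyMeasurable
    · filter_upwards [hb', self_mem_nhdsWithin] with ρ h1 h2
      refine Eventually.of_forall fun t ht => ?_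
      have h3 : 0 < |ρ| := abs_pos.2 h2
      rw [Real.norm_eq_abs, abs_mul, abs_inv, inv_mul_le_iff₀ h3, mul_comm]
      exact h1 t (hsub ht)
    · refine Eventually.of_forall fun t ht => ?_
      have := hasDerivAt_iff_tendsto_slope.1 (hd t (hsub ht))
      refine this.congr fun ρ => ?_
      rw [slope_def_field, h0, sub_zero, div_eq_inv_mul]
  refine key.congr' ?_
  filter_upwards [hb'] with ρ h1
  have hi : IntervalIntegrable (fun t => G ρ t - G₀) volume 0 1 := by
    refine (intervalIntegrable_const (c := C * |ρ|)).mono_fun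
      ((hm ρ).sub_const G₀).aestronglyMeasurable ?_
    refine (ae_restrict_iff' measurableSet_uIoc).2 (Eventually.of_forall fun t ht => ?_)
    rw [Real.norm_eq_abs]
    exact (h1 t (hsub ht)).trans (le_abs_self _)
  have e1 : ∫ t in (0 : ℝ)..1, G 0 t = G₀ := by simp [h0]
  have e2 : ∫ t in (0 : ℝ)..1, G ρ t = (∫ t in (0 : ℝ)..1, (G ρ t - G₀)) + G₀ := by
    have := intervalIntegral.integral_add hi (intervalIntegrable_const (c := G₀))
    simp only [sub_add_cancel] at this
    rw [this]
    simp
  rw [slope_def_field, e1, e2, add_sub_cancel_right, intervalIntegral.integral_const_mul, sub_zero,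
    div_eq_inv_mul]

namespace IsProfileNorm

variable {ν : ℝ → ℝ} {N : Seminorm ℝ (ℝ × ℝ)}

/-- By homogeneity the norm is `T * ν (A / T)`, so the product and chain rules apply. In the second
alternative of `hd` the quotient has derivative zero and `ν` need not be differentiable. -/
theorem hasDerivAt_norm_comp (h : IsProfileNorm ν N) {A T : ℝ → ℝ} {A₁ T₁ t : ℝ}
    (hA : HasDerivAt A A₁ t) (hT : HasDerivAt T T₁ t) (hT0 : 0 < T t)
    (hd : DifferentiableAt ℝ ν (A t / T t) ∨ A t = 0 ∧ A₁ = 0) :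
    HasDerivAt (fun ρ => N (A ρ, T ρ)) (deriv ν (A t / T t) * A₁ +
      (ν (A t / T t) - A t / T t * deriv ν (A t / T t)) * T₁) t := by
  have h1 := hA.div hT hT0.ne'
  have h2 := hT.mul (h.hasDerivAt_comp h1 (hd.imp_right fun h0 => by simp [h0.1, h0.2]))
  have e : (fun ρ => N (A ρ, T ρ)) =ᶠ[𝓝 t] fun ρ => T ρ * ν (A ρ / T ρ) := by
    filter_upwards [hT.continuousAt.eventually (Ioi_mem_nhds hT0)] with ρ hρ
    exact h.apply_pos _ hρ
  refine (h2.congr_of_eventuallyEq e).congr_deriv ?_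
  simp only [Pi.div_apply]
  field_simp
  ring

end IsProfileNorm

/-- The scaled length of the lift of a straight line in area-preserving polar coordinates; `p` is
the radial derivative of the image. -/
noncomputable def upperLength (N : Seminorm ℝ (ℝ × ℝ)) (p : ℝ → ℝ) (r ρ X Y : ℝ) : ℝ :=
  ∫ t in (0 : ℝ)..1, N (p (t * (ρ * X)) * X,
    √((1 + 2 * (t * (ρ * X)) / r)⁻¹ * X ^ 2 + (1 + 2 * (t * (ρ * X)) / r) * Y ^ 2))

/-- A scaled lower bound for the length of all curves with the same end points. -/
noncomputable def lowerLength (N : Seminorm ℝ (ℝ × ℝ)) (p : ℝ → ℝ) (r ρ X Y : ℝ) : ℝ :=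
  N (∫ t in (0 : ℝ)..1, p (t * (ρ * X)) * X,
    √((1 + ρ * X / r)⁻¹ * X ^ 2 +
      ((1 + 2 * (ρ * X) / r) * (1 - (ρ * Y) ^ 2 / r ^ 2) * (1 + ρ * X / r)⁻¹) * Y ^ 2))

section Bounds

variable {p : ℝ → ℝ} {r δ a K C ρ X Y X₀ Y₀ t : ℝ}

theorem abs_slope_sub_le (hK : 0 ≤ K) (hp : ∀ k, |k| < δ → |p k - a| ≤ K * |k|)
    (hρ : 4 * |ρ| < δ) (hX : |X| ≤ 4) (hXX : |X - X₀| ≤ C * |ρ|) (ht : t ∈ Icc (0 : ℝ) 1) :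
    |p (t * (ρ * X)) * X - a * X₀| ≤ (16 * K + |a| * C) * |ρ| := by
  have h1 : |t * (ρ * X)| ≤ 4 * |ρ| := by
    rw [abs_mul, abs_mul, abs_of_nonneg ht.1]
    have : |ρ| * |X| ≤ |ρ| * 4 := by gcongr
    have h0 : 0 ≤ |ρ| * |X| := by positivity
    nlinarith [ht.1, ht.2]
  have h2 := hp _ (h1.trans_lt hρ)
  have e : p (t * (ρ * X)) * X - a * X₀ = (p (t * (ρ * X)) - a) * X + a * (X - X₀) := by ring
  rw [e]
  refine (abs_add_le _ _).trans ?_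
  rw [abs_mul, abs_mul]
  have h3 : |p (t * (ρ * X)) - a| * |X| ≤ (K * (4 * |ρ|)) * 4 := by
    gcongr
    exact h2.trans (by gcongr)
  have h4 : |a| * |X - X₀| ≤ |a| * (C * |ρ|) := by gcongr
  linarith

theorem weight_bounds (hr : 0 < r) (hρ : 64 * |ρ| ≤ r) (hX : |X| ≤ 4) (ht : t ∈ Icc (0 : ℝ) 1) :
    |t * (ρ * X) / r| ≤ 4 / r * |ρ| ∧ |t * (ρ * X) / r| ≤ 1 / 16 := by
  have h1 : |t * (ρ * X)| ≤ 4 * |ρ| := by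
    rw [abs_mul, abs_mul, abs_of_nonneg ht.1]
    have : |ρ| * |X| ≤ |ρ| * 4 := by gcongr
    have h0 : 0 ≤ |ρ| * |X| := by positivity
    nlinarith [ht.1, ht.2]
  rw [abs_div, abs_of_pos hr]
  constructor
  · rw [div_mul_eq_mul_div]
    gcongr
  · rw [div_le_iff₀ hr]
    linarith

theorem abs_upper_speed_sub_le (hr : 0 < r) (hρ : 64 * |ρ| ≤ r) (hX : |X| ≤ 4) (hY : |Y| ≤ 4)
    (hXX : |X - X₀| ≤ C * |ρ|) (hYY : |Y - Y₀| ≤ C * |ρ|) (ht : t ∈ Icc (0 : ℝ) 1) :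
    |√((1 + 2 * (t * (ρ * X)) / r)⁻¹ * X ^ 2 + (1 + 2 * (t * (ρ * X)) / r) * Y ^ 2) -
      √(X₀ ^ 2 + Y₀ ^ 2)| ≤ (96 / r + 2 * C) * |ρ| := by
  obtain ⟨h1, h2⟩ := weight_bounds hr hρ hX ht
  set ε := t * (ρ * X) / r with hε
  have e : 2 * (t * (ρ * X)) / r = 2 * ε := by rw [hε]; ring
  rw [e]
  have h2' := abs_le.1 h2
  have hpos : 0 < 1 + 2 * ε := by linarith
  refine (abs_sqrt_weighted_sub_le (inv_nonneg.2 hpos.le) hpos.le).trans ?_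
  have h3 : |(1 + 2 * ε)⁻¹ - 1| ≤ 4 * |ε| := by
    have : (1 + 2 * ε)⁻¹ - 1 = -(2 * ε) / (1 + 2 * ε) := by field_simp; ring
    rw [this, abs_div, abs_neg, abs_mul, abs_two, abs_of_pos hpos, div_le_iff₀ hpos]
    nlinarith [abs_nonneg ε]
  have h4 : |1 + 2 * ε - 1| = 2 * |ε| := by
    rw [add_sub_cancel_left, abs_mul, abs_two]
  rw [h4]
  have h5 : |(1 + 2 * ε)⁻¹ - 1| * |X| ≤ (4 * (4 / r * |ρ|)) * 4 := by
    gcongr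
    exact h3.trans (by gcongr)
  have h6 : 2 * |ε| * |Y| ≤ (2 * (4 / r * |ρ|)) * 4 := by gcongr
  calc _ ≤ (4 * (4 / r * |ρ|)) * 4 + C * |ρ| + ((2 * (4 / r * |ρ|)) * 4 + C * |ρ|) := by gcongr
    _ = _ := by ring

theorem abs_lower_speed_sub_le (hr : 0 < r) (hρ : 64 * |ρ| ≤ r) (hX : |X| ≤ 4) (hY : |Y| ≤ 4)
    (hXX : |X - X₀| ≤ C * |ρ|) (hYY : |Y - Y₀| ≤ C * |ρ|) :
    |√((1 + ρ * X / r)⁻¹ * X ^ 2 +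
      ((1 + 2 * (ρ * X) / r) * (1 - (ρ * Y) ^ 2 / r ^ 2) * (1 + ρ * X / r)⁻¹) * Y ^ 2) -
      √(X₀ ^ 2 + Y₀ ^ 2)| ≤ (96 / r + 2 * C) * |ρ| := by
  have ht1 : (1 : ℝ) ∈ Icc (0 : ℝ) 1 := by simp
  obtain ⟨h1, h2⟩ := weight_bounds hr hρ hX ht1
  obtain ⟨h1y, h2y⟩ := weight_bounds hr hρ hY ht1
  rw [one_mul] at h1 h2 h1y h2y
  set ε := ρ * X / r with hε
  set η := ρ * Y / r with hη
  have e : 2 * (ρ * X) / r = 2 * ε := by rw [hε]; ring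
  have e' : (ρ * Y) ^ 2 / r ^ 2 = η ^ 2 := by rw [hη]; ring
  rw [e, e']
  have h2' := abs_le.1 h2
  have h2y' := abs_le.1 h2y
  have hpos : 0 < 1 + ε := by linarith
  have hη2 : η ^ 2 ≤ 1 / 16 * |η| := by
    rw [← sq_abs, sq]
    gcongr
  have hη1 : 0 ≤ 1 - η ^ 2 := by nlinarith
  have h2ε : 0 ≤ 1 + 2 * ε := by linarith
  refine (abs_sqrt_weighted_sub_le (inv_nonneg.2 hpos.le)
    (mul_nonneg (mul_nonneg h2ε hη1) (inv_nonneg.2 hpos.le))).trans ?_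
  have h3 : |(1 + ε)⁻¹ - 1| ≤ 2 * |ε| := by
    have : (1 + ε)⁻¹ - 1 = -ε / (1 + ε) := by field_simp; ring
    rw [this, abs_div, abs_neg, abs_of_pos hpos, div_le_iff₀ hpos]
    nlinarith [abs_nonneg ε]
  have h4 : |(1 + 2 * ε) * (1 - η ^ 2) * (1 + ε)⁻¹ - 1| ≤ 2 * |ε| + |η| := by
    have : (1 + 2 * ε) * (1 - η ^ 2) * (1 + ε)⁻¹ - 1 = (ε - (1 + 2 * ε) * η ^ 2) / (1 + ε) := by
      field_simp
      ring
    rw [this, abs_div, abs_of_pos hpos, div_le_iff₀ hpos]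
    have h6 : |ε - (1 + 2 * ε) * η ^ 2| ≤ |ε| + 2 * η ^ 2 := by
      refine (abs_sub _ _).trans ?_
      rw [abs_mul, abs_of_nonneg h2ε, abs_of_nonneg (sq_nonneg η)]
      gcongr
      linarith
    nlinarith [abs_nonneg ε, abs_nonneg η]
  have h5 : |(1 + ε)⁻¹ - 1| * |X| ≤ (2 * (4 / r * |ρ|)) * 4 := by
    gcongr
    exact h3.trans (by gcongr)
  have h6 : |(1 + 2 * ε) * (1 - η ^ 2) * (1 + ε)⁻¹ - 1| * |Y| ≤
      (2 * (4 / r * |ρ|) + 4 / r * |ρ|) * 4 := by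
    gcongr
    exact h4.trans (by gcongr)
  have h7 : 0 ≤ 4 / r * |ρ| := by positivity
  calc _ ≤ (2 * (4 / r * |ρ|)) * 4 + C * |ρ| +
        ((2 * (4 / r * |ρ|) + 4 / r * |ρ|) * 4 + C * |ρ|) := by gcongr
    _ = 20 * (4 / r * |ρ|) + 2 * C * |ρ| := by ring
    -- The estimate is weakened so that the upper and lower speeds share one constant.
    _ ≤ 24 * (4 / r * |ρ|) + 2 * C * |ρ| := by gcongr; norm_num
    _ = _ := by ring

end Bounds

theorem abs_integral_sub_le_of_bound {g : ℝ → ℝ} {G₀ B : ℝ} (hm : Measurable g)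
    (hb : ∀ t ∈ Icc (0 : ℝ) 1, |g t - G₀| ≤ B) : |(∫ t in (0 : ℝ)..1, g t) - G₀| ≤ B := by
  have hsub : uIoc (0 : ℝ) 1 ⊆ Icc 0 1 := by
    rw [uIoc_of_le zero_le_one]
    exact Ioc_subset_Icc_self
  have hi : IntervalIntegrable (fun t => g t - G₀) volume 0 1 := by
    refine (intervalIntegrable_const (c := B)).mono_fun (hm.sub_const G₀).aestronglyMeasurable ?_
    refine (ae_restrict_iff' measurableSet_uIoc).2 (Eventually.of_forall fun t ht => ?_)
    rw [Real.norm_eq_abs]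
    exact (hb t (hsub ht)).trans (le_abs_self _)
  have e2 : ∫ t in (0 : ℝ)..1, g t = (∫ t in (0 : ℝ)..1, (g t - G₀)) + G₀ := by
    have := intervalIntegral.integral_add hi (intervalIntegrable_const (c := G₀))
    simp only [sub_add_cancel] at this
    rw [this]
    simp
  rw [e2, add_sub_cancel_right]
  have := intervalIntegral.norm_integral_le_of_norm_le_const (a := 0) (b := 1)
    (f := fun t => g t - G₀) (C := B) fun t ht => hb t (hsub ht)
  simpa using this

namespace IsProfileNorm

variable {ν : ℝ → ℝ} {N : Seminorm ℝ (ℝ × ℝ)} {p : ℝ → ℝ} {r : ℝ}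

theorem measurable_norm (h : IsProfileNorm ν N) : Measurable N := h.norm_continuous.measurable

section Bounds

variable {δ a K C ρ X Y X₀ Y₀ : ℝ}

theorem abs_upperLength_sub_le (h : IsProfileNorm ν N) (hpm : Measurable p) (hr : 0 < r)
    (hK : 0 ≤ K) (hp : ∀ k, |k| < δ → |p k - a| ≤ K * |k|) (hρ : 4 * |ρ| < δ)
    (hρr : 64 * |ρ| ≤ r) (hX : |X| ≤ 4) (hY : |Y| ≤ 4) (hXX : |X - X₀| ≤ C * |ρ|)
    (hYY : |Y - Y₀| ≤ C * |ρ|) :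
    |upperLength N p r ρ X Y - N (a * X₀, √(X₀ ^ 2 + Y₀ ^ 2))| ≤
      (N (1, 0) * (16 * K + |a| * C) + (96 / r + 2 * C)) * |ρ| := by
  have hN := h.measurable_norm
  refine abs_integral_sub_le_of_bound (hN.comp (by fun_prop)) fun t ht => ?_
  refine (h.sub_le _ _ _ _).trans ?_
  have h1 := mul_le_mul_of_nonneg_left (abs_slope_sub_le hK hp hρ hX hXX ht)
    (apply_nonneg N ((1 : ℝ), (0 : ℝ)))
  have h2 := abs_upper_speed_sub_le hr hρr hX hY hXX hYY ht
  linarith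

theorem abs_lowerLength_sub_le (h : IsProfileNorm ν N) (hpm : Measurable p) (hr : 0 < r)
    (hK : 0 ≤ K) (hp : ∀ k, |k| < δ → |p k - a| ≤ K * |k|) (hρ : 4 * |ρ| < δ)
    (hρr : 64 * |ρ| ≤ r) (hX : |X| ≤ 4) (hY : |Y| ≤ 4) (hXX : |X - X₀| ≤ C * |ρ|)
    (hYY : |Y - Y₀| ≤ C * |ρ|) :
    |lowerLength N p r ρ X Y - N (a * X₀, √(X₀ ^ 2 + Y₀ ^ 2))| ≤
      (N (1, 0) * (16 * K + |a| * C) + (96 / r + 2 * C)) * |ρ| := by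
  refine (h.sub_le _ _ _ _).trans ?_
  have h0 : |(∫ t in (0 : ℝ)..1, p (t * (ρ * X)) * X) - a * X₀| ≤ (16 * K + |a| * C) * |ρ| :=
    abs_integral_sub_le_of_bound (by fun_prop) fun t ht => abs_slope_sub_le hK hp hρ hX hXX ht
  have h1 := mul_le_mul_of_nonneg_left h0 (apply_nonneg N ((1 : ℝ), (0 : ℝ)))
  have h2 := abs_lower_speed_sub_le hr hρr hX hY hXX hYY
  linarith

end Bounds

theorem measurable_upperLength (h : IsProfileNorm ν N) (hpm : Measurable p) (ρ : ℝ) :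
    Measurable fun q : ℝ × ℝ => upperLength N p r ρ q.1 q.2 := by
  have hN := h.measurable_norm
  unfold upperLength
  simp only [intervalIntegral.integral_of_le zero_le_one]
  refine StronglyMeasurable.measurable ?_
  refine StronglyMeasurable.integral_prod_right' (f := fun w : (ℝ × ℝ) × ℝ =>
    N (p (w.2 * (ρ * w.1.1)) * w.1.1, √((1 + 2 * (w.2 * (ρ * w.1.1)) / r)⁻¹ * w.1.1 ^ 2 +
      (1 + 2 * (w.2 * (ρ * w.1.1)) / r) * w.1.2 ^ 2))) ?_
  exact (hN.comp (by fun_prop)).stronglyMeasurable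

theorem measurable_lowerLength (h : IsProfileNorm ν N) (hpm : Measurable p) (ρ : ℝ) :
    Measurable fun q : ℝ × ℝ => lowerLength N p r ρ q.1 q.2 := by
  have hN := h.measurable_norm
  unfold lowerLength
  have h1 : Measurable fun q : ℝ × ℝ => ∫ t in (0 : ℝ)..1, p (t * (ρ * q.1)) * q.1 := by
    simp only [intervalIntegral.integral_of_le zero_le_one]
    refine StronglyMeasurable.measurable ?_
    refine StronglyMeasurable.integral_prod_right' (f := fun w : (ℝ × ℝ) × ℝ =>
      p (w.2 * (ρ * w.1.1)) * w.1.1) ?_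
    exact Measurable.stronglyMeasurable (by fun_prop)
  exact hN.comp (h1.prodMk (by fun_prop))

end IsProfileNorm

section Derivatives

variable {p : ℝ → ℝ} {a b r X₀ Y₀ X₁ Y₁ : ℝ}

theorem HasDerivAt.exists_abs_sub_le (hp : HasDerivAt p b 0) (ha : p 0 = a) :
    ∃ δ > 0, ∀ k, |k| < δ → |p k - a| ≤ (|b| + 1) * |k| := by
  have h1 := (hasDerivAt_iff_isLittleO.1 hp).def zero_lt_one
  obtain ⟨δ, hδ, h2⟩ := Metric.eventually_nhds_iff.1 h1
  refine ⟨δ, hδ, fun k hk => ?_⟩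
  have h3 := h2 (y := k) (by simpa using hk)
  simp only [sub_zero, smul_eq_mul, Real.norm_eq_abs, one_mul, ha] at h3
  have e : p k - a = (p k - a - k * b) + k * b := by ring
  rw [e]
  refine (abs_add_le _ _).trans ?_
  rw [abs_mul]
  linarith

theorem hasDerivAt_line (X₀ X₁ : ℝ) : HasDerivAt (fun ρ : ℝ => X₀ + ρ * X₁) X₁ 0 := by
  simpa using ((hasDerivAt_id (0 : ℝ)).mul_const X₁).const_add X₀

theorem hasDerivAt_mul_line (X₀ X₁ : ℝ) : HasDerivAt (fun ρ : ℝ => ρ * (X₀ + ρ * X₁)) X₀ 0 := by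
  simpa using (hasDerivAt_id' (0 : ℝ)).fun_mul (hasDerivAt_line X₀ X₁)

theorem hasDerivAt_slope_line (hp : HasDerivAt p b 0) (ha : p 0 = a) (t : ℝ) :
    HasDerivAt (fun ρ => p (t * (ρ * (X₀ + ρ * X₁))) * (X₀ + ρ * X₁))
      (a * X₁ + t * (b * X₀ ^ 2)) 0 := by
  have h1 := (hasDerivAt_mul_line X₀ X₁).const_mul t
  have h2 : HasDerivAt (fun ρ => p (t * (ρ * (X₀ + ρ * X₁)))) (b * (t * X₀)) 0 :=
    HasDerivAt.comp (h₂ := p) 0 (by simpa using hp) h1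
  refine (h2.mul (hasDerivAt_line X₀ X₁)).congr_deriv ?_
  simp [ha]
  ring

theorem hasDerivAt_upper_speed (hr : 0 < r) (hR : 0 < X₀ ^ 2 + Y₀ ^ 2) (t : ℝ) :
    HasDerivAt (fun ρ => √((1 + 2 * (t * (ρ * (X₀ + ρ * X₁))) / r)⁻¹ * (X₀ + ρ * X₁) ^ 2 +
        (1 + 2 * (t * (ρ * (X₀ + ρ * X₁))) / r) * (Y₀ + ρ * Y₁) ^ 2))
      ((X₀ * X₁ + Y₀ * Y₁ + t * ((X₀ * Y₀ ^ 2 - X₀ ^ 3) / r)) / √(X₀ ^ 2 + Y₀ ^ 2)) 0 := by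
  have h1 := ((((hasDerivAt_mul_line X₀ X₁).const_mul t).const_mul 2).div_const r).const_add 1
  have h2 := ((h1.fun_inv (by simp)).mul ((hasDerivAt_line X₀ X₁).pow 2)).add
    (h1.mul ((hasDerivAt_line Y₀ Y₁).pow 2))
  have h3 := h2.sqrt (by simpa using hR.ne')
  refine (h3.congr_deriv ?_)
  simp only [zero_mul, mul_zero, zero_div, add_zero, inv_one, one_mul, Pi.add_apply, Pi.mul_apply,
    Pi.pow_apply, Nat.cast_ofNat]
  have := sqrt_pos.2 hR
  field_simp
  ring

/-- The weights of the chord bound reproduce, to first order, those of the coordinate line at `t = 1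
/ 2`; the factor `1 - (ρ * Y) ^ 2 / r ^ 2` enters only at second order. -/
theorem hasDerivAt_lower_speed (hr : 0 < r) (hR : 0 < X₀ ^ 2 + Y₀ ^ 2) :
    HasDerivAt (fun ρ => √((1 + ρ * (X₀ + ρ * X₁) / r)⁻¹ * (X₀ + ρ * X₁) ^ 2 +
        ((1 + 2 * (ρ * (X₀ + ρ * X₁)) / r) * (1 - (ρ * (Y₀ + ρ * Y₁)) ^ 2 / r ^ 2) *
          (1 + ρ * (X₀ + ρ * X₁) / r)⁻¹) * (Y₀ + ρ * Y₁) ^ 2))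
      ((X₀ * X₁ + Y₀ * Y₁ + 1 / 2 * ((X₀ * Y₀ ^ 2 - X₀ ^ 3) / r)) / √(X₀ ^ 2 + Y₀ ^ 2)) 0 := by
  have h0 := ((hasDerivAt_mul_line X₀ X₁).div_const r).const_add 1
  have h1 := (((hasDerivAt_mul_line X₀ X₁).const_mul 2).div_const r).const_add 1
  have h1' := ((((hasDerivAt_mul_line Y₀ Y₁).pow 2).div_const (r ^ 2))).const_sub 1
  have h0i := h0.fun_inv (by simp)
  have h2 := (h0i.mul ((hasDerivAt_line X₀ X₁).pow 2)).add
    (((h1.mul h1').mul h0i).mul ((hasDerivAt_line Y₀ Y₁).pow 2))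
  have h3 := h2.sqrt (by simpa using hR.ne')
  refine (h3.congr_deriv ?_)
  simp only [zero_mul, mul_zero, zero_div, add_zero, inv_one, one_mul, Pi.add_apply, Pi.mul_apply,
    Pi.pow_apply, Nat.cast_ofNat, mul_one, ne_eq, OfNat.ofNat_ne_zero, not_false_eq_true, zero_pow,
    sub_zero]
  have := sqrt_pos.2 hR
  field_simp
  ring

theorem integral_add_mul_id (α β : ℝ) : ∫ t in (0 : ℝ)..1, (α + t * β) = α + 1 / 2 * β := by
  rw [intervalIntegral.integral_add intervalIntegrable_const
    (Continuous.intervalIntegrable (by fun_prop) _ _), intervalIntegral.integral_mul_const,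
    integral_id]
  simp

theorem eventually_line_bounds {δ : ℝ} (hδ : 0 < δ) (hr : 0 < r) (hX : |X₀| ≤ 3) (hY : |Y₀| ≤ 3) :
    ∀ᶠ ρ in 𝓝 (0 : ℝ), 4 * |ρ| < δ ∧ 64 * |ρ| ≤ r ∧ |X₀ + ρ * X₁| ≤ 4 ∧ |Y₀ + ρ * Y₁| ≤ 4 := by
  have h : ∀ {f : ℝ → ℝ} {m : ℝ}, Continuous f → f 0 < m → ∀ᶠ ρ in 𝓝 (0 : ℝ), f ρ < m :=
    fun hf h0 => hf.continuousAt.eventually (Iio_mem_nhds h0)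
  have h1 : ∀ᶠ ρ in 𝓝 (0 : ℝ), 4 * |ρ| < δ := h (by fun_prop) (by simpa using hδ)
  have h2 : ∀ᶠ ρ in 𝓝 (0 : ℝ), 64 * |ρ| < r := h (by fun_prop) (by simpa using hr)
  have h3 : ∀ᶠ ρ in 𝓝 (0 : ℝ), |X₀ + ρ * X₁| < 4 := h (by fun_prop) (by simp; linarith)
  have h4 : ∀ᶠ ρ in 𝓝 (0 : ℝ), |Y₀ + ρ * Y₁| < 4 := h (by fun_prop) (by simp; linarith)
  filter_upwards [h1, h2, h3, h4] with ρ g1 g2 g3 g4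
  exact ⟨g1, g2.le, g3.le, g4.le⟩

variable {ν : ℝ → ℝ} {N : Seminorm ℝ (ℝ × ℝ)}

theorem abs_line_sub_le (X₀ X₁ Y₁ ρ : ℝ) :
    |X₀ + ρ * X₁ - X₀| ≤ (|X₁| + |Y₁|) * |ρ| ∧ |X₀ + ρ * Y₁ - X₀| ≤ (|X₁| + |Y₁|) * |ρ| := by
  rw [add_sub_cancel_left, add_sub_cancel_left, abs_mul, abs_mul, mul_comm, mul_comm |ρ|]
  constructor <;> gcongr <;> simp

/-- For each `t` the integrand has a derivative at `ρ = 0` that is affine in `t`, and the mean of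
`t` over the unit interval is `1 / 2`. -/
theorem IsProfileNorm.hasDerivAt_upperLength (h : IsProfileNorm ν N) (hpm : Measurable p)
    (hp : HasDerivAt p b 0) (ha : p 0 = a) (hr : 0 < r) (hX : |X₀| ≤ 3) (hY : |Y₀| ≤ 3)
    (hR : 0 < X₀ ^ 2 + Y₀ ^ 2)
    (hd : DifferentiableAt ℝ ν (a * X₀ / √(X₀ ^ 2 + Y₀ ^ 2)) ∨ a = 0 ∧ b = 0) :
    HasDerivAt (fun ρ => upperLength N p r ρ (X₀ + ρ * X₁) (Y₀ + ρ * Y₁))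
      (deriv ν (a * X₀ / √(X₀ ^ 2 + Y₀ ^ 2)) * (a * X₁ + 1 / 2 * (b * X₀ ^ 2)) +
        (ν (a * X₀ / √(X₀ ^ 2 + Y₀ ^ 2)) -
          a * X₀ / √(X₀ ^ 2 + Y₀ ^ 2) * deriv ν (a * X₀ / √(X₀ ^ 2 + Y₀ ^ 2))) *
        ((X₀ * X₁ + Y₀ * Y₁ + 1 / 2 * ((X₀ * Y₀ ^ 2 - X₀ ^ 3) / r)) / √(X₀ ^ 2 + Y₀ ^ 2))) 0 := by
  obtain ⟨δ, hδ, hpδ⟩ := hp.exists_abs_sub_le ha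
  have hN := h.measurable_norm
  set s := a * X₀ / √(X₀ ^ 2 + Y₀ ^ 2) with hs
  set R := √(X₀ ^ 2 + Y₀ ^ 2) with hRdef
  have hG : ∀ t ∈ Icc (0 : ℝ) 1, HasDerivAt
      (fun ρ => N (p (t * (ρ * (X₀ + ρ * X₁))) * (X₀ + ρ * X₁),
        √((1 + 2 * (t * (ρ * (X₀ + ρ * X₁))) / r)⁻¹ * (X₀ + ρ * X₁) ^ 2 +
          (1 + 2 * (t * (ρ * (X₀ + ρ * X₁))) / r) * (Y₀ + ρ * Y₁) ^ 2)))
      (deriv ν s * (a * X₁ + t * (b * X₀ ^ 2)) + (ν s - s * deriv ν s) *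
        ((X₀ * X₁ + Y₀ * Y₁ + t * ((X₀ * Y₀ ^ 2 - X₀ ^ 3) / r)) / R)) 0 := by
    intro t ht
    have h1 := h.hasDerivAt_norm_comp (hasDerivAt_slope_line (X₀ := X₀) (X₁ := X₁) hp ha t)
      (hasDerivAt_upper_speed (X₁ := X₁) (Y₁ := Y₁) hr hR t)
      (by simpa using hR)
      (by
        simp only [zero_mul, mul_zero, zero_div, add_zero, inv_one, one_mul, ha]
        refine hd.imp id fun h0 => ?_
        simp [h0.1, h0.2])
    simp only [zero_mul, mul_zero, zero_div, add_zero, inv_one, one_mul, ha] at h1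
    exact h1
  have h2 := hasDerivAt_integral_zero_of_bound (G₀ := N (a * X₀, R)) (C := N (1, 0) *
    (16 * (|b| + 1) + |a| * (|X₁| + |Y₁|)) + (96 / r + 2 * (|X₁| + |Y₁|)))
    (fun ρ => hN.comp (by fun_prop)) (fun t => by simp [ha, hRdef]) ?_ hG
  · refine h2.congr_deriv ?_
    have e : ∀ t, deriv ν s * (a * X₁ + t * (b * X₀ ^ 2)) + (ν s - s * deriv ν s) *
        ((X₀ * X₁ + Y₀ * Y₁ + t * ((X₀ * Y₀ ^ 2 - X₀ ^ 3) / r)) / R) =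
        (deriv ν s * (a * X₁) + (ν s - s * deriv ν s) * ((X₀ * X₁ + Y₀ * Y₁) / R)) +
        t * (deriv ν s * (b * X₀ ^ 2) + (ν s - s * deriv ν s) *
          ((X₀ * Y₀ ^ 2 - X₀ ^ 3) / r / R)) := fun t => by ring
    simp only [e, integral_add_mul_id]
  · filter_upwards [eventually_line_bounds (X₁ := X₁) (Y₁ := Y₁) hδ hr hX hY] with ρ hρ t ht
    refine (h.sub_le _ _ _ _).trans ?_
    have h1 := mul_le_mul_of_nonneg_left (abs_slope_sub_le (by positivity) hpδ hρ.1 hρ.2.2.1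
      (abs_line_sub_le X₀ X₁ Y₁ ρ).1 ht) (apply_nonneg N ((1 : ℝ), (0 : ℝ)))
    have h2 := abs_upper_speed_sub_le hr hρ.2.1 hρ.2.2.1 hρ.2.2.2 (abs_line_sub_le X₀ X₁ Y₁ ρ).1
      (abs_line_sub_le Y₀ X₁ Y₁ ρ).2 ht
    rw [← hRdef] at h2
    linarith

/-- Averaging of the slope now takes place inside `N`, but at first order this makes no difference.
The derivative is that of the upper length, so the two bounds trap the amoeba to the order needed.
-/
theorem IsProfileNorm.hasDerivAt_lowerLength (h : IsProfileNorm ν N) (hpm : Measurable p)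
    (hp : HasDerivAt p b 0) (ha : p 0 = a) (hr : 0 < r) (hX : |X₀| ≤ 3) (hY : |Y₀| ≤ 3)
    (hR : 0 < X₀ ^ 2 + Y₀ ^ 2)
    (hd : DifferentiableAt ℝ ν (a * X₀ / √(X₀ ^ 2 + Y₀ ^ 2)) ∨ a = 0 ∧ b = 0) :
    HasDerivAt (fun ρ => lowerLength N p r ρ (X₀ + ρ * X₁) (Y₀ + ρ * Y₁))
      (deriv ν (a * X₀ / √(X₀ ^ 2 + Y₀ ^ 2)) * (a * X₁ + 1 / 2 * (b * X₀ ^ 2)) +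
        (ν (a * X₀ / √(X₀ ^ 2 + Y₀ ^ 2)) -
          a * X₀ / √(X₀ ^ 2 + Y₀ ^ 2) * deriv ν (a * X₀ / √(X₀ ^ 2 + Y₀ ^ 2))) *
        ((X₀ * X₁ + Y₀ * Y₁ + 1 / 2 * ((X₀ * Y₀ ^ 2 - X₀ ^ 3) / r)) / √(X₀ ^ 2 + Y₀ ^ 2))) 0 := by
  obtain ⟨δ, hδ, hpδ⟩ := hp.exists_abs_sub_le ha
  have h2 := hasDerivAt_integral_zero_of_bound (G₀ := a * X₀)
    (G := fun ρ t => p (t * (ρ * (X₀ + ρ * X₁))) * (X₀ + ρ * X₁))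
    (C := 16 * (|b| + 1) + |a| * (|X₁| + |Y₁|))
    (fun ρ => by fun_prop) (fun t => by simp [ha]) ?_
    (fun t _ => hasDerivAt_slope_line hp ha t)
  · rw [integral_add_mul_id] at h2
    have h1 := h.hasDerivAt_norm_comp h2 (hasDerivAt_lower_speed (X₁ := X₁) (Y₁ := Y₁) hr hR)
      (by simpa using hR)
      (by
        simp only [zero_mul, mul_zero, zero_div, add_zero, inv_one, one_mul, ha, mul_one, ne_eq,
          OfNat.ofNat_ne_zero, not_false_eq_true, zero_pow, sub_zero,
          intervalIntegral.integral_const, one_smul]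
        refine hd.imp id fun h0 => ?_
        simp [h0.1, h0.2])
    simp only [zero_mul, mul_zero, zero_div, add_zero, inv_one, one_mul, ha, mul_one, ne_eq,
      OfNat.ofNat_ne_zero, not_false_eq_true, zero_pow, sub_zero,
      intervalIntegral.integral_const, one_smul] at h1
    exact h1
  · filter_upwards [eventually_line_bounds (X₁ := X₁) (Y₁ := Y₁) hδ hr hX hY] with ρ hρ t ht
    exact abs_slope_sub_le (by positivity) hpδ hρ.1 hρ.2.2.1 (abs_line_sub_le X₀ X₁ Y₁ ρ).1 ht

end Derivatives

/-! ### Integration by parts in the angle. -/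

namespace IsProfileNorm

variable {ν : ℝ → ℝ} {N : Seminorm ℝ (ℝ × ℝ)}

/-- The derivative of `ϑ ↦ ν (a cos ϑ)` at almost every angle. -/
theorem ae_hasDerivAt_cos (h : IsProfileNorm ν N) (a : ℝ) :
    ∀ᵐ ϑ : ℝ, ϑ ∈ Ioo (-(π / 2)) (π / 2) → HasDerivAt (fun ϑ => ν (a * cos ϑ))
      (deriv ν (a * cos ϑ) * (a * -sin ϑ)) ϑ := by
  rcases eq_or_ne a 0 with rfl | ha
  · exact Eventually.of_forall fun ϑ _ =>
      h.hasDerivAt_comp ((hasDerivAt_cos ϑ).const_mul 0) (Or.inr (by simp))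
  · filter_upwards [h.ae_differentiableAt ha] with ϑ h1 h2
    exact h.hasDerivAt_comp ((hasDerivAt_cos ϑ).const_mul a) (Or.inl (h1 h2))

/-- Since `1 ≤ ν`, the reciprocal inherits the Lipschitz constant. Absolute continuity permits
integration by parts without assuming `ν` differentiable everywhere. -/
theorem absolutelyContinuous_inv_cos (h : IsProfileNorm ν N) (a : ℝ) :
    AbsolutelyContinuousOnInterval (fun ϑ => (ν (a * cos ϑ))⁻¹) (-(π / 2)) (π / 2) := by
  have h1 : LipschitzWith ((N (1, 0)).toNNReal * (‖a‖₊ * 1)) fun ϑ => (ν (a * cos ϑ))⁻¹ := by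
    have h2 : LipschitzWith (N (1, 0)).toNNReal fun s => (ν s)⁻¹ := by
      refine LipschitzWith.of_dist_le_mul fun s t => ?_
      rw [Real.coe_toNNReal _ (apply_nonneg N _), Real.dist_eq, Real.dist_eq]
      have hs := h.one_le s
      have ht := h.one_le t
      have e : (ν s)⁻¹ - (ν t)⁻¹ = (ν t - ν s) / (ν s * ν t) := by
        have := h.pos s
        have := h.pos t
        field_simp
      rw [e, abs_div, abs_of_pos (by positivity : 0 < ν s * ν t), abs_sub_comm]
      refine (div_le_self (abs_nonneg _) (one_le_mul_of_one_le_of_one_le hs ht)).trans ?_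
      exact h.lipschitz s t
    exact h2.comp ((lipschitzWith_smul a).comp lipschitzWith_cos)
  exact (h1.lipschitzOnWith).absolutelyContinuousOnInterval

theorem absolutelyContinuous_inv_cos_pow (h : IsProfileNorm ν N) (a : ℝ) (j : ℕ) :
    AbsolutelyContinuousOnInterval (fun ϑ => (ν (a * cos ϑ))⁻¹ ^ (j + 1)) (-(π / 2)) (π / 2) := by
  induction j with
  | zero => simpa using h.absolutelyContinuous_inv_cos a
  | succ j ih =>
    simp only [pow_succ _ (j + 1)]
    exact ih.fun_mul (h.absolutelyContinuous_inv_cos a)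

/-- Integration of the derivative of `P * ν (a cos ϑ) ^ (-j-1)` over a half-turn. -/
theorem integral_deriv_mul_inv_pow (h : IsProfileNorm ν N) (a : ℝ) (j : ℕ) {P P' : ℝ → ℝ}
    (hPc : ContDiff ℝ 1 P) (hP : ∀ ϑ, HasDerivAt P (P' ϑ) ϑ) :
    ∫ ϑ in (-(π / 2))..(π / 2), (P' ϑ * (ν (a * cos ϑ))⁻¹ ^ (j + 1) +
      P ϑ * ((j + 1) * (deriv ν (a * cos ϑ) * (a * sin ϑ)) * (ν (a * cos ϑ))⁻¹ ^ (j + 2))) =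
      P (π / 2) - P (-(π / 2)) := by
  have h1 := (hPc.contDiffOn (s := uIcc (-(π / 2)) (π / 2))).absolutelyContinuousOnInterval.fun_mul
    (h.absolutelyContinuous_inv_cos_pow a j)
  have h2 := h1.integral_deriv_eq_sub
  -- At both ends the cosine vanishes and `ν 0 = 1`, so the boundary terms do not involve `ν`.
  simp only [cos_pi_div_two, cos_neg, mul_zero, h.zero, inv_one, one_pow, mul_one] at h2
  rw [← h2]
  refine intervalIntegral.integral_congr_ae ?_
  have hne : ∀ᵐ ϑ : ℝ, ϑ ≠ π / 2 := by simp [ae_iff]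
  filter_upwards [h.ae_hasDerivAt_cos a, hne] with ϑ h3 h4 h5
  rw [uIoc_of_le (by linarith [pi_pos])] at h5
  have h6 := h3 ⟨h5.1, lt_of_le_of_ne h5.2 h4⟩
  have hpos := h.pos (a * cos ϑ)
  have h7 := (hP ϑ).fun_mul ((h6.fun_inv hpos.ne').fun_pow (j + 1))
  rw [h7.deriv]
  push_cast
  rw [div_eq_mul_inv, ← inv_pow]
  ring

theorem intervalIntegrable_of_bounded {g : ℝ → ℝ} {B a b : ℝ} (hm : Measurable g)
    (hb : ∀ ϑ, |g ϑ| ≤ B) : IntervalIntegrable g volume a b := by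
  refine (intervalIntegrable_const (c := B)).mono_fun hm.aestronglyMeasurable ?_
  refine Eventually.of_forall fun t => ?_
  rw [Real.norm_eq_abs]
  exact (hb t).trans (le_abs_self _)

theorem intervalIntegrable_trig (h : IsProfileNorm ν N) (a x y : ℝ) {P : ℝ → ℝ}
    (hP : Continuous P) (j : ℕ) :
    IntervalIntegrable (fun ϑ => P ϑ * (ν (a * cos ϑ))⁻¹ ^ j) volume x y := by
  have := h.continuous
  refine Continuous.intervalIntegrable ?_ _ _
  refine hP.mul (Continuous.pow (Continuous.inv₀ (by fun_prop) fun ϑ => (h.pos _).ne') j)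

theorem intervalIntegrable_deriv_trig (h : IsProfileNorm ν N) (a x y : ℝ) {P : ℝ → ℝ}
    (hP : Continuous P) (j : ℕ) : IntervalIntegrable
      (fun ϑ => deriv ν (a * cos ϑ) * (P ϑ * (ν (a * cos ϑ))⁻¹ ^ j)) volume x y := by
  have hc := h.continuous
  refine IntervalIntegrable.mul_continuousOn ?_ (Continuous.continuousOn ?_)
  · refine intervalIntegrable_of_bounded (B := N (1, 0)) ?_ fun ϑ => h.deriv_abs_le _
    exact (measurable_deriv ν).comp (by fun_prop)
  · exact hP.mul (Continuous.pow (Continuous.inv₀ (by fun_prop) fun ϑ => (h.pos _).ne') j)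

/-- A formula for the edge-stopping function that does not involve the derivative of `ν`. -/
theorem edgeStopping_eq (h : IsProfileNorm ν N) (a : ℝ) :
    edgeStopping ν a = 1 / 2 * ∫ ϑ in (-(π / 2))..(π / 2), cos ϑ * (ν (a * cos ϑ))⁻¹ ^ 3 := by
  have h1 := h.integral_deriv_mul_inv_pow a 2 contDiff_sin hasDerivAt_sin
  have e : ∀ ϑ, cos ϑ * (ν (a * cos ϑ))⁻¹ ^ (2 + 1) + sin ϑ * (((2 : ℕ) + 1) *
      (deriv ν (a * cos ϑ) * (a * sin ϑ)) * (ν (a * cos ϑ))⁻¹ ^ (2 + 2)) =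
      cos ϑ * (ν (a * cos ϑ))⁻¹ ^ 3 +
        3 * a * (deriv ν (a * cos ϑ) * (sin ϑ ^ 2 * (ν (a * cos ϑ))⁻¹ ^ 4)) := by
    intro ϑ
    push_cast
    ring
  simp only [e] at h1
  rw [intervalIntegral.integral_add (h.intervalIntegrable_trig _ _ _ continuous_cos _)
    ((h.intervalIntegrable_deriv_trig _ _ _ (by fun_prop) _).const_mul _),
    intervalIntegral.integral_const_mul, sin_neg, sin_pi_div_two] at h1
  have h2 : Jtilde₁ ν a = ∫ ϑ in (-(π / 2))..(π / 2),
      deriv ν (a * cos ϑ) * (sin ϑ ^ 2 * (ν (a * cos ϑ))⁻¹ ^ 4) := by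
    unfold Jtilde₁
    congr 1
    ext ϑ
    rw [inv_pow]
    ring
  rw [edgeStopping, h2]
  linarith

end IsProfileNorm

/-- The angular density of the first-order deformation of the amoeba. -/
noncomputable def deformation (ν : ℝ → ℝ) (r a b c ϑ : ℝ) : ℝ :=
  deriv ν (a * cos ϑ) * (a * c + b * cos ϑ ^ 2 / (2 * ν (a * cos ϑ) ^ 2)) +
    (ν (a * cos ϑ) - a * cos ϑ * deriv ν (a * cos ϑ)) *
      (c * cos ϑ + (cos ϑ * sin ϑ ^ 2 - cos ϑ ^ 3) / (2 * r * ν (a * cos ϑ) ^ 2))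

/-- Two integrations by parts are used. The one with `sin` and `ν⁻¹` turns the coefficient of `c`
into its boundary value `2`. The one with `cos ^ 2 * sin` and `ν⁻³` has no boundary terms and
removes the cubic curvature terms, leaving the derivative-free integral for `edgeStopping`. For `b =
F' - F / r` and `a = F`, the combination `b + a / r` is the second derivative along the ray. -/
theorem IsProfileNorm.integral_deformation {ν : ℝ → ℝ} {N : Seminorm ℝ (ℝ × ℝ)}
    (h : IsProfileNorm ν N) {r : ℝ} (hr : 0 < r) (a b c : ℝ) :
    ∫ ϑ in (-(π / 2))..(π / 2), deformation ν r a b c ϑ / ν (a * cos ϑ) ^ 2 =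
      2 * c + 1 / 2 * (b + a / r) * (∫ ϑ in (-(π / 2))..(π / 2),
        deriv ν (a * cos ϑ) * (cos ϑ ^ 2 * (ν (a * cos ϑ))⁻¹ ^ 4)) -
        edgeStopping ν a / (3 * r) := by
  have h1 := h.integral_deriv_mul_inv_pow a 0 contDiff_sin hasDerivAt_sin
  have h3 := h.integral_deriv_mul_inv_pow a 2 (P := fun ϑ => cos ϑ ^ 2 * sin ϑ)
    (P' := fun ϑ => 3 * cos ϑ ^ 3 - 2 * cos ϑ) ((contDiff_cos.pow 2).mul contDiff_sin) (by
      intro ϑ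
      refine (((hasDerivAt_cos ϑ).fun_pow 2).fun_mul (hasDerivAt_sin ϑ)).congr_deriv ?_
      have := sin_sq_add_cos_sq ϑ
      simp only [Nat.cast_ofNat, Nat.add_one_sub_one, pow_one]
      linear_combination (-2 * cos ϑ) * this)
  simp only [cos_neg, cos_pi_div_two, sin_neg, sin_pi_div_two] at h1 h3
  have e1 : ∀ ϑ, cos ϑ * (ν (a * cos ϑ))⁻¹ ^ (0 + 1) + sin ϑ * (((0 : ℕ) + 1) *
      (deriv ν (a * cos ϑ) * (a * sin ϑ)) * (ν (a * cos ϑ))⁻¹ ^ (0 + 2)) =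
      cos ϑ * (ν (a * cos ϑ))⁻¹ ^ 1 +
        deriv ν (a * cos ϑ) * ((a * sin ϑ ^ 2) * (ν (a * cos ϑ))⁻¹ ^ 2) := by
    intro ϑ
    push_cast
    ring
  have e3 : ∀ ϑ, (3 * cos ϑ ^ 3 - 2 * cos ϑ) * (ν (a * cos ϑ))⁻¹ ^ (2 + 1) +
      cos ϑ ^ 2 * sin ϑ * (((2 : ℕ) + 1) *
      (deriv ν (a * cos ϑ) * (a * sin ϑ)) * (ν (a * cos ϑ))⁻¹ ^ (2 + 2)) =
      (3 * cos ϑ ^ 3 - 2 * cos ϑ) * (ν (a * cos ϑ))⁻¹ ^ 3 +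
        deriv ν (a * cos ϑ) * ((3 * a * cos ϑ ^ 2 * sin ϑ ^ 2) * (ν (a * cos ϑ))⁻¹ ^ 4) := by
    intro ϑ
    push_cast
    ring
  simp only [e1] at h1
  simp only [e3] at h3
  have i1 := (h.intervalIntegrable_trig a (-(π / 2)) (π / 2) continuous_cos 1).add
    (h.intervalIntegrable_deriv_trig a (-(π / 2)) (π / 2) (P := fun ϑ => a * sin ϑ ^ 2)
      (by fun_prop) 2)
  have i2 := h.intervalIntegrable_deriv_trig a (-(π / 2)) (π / 2) (P := fun ϑ => cos ϑ ^ 2)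
      (by fun_prop) 4
  have i3 := (h.intervalIntegrable_trig a (-(π / 2)) (π / 2)
      (P := fun ϑ => 3 * cos ϑ ^ 3 - 2 * cos ϑ) (by fun_prop) 3).add
    (h.intervalIntegrable_deriv_trig a (-(π / 2)) (π / 2)
      (P := fun ϑ => 3 * a * cos ϑ ^ 2 * sin ϑ ^ 2) (by fun_prop) 4)
  have i4 := h.intervalIntegrable_trig a (-(π / 2)) (π / 2) continuous_cos 3
  have e : ∀ ϑ, deformation ν r a b c ϑ / ν (a * cos ϑ) ^ 2 =
      c * (cos ϑ * (ν (a * cos ϑ))⁻¹ ^ 1 +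
        deriv ν (a * cos ϑ) * ((a * sin ϑ ^ 2) * (ν (a * cos ϑ))⁻¹ ^ 2)) +
      (1 / 2 * (b + a / r)) * (deriv ν (a * cos ϑ) * (cos ϑ ^ 2 * (ν (a * cos ϑ))⁻¹ ^ 4)) -
      (1 / (3 * r)) * ((3 * cos ϑ ^ 3 - 2 * cos ϑ) * (ν (a * cos ϑ))⁻¹ ^ 3 +
        deriv ν (a * cos ϑ) * ((3 * a * cos ϑ ^ 2 * sin ϑ ^ 2) * (ν (a * cos ϑ))⁻¹ ^ 4)) -
      (1 / (6 * r)) * (cos ϑ * (ν (a * cos ϑ))⁻¹ ^ 3) := by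
    intro ϑ
    have hpos := h.pos (a * cos ϑ)
    have hs : sin ϑ ^ 2 = 1 - cos ϑ ^ 2 := by linarith [sin_sq_add_cos_sq ϑ]
    rw [deformation, hs]
    field_simp
    ring
  simp only [e]
  rw [intervalIntegral.integral_sub (((i1.const_mul c).add (i2.const_mul _)).sub (i3.const_mul _))
    (i4.const_mul _), intervalIntegral.integral_sub ((i1.const_mul c).add (i2.const_mul _))
    (i3.const_mul _), intervalIntegral.integral_add (i1.const_mul c) (i2.const_mul _),
    intervalIntegral.integral_const_mul, intervalIntegral.integral_const_mul,
    intervalIntegral.integral_const_mul, intervalIntegral.integral_const_mul, h.edgeStopping_eq]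
  rw [h1, h3]
  field_simp
  ring

/-! ### Half areas of the unit balls of first-order lengths. -/

/-- A family of scaled length functions that agree to first order with the lengths of the lifts of
curves; `a` and `b` are the first two radial derivatives of the image. -/
structure IsFirstOrderLength (ν : ℝ → ℝ) (N : Seminorm ℝ (ℝ × ℝ)) (r a b : ℝ)
    (l : ℝ → ℝ → ℝ → ℝ) : Prop where
  measurable : ∀ ρ, Measurable fun q : ℝ × ℝ => l ρ q.1 q.2
  bound : ∀ C, 0 ≤ C → ∃ B, 0 ≤ B ∧ ∀ᶠ ρ in 𝓝 (0 : ℝ), ∀ X Y X₀ Y₀, |X| ≤ 4 → |Y| ≤ 4 →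
    |X - X₀| ≤ C * |ρ| → |Y - Y₀| ≤ C * |ρ| →
    |l ρ X Y - N (a * X₀, √(X₀ ^ 2 + Y₀ ^ 2))| ≤ B * |ρ|
  hasDerivAt : ∀ X₀ Y₀ X₁ Y₁, |X₀| ≤ 3 → |Y₀| ≤ 3 → 0 < X₀ ^ 2 + Y₀ ^ 2 →
    (DifferentiableAt ℝ ν (a * X₀ / √(X₀ ^ 2 + Y₀ ^ 2)) ∨ a = 0 ∧ b = 0) →
    HasDerivAt (fun ρ => l ρ (X₀ + ρ * X₁) (Y₀ + ρ * Y₁))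
      (deriv ν (a * X₀ / √(X₀ ^ 2 + Y₀ ^ 2)) * (a * X₁ + 1 / 2 * (b * X₀ ^ 2)) +
        (ν (a * X₀ / √(X₀ ^ 2 + Y₀ ^ 2)) -
          a * X₀ / √(X₀ ^ 2 + Y₀ ^ 2) * deriv ν (a * X₀ / √(X₀ ^ 2 + Y₀ ^ 2))) *
        ((X₀ * X₁ + Y₀ * Y₁ + 1 / 2 * ((X₀ * Y₀ ^ 2 - X₀ ^ 3) / r)) / √(X₀ ^ 2 + Y₀ ^ 2))) 0

section FirstOrder

variable {ν : ℝ → ℝ} {N : Seminorm ℝ (ℝ × ℝ)} {p : ℝ → ℝ} {r a b : ℝ}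

theorem eventually_small_abs {δ : ℝ} (hδ : 0 < δ) (hr : 0 < r) :
    ∀ᶠ ρ in 𝓝 (0 : ℝ), 4 * |ρ| < δ ∧ 64 * |ρ| ≤ r := by
  filter_upwards [eventually_line_bounds (X₀ := 0) (Y₀ := 0) (X₁ := 0) (Y₁ := 0) hδ hr (by simp)
    (by simp)] with ρ h
  exact ⟨h.1, h.2.1⟩

theorem IsProfileNorm.isFirstOrderLength_upperLength (h : IsProfileNorm ν N) (hpm : Measurable p)
    (hp : HasDerivAt p b 0) (ha : p 0 = a) (hr : 0 < r) :
    IsFirstOrderLength ν N r a b (upperLength N p r) where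
  measurable := h.measurable_upperLength hpm
  bound C hC := by
    obtain ⟨δ, hδ, hpδ⟩ := hp.exists_abs_sub_le ha
    refine ⟨N (1, 0) * (16 * (|b| + 1) + |a| * C) + (96 / r + 2 * C), ?_, ?_⟩
    · have := apply_nonneg N ((1 : ℝ), (0 : ℝ))
      positivity
    · filter_upwards [eventually_small_abs hδ hr] with ρ hρ X Y X₀ Y₀ h1 h2 h3 h4
      exact h.abs_upperLength_sub_le hpm hr (by positivity) hpδ hρ.1 hρ.2 h1 h2 h3 h4
  hasDerivAt _ _ _ _ hX hY hR hd := h.hasDerivAt_upperLength hpm hp ha hr hX hY hR hd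

theorem IsProfileNorm.isFirstOrderLength_lowerLength (h : IsProfileNorm ν N) (hpm : Measurable p)
    (hp : HasDerivAt p b 0) (ha : p 0 = a) (hr : 0 < r) :
    IsFirstOrderLength ν N r a b (lowerLength N p r) where
  measurable := h.measurable_lowerLength hpm
  bound C hC := by
    obtain ⟨δ, hδ, hpδ⟩ := hp.exists_abs_sub_le ha
    refine ⟨N (1, 0) * (16 * (|b| + 1) + |a| * C) + (96 / r + 2 * C), ?_, ?_⟩
    · have := apply_nonneg N ((1 : ℝ), (0 : ℝ))
      positivity
    · filter_upwards [eventually_small_abs hδ hr] with ρ hρ X Y X₀ Y₀ h1 h2 h3 h4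
      exact h.abs_lowerLength_sub_le hpm hr (by positivity) hpδ hρ.1 hρ.2 h1 h2 h3 h4
  hasDerivAt _ _ _ _ hX hY hR hd := h.hasDerivAt_lowerLength hpm hp ha hr hX hY hR hd

/-- The area, in polar coordinates, of the part of the unit ball of `l ρ` on one side of the
level line through the point with coordinates `(c * ρ ^ 2, 0)`. -/
noncomputable def halfArea (l : ℝ → ℝ → ℝ → ℝ) (σ c ρ : ℝ) : ℝ :=
  ∫ ϑ in Ioo (-(π / 2)) (π / 2), ∫ s in Ioo (0 : ℝ) 3,
    if l ρ (σ * (s * cos ϑ) + c * ρ) (s * sin ϑ) ≤ 1 then s else 0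

theorem IsFirstOrderLength.measurable_polar {l : ℝ → ℝ → ℝ → ℝ}
    (hl : IsFirstOrderLength ν N r a b l) (σ c ρ : ℝ) :
    Measurable fun q : ℝ × ℝ => l ρ (σ * (q.2 * cos q.1) + c * ρ) (q.2 * sin q.1) := by
  have h1 : Measurable fun q : ℝ × ℝ => (σ * (q.2 * cos q.1) + c * ρ, q.2 * sin q.1) := by
    fun_prop
  exact (hl.measurable ρ).comp h1

/-- The shift `c * ρ` has the size of the allowed error. Without it homogeneity gives `s * ν (a *
cos ϑ)` along a ray, evenness of `ν` making the side `σ` irrelevant. -/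
theorem IsFirstOrderLength.exists_polar_bound (h : IsProfileNorm ν N) {l : ℝ → ℝ → ℝ → ℝ}
    (hl : IsFirstOrderLength ν N r a b l) {σ : ℝ} (hσ : |σ| = 1) (c : ℝ) :
    ∃ B, 0 ≤ B ∧ ∀ᶠ ρ in 𝓝[>] (0 : ℝ), ∀ ϑ, ∀ s ∈ Ioo (0 : ℝ) 3,
      |l ρ (σ * (s * cos ϑ) + c * ρ) (s * sin ϑ) - s * ν (a * cos ϑ)| ≤ B * ρ := by
  obtain ⟨B, hB, hev⟩ := hl.bound |c| (abs_nonneg c)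
  have hσ2 : σ ^ 2 = 1 := by rw [← sq_abs, hσ, one_pow]
  refine ⟨B, hB, ?_⟩
  have h1 : ∀ᶠ ρ in 𝓝 (0 : ℝ), |c * ρ| < 1 := by
    have : Continuous fun ρ : ℝ => |c * ρ| := by fun_prop
    exact this.continuousAt.eventually (Iio_mem_nhds (by simp))
  filter_upwards [hev.filter_mono nhdsWithin_le_nhds, h1.filter_mono nhdsWithin_le_nhds,
    self_mem_nhdsWithin] with ρ h2 h3 h4 ϑ s hs
  have hρ : |ρ| = ρ := abs_of_pos h4
  have hX0 : |σ * (s * cos ϑ)| ≤ 3 := by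
    rw [abs_mul, hσ, one_mul, abs_mul, abs_of_pos hs.1]
    nlinarith [abs_cos_le_one ϑ, hs.1, hs.2, abs_nonneg (cos ϑ)]
  have hY0 : |s * sin ϑ| ≤ 3 := by
    rw [abs_mul, abs_of_pos hs.1]
    nlinarith [abs_sin_le_one ϑ, hs.1, hs.2, abs_nonneg (sin ϑ)]
  have h5 := h2 (σ * (s * cos ϑ) + c * ρ) (s * sin ϑ) (σ * (s * cos ϑ)) (s * sin ϑ)
    ((abs_add_le _ _).trans (by linarith)) (by linarith)
    (by rw [add_sub_cancel_left, abs_mul]) (by rw [sub_self, abs_zero]; positivity)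
  have e1 : (σ * (s * cos ϑ)) ^ 2 + (s * sin ϑ) ^ 2 = s ^ 2 := by
    rw [mul_pow, hσ2]
    linear_combination s ^ 2 * sin_sq_add_cos_sq ϑ
  have e2 : N (a * (σ * (s * cos ϑ)), s) = s * ν (a * cos ϑ) := by
    rw [h.apply_pos _ hs.1]
    have : a * (σ * (s * cos ϑ)) / s = σ * (a * cos ϑ) := by
      have := hs.1.ne'
      field_simp
    rw [this]
    rcases sq_eq_one_iff.1 hσ2 with rfl | rfl
    · rw [one_mul]
    · rw [neg_one_mul, h.even]
  rw [e1, sqrt_sq hs.1.le, e2, hρ] at h5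
  exact h5

/-- At radius `1 / ν (a * cos ϑ)` the unperturbed length is exactly `1`. The displacement by `τ`
along the ray contributes `ν (a * cos ϑ) * τ` by homogeneity; the shift `c` and the second-order
data `b`, `r` contribute the deformation. -/
theorem IsFirstOrderLength.tendsto_polar (h : IsProfileNorm ν N) {l : ℝ → ℝ → ℝ → ℝ}
    (hl : IsFirstOrderLength ν N r a b l) (hr : 0 < r) {σ : ℝ} (hσ : σ = 1 ∨ σ = -1) (c : ℝ)
    {ϑ : ℝ} (hd : DifferentiableAt ℝ ν (σ * a * cos ϑ) ∨ a = 0 ∧ b = 0) (τ : ℝ) :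
    Tendsto (fun ρ => (l ρ (σ * ((1 / ν (a * cos ϑ) + ρ * τ) * cos ϑ) + c * ρ)
      ((1 / ν (a * cos ϑ) + ρ * τ) * sin ϑ) - 1) / ρ) (𝓝[>] 0)
      (𝓝 (ν (a * cos ϑ) * τ + σ * deformation ν r a b c ϑ)) := by
  have hn := h.one_le (a * cos ϑ)
  set n := ν (a * cos ϑ) with hndef
  have hn0 : 0 < n := by linarith
  have hn1 : 1 / n ≤ 1 := by rw [div_le_one hn0]; exact hn
  have hn2 : 0 < 1 / n := by positivity
  have hσ2 : σ ^ 2 = 1 := by rcases hσ with rfl | rfl <;> norm_num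
  have e1 : (σ * cos ϑ * (1 / n)) ^ 2 + (sin ϑ * (1 / n)) ^ 2 = (1 / n) ^ 2 := by
    linear_combination (cos ϑ * (1 / n)) ^ 2 * hσ2 + (1 / n) ^ 2 * sin_sq_add_cos_sq ϑ
  have e2 : √((σ * cos ϑ * (1 / n)) ^ 2 + (sin ϑ * (1 / n)) ^ 2) = 1 / n := by
    rw [e1, sqrt_sq hn2.le]
  have e3 : a * (σ * cos ϑ * (1 / n)) / (1 / n) = σ * a * cos ϑ := by field_simp
  have hσa : |σ| = 1 := by rcases hσ with rfl | rfl <;> simp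
  have hX : |σ * cos ϑ * (1 / n)| ≤ 3 := by
    rw [abs_mul, abs_mul, hσa, one_mul, abs_of_pos hn2]
    nlinarith [abs_cos_le_one ϑ, abs_nonneg (cos ϑ)]
  have hY : |sin ϑ * (1 / n)| ≤ 3 := by
    rw [abs_mul, abs_of_pos hn2]
    nlinarith [abs_sin_le_one ϑ, abs_nonneg (sin ϑ)]
  -- The velocity is the radial displacement `τ`, taken on side `σ`, plus the translation by `c` in
  -- the radial coordinate `k`.
  have h1 := hl.hasDerivAt (σ * cos ϑ * (1 / n)) (sin ϑ * (1 / n)) (σ * τ * cos ϑ + c) (τ * sin ϑ) hX hY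
    (by rw [e1]; positivity) (by rw [e2, e3]; exact hd)
  rw [e2, e3] at h1
  have h2 := (hasDerivAt_iff_tendsto_slope.1 h1).mono_left
    (nhdsWithin_mono 0 fun x (hx : 0 < x) => hx.ne')
  have e0 : l 0 (σ * cos ϑ * (1 / n)) (sin ϑ * (1 / n)) = 1 := by
    obtain ⟨B, -, hB⟩ := hl.bound 0 le_rfl
    have h3 := hB.self_of_nhds (σ * cos ϑ * (1 / n)) (sin ϑ * (1 / n)) (σ * cos ϑ * (1 / n))
      (sin ϑ * (1 / n)) (by linarith) (by linarith) (by simp) (by simp)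
    rw [abs_zero, mul_zero, abs_nonpos_iff, sub_eq_zero, e2, h.apply_pos _ hn2, e3] at h3
    rw [h3]
    have : ν (σ * a * cos ϑ) = n := by
      rcases hσ with rfl | rfl
      · rw [one_mul]
      · rw [neg_one_mul, neg_mul, h.even]
    rw [this]
    field_simp
  have hval : deriv ν (σ * a * cos ϑ) * (a * (σ * τ * cos ϑ + c) +
      1 / 2 * (b * (σ * cos ϑ * (1 / n)) ^ 2)) + (ν (σ * a * cos ϑ) -
        σ * a * cos ϑ * deriv ν (σ * a * cos ϑ)) * ((σ * cos ϑ * (1 / n) * (σ * τ * cos ϑ + c) +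
          sin ϑ * (1 / n) * (τ * sin ϑ) + 1 / 2 * ((σ * cos ϑ * (1 / n) * (sin ϑ * (1 / n)) ^ 2 -
            (σ * cos ϑ * (1 / n)) ^ 3) / r)) / (1 / n)) =
      n * τ + σ * deformation ν r a b c ϑ := by
    have hs : sin ϑ ^ 2 = 1 - cos ϑ ^ 2 := by linarith [sin_sq_add_cos_sq ϑ]
    have e5 : deriv ν (σ * a * cos ϑ) = σ * deriv ν (a * cos ϑ) ∧ ν (σ * a * cos ϑ) = n := by
      rcases hσ with rfl | rfl
      · simp [hndef]
      · rw [neg_one_mul, neg_mul, h.even, h.deriv_neg, neg_one_mul]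
        exact ⟨rfl, rfl⟩
    rw [e5.1, e5.2, deformation, ← hndef]
    have e6 : sin ϑ * (1 / n) * (τ * sin ϑ) = (1 - cos ϑ ^ 2) * τ * (1 / n) := by
      rw [← hs]
      ring
    rw [e6, mul_pow (sin ϑ), hs]
    rcases hσ with rfl | rfl <;> field_simp <;> ring
  rw [hval] at h2
  refine h2.congr fun ρ => ?_
  rw [slope_def_field, zero_mul, zero_mul, add_zero, add_zero, e0, sub_zero]
  congr 3 <;> ring

/-- First-order expansion of the area of the half amoebas. -/
theorem IsFirstOrderLength.tendsto_halfArea (h : IsProfileNorm ν N) {l : ℝ → ℝ → ℝ → ℝ}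
    (hl : IsFirstOrderLength ν N r a b l) (hr : 0 < r) {σ : ℝ} (hσ : σ = 1 ∨ σ = -1) (c : ℝ)
    (hd : a ≠ 0 ∨ DifferentiableAt ℝ ν 0 ∨ b = 0) :
    Tendsto (fun ρ => (halfArea l σ c ρ -
      ∫ ϑ in Ioo (-(π / 2)) (π / 2), 1 / (2 * ν (a * cos ϑ) ^ 2)) / ρ) (𝓝[>] 0)
      (𝓝 (-(σ * ∫ ϑ in (-(π / 2))..(π / 2), deformation ν r a b c ϑ / ν (a * cos ϑ) ^ 2))) := by
  have hσa : |σ| = 1 := by rcases hσ with rfl | rfl <;> simp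
  obtain ⟨B, hB, hb⟩ := hl.exists_polar_bound h hσa c
  have hc := h.continuous
  have h1 := tendsto_integral_integral_sublevel (μ := volume.restrict (Ioo (-(π / 2)) (π / 2)))
    (D := fun ρ ϑ s => l ρ (σ * (s * cos ϑ) + c * ρ) (s * sin ϑ))
    (n := fun ϑ => ν (a * cos ϑ)) (E := fun ϑ => σ * deformation ν r a b c ϑ)
    (fun ϑ => h.one_le _) (by fun_prop) hB (hl.measurable_polar σ c) hb ?_
  · have e : -∫ ϑ in Ioo (-(π / 2)) (π / 2), σ * deformation ν r a b c ϑ / ν (a * cos ϑ) ^ 2 =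
        -(σ * ∫ ϑ in (-(π / 2))..(π / 2), deformation ν r a b c ϑ / ν (a * cos ϑ) ^ 2) := by
      rw [intervalIntegral.integral_of_le (by linarith [pi_pos]), integral_Ioc_eq_integral_Ioo,
        ← integral_const_mul]
      simp only [mul_div_assoc]
    rw [e] at h1
    refine h1.congr fun ρ => ?_
    rw [integral_div, integral_sub, halfArea]
    · have hm : StronglyMeasurable fun q : ℝ × ℝ =>
          if l ρ (σ * (q.2 * cos q.1) + c * ρ) (q.2 * sin q.1) ≤ 1 then q.2 else 0 :=
        (Measurable.ite (measurableSet_le (hl.measurable_polar σ c ρ) measurable_const)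
          measurable_snd measurable_const).stronglyMeasurable
      refine Integrable.of_bound hm.integral_prod_right'.aestronglyMeasurable
        (3 * volume.real (Ioo (0 : ℝ) 3)) (Eventually.of_forall fun ϑ => ?_)
      refine norm_setIntegral_le_of_norm_le_const (by simp) fun s hs => ?_
      rw [Real.norm_eq_abs, abs_le]
      split_ifs <;> constructor <;> linarith [hs.1, hs.2]
    · refine Integrable.of_bound (Measurable.aestronglyMeasurable (by fun_prop)) 1
        (Eventually.of_forall fun ϑ => ?_)
      have := h.one_le (a * cos ϑ)
      have h3 : 1 ≤ 2 * ν (a * cos ϑ) ^ 2 := by nlinarith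
      rw [Real.norm_of_nonneg (by positivity)]
      exact (div_le_one (by linarith)).2 h3
  · rw [ae_restrict_iff' measurableSet_Ioo]
    -- For `a = 0` all angles sample `ν` at `0`, so almost-everywhere differentiability does not
    -- help and the alternatives in `hd` take over.
    have key : ∀ᵐ ϑ : ℝ, ϑ ∈ Ioo (-(π / 2)) (π / 2) →
        DifferentiableAt ℝ ν (σ * a * cos ϑ) ∨ a = 0 ∧ b = 0 := by
      by_cases ha : a = 0
      · refine Eventually.of_forall fun ϑ _ => ?_
        rcases hd with hd | hd | hd
        · exact absurd ha hd
        · left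
          simpa [ha] using hd
        · exact Or.inr ⟨ha, hd⟩
      · have hσ0 : σ ≠ 0 := by rcases hσ with rfl | rfl <;> norm_num
        filter_upwards [h.ae_differentiableAt (mul_ne_zero hσ0 ha)] with ϑ h2 h3
        exact Or.inl (h2 h3)
    filter_upwards [key] with ϑ h2 h3 τ
    exact hl.tendsto_polar h hr hσ c (h2 h3) τ

end FirstOrder

/-! ### Trapping the amoeba in the chart and comparing its halves. -/

theorem Seminorm.map_mul_mul (N : Seminorm ℝ (ℝ × ℝ)) {ρ : ℝ} (hρ : 0 ≤ ρ) (A T : ℝ) :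
    N (ρ * A, ρ * T) = ρ * N (A, T) := by
  have h := map_smul_eq_mul N ρ (A, T)
  rwa [Real.norm_of_nonneg hρ] at h

/-- Area-preserving polar coordinates around a point `x` of the domain of a rotationally symmetric
image. -/
structure IsRadialChart (Ω : Set Plane) (f : Plane → ℝ) (z x : Plane) (L : ℂ ≃ₗᵢ[ℝ] Plane)
    (r δ : ℝ) : Prop where
  r_pos : 0 < r
  map_r : L r = x - z
  δ_pos : 0 < δ
  δ_le : δ ≤ r / 4
  mem : ∀ k y, |k| < δ → |y| < δ → z + L (sectorMap r k y) ∈ Ω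
  symm : IsRotSymmOn f Ω z
  contDiffOn : ContDiffOn ℝ 1 f Ω
  differentiableAt : ∀ k, |k| < δ → DifferentiableAt ℝ (radialPart f z L r) k
  continuousOn_deriv : ContinuousOn (deriv (radialPart f z L r)) (Ioo (-δ) δ)

section Area

variable {ν : ℝ → ℝ} {N : Seminorm ℝ (ℝ × ℝ)} {Ω : Set Plane} {f u : Plane → ℝ} {z x : Plane}
  {L : ℂ ≃ₗᵢ[ℝ] Plane} {r δ a b c σ ρ : ℝ} {l : ℝ → ℝ → ℝ → ℝ}

/-- The points, in polar coordinates, of one half of the unit ball of `l ρ`. -/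
def halfRegion (l : ℝ → ℝ → ℝ → ℝ) (σ c ρ : ℝ) : Set (ℝ × ℝ) :=
  {p | p ∈ Ioo (0 : ℝ) 3 ×ˢ Ioo (-(π / 2)) (π / 2) ∧
    l ρ (σ * (p.1 * cos p.2) + c * ρ) (p.1 * sin p.2) ≤ 1}

theorem measurableSet_halfRegion_sublevel (hl : IsFirstOrderLength ν N r a b l) (σ c ρ : ℝ) :
    MeasurableSet {p : ℝ × ℝ | l ρ (σ * (p.1 * cos p.2) + c * ρ) (p.1 * sin p.2) ≤ 1} :=
  measurableSet_le ((hl.measurable_polar σ c ρ).comp measurable_swap) measurable_const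

theorem measurableSet_halfRegion (hl : IsFirstOrderLength ν N r a b l) (σ c ρ : ℝ) :
    MeasurableSet (halfRegion l σ c ρ) :=
  (measurableSet_Ioo.prod measurableSet_Ioo).inter (measurableSet_halfRegion_sublevel hl σ c ρ)

theorem halfArea_nonneg : 0 ≤ halfArea l σ c ρ := by
  refine integral_nonneg fun ϑ => setIntegral_nonneg measurableSet_Ioo fun s hs => ?_
  split_ifs
  exacts [hs.1.le, le_rfl]

/-- Fubini's theorem with the radius integrated first, which is the order needed for the expansion
angle by angle. -/
theorem lintegral_halfRegion (hl : IsFirstOrderLength ν N r a b l) (σ c ρ : ℝ) :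
    ∫⁻ p in halfRegion l σ c ρ, ENNReal.ofReal (ρ ^ 2 * p.1) =
      ENNReal.ofReal (ρ ^ 2 * halfArea l σ c ρ) := by
  set S := Ioo (0 : ℝ) 3 ×ˢ Ioo (-(π / 2)) (π / 2) with hS
  set T := {p : ℝ × ℝ | l ρ (σ * (p.1 * cos p.2) + c * ρ) (p.1 * sin p.2) ≤ 1} with hT
  have hTm : MeasurableSet T := measurableSet_halfRegion_sublevel hl σ c ρ
  have hSm : MeasurableSet S := measurableSet_Ioo.prod measurableSet_Ioo
  have hSfin : volume S ≠ ⊤ := by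
    rw [hS, Measure.volume_eq_prod, Measure.prod_prod]
    exact ENNReal.mul_ne_top (by simp) (by simp)
  have hint : IntegrableOn (fun p : ℝ × ℝ => ρ ^ 2 * p.1) S := by
    have : IsFiniteMeasure (volume.restrict S) := ⟨by
      rw [Measure.restrict_apply_univ]
      exact hSfin.lt_top⟩
    refine Integrable.of_bound (C := ρ ^ 2 * 3) (by fun_prop) ?_
    refine (ae_restrict_iff' hSm).2 (Eventually.of_forall fun p hp => ?_)
    rw [Real.norm_of_nonneg (mul_nonneg (sq_nonneg _) hp.1.1.le)]
    have := hp.1.2.le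
    gcongr
  have e0 : halfRegion l σ c ρ = S ∩ T := rfl
  rw [e0, ← ofReal_integral_eq_lintegral_ofReal (hint.mono_set inter_subset_left)
    ((ae_restrict_iff' (hSm.inter hTm)).2 (Eventually.of_forall fun p hp =>
      mul_nonneg (sq_nonneg _) hp.1.1.1.le))]
  congr 1
  rw [← setIntegral_indicator hTm]
  have hi : Integrable (T.indicator fun p : ℝ × ℝ => ρ ^ 2 * p.1) (volume.restrict S) :=
    hint.indicator hTm
  rw [hS, Measure.volume_eq_prod, ← Measure.prod_restrict] at hi ⊢
  rw [integral_prod_symm _ hi, halfArea, ← integral_const_mul]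
  congr 1
  ext ϑ
  rw [← integral_const_mul]
  congr 1
  ext s
  simp only [indicator, hT, mem_ofPred_eq, mul_ite, mul_zero]

theorem IsRadialChart.abs_lt_of_le (hc : IsRadialChart Ω f z x L r δ) {k : ℝ} (hk : |k| < δ) :
    |k| < r / 4 := hk.trans_le hc.δ_le

theorem IsRadialChart.eq_center (hc : IsRadialChart Ω f z x L r δ) :
    z + L (sectorMap r 0 0) = x := by
  rw [sectorMap_zero hc.r_pos, hc.map_r, add_sub_cancel]

theorem IsRadialChart.apply_eq (hc : IsRadialChart Ω f z x L r δ) (hu : IsRotSymmOn u Ω z) {k y : ℝ}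
    (hk : |k| < δ) (hy : |y| < δ) :
    u (z + L (sectorMap r k y)) = radialPart u z L r k :=
  hu.eq_radialPart L (hc.mem k y hk hy) (hc.mem k 0 hk (by simpa using hc.δ_pos))

/-- Points with small upper length belong to the amoeba. -/
theorem IsRadialChart.mem_amoeba (h : IsProfileNorm ν N) (hc : IsRadialChart Ω f z x L r δ)
    (hρ : 0 < ρ) {X Y : ℝ} (hX : |ρ * X| < δ) (hY : |ρ * Y| < δ) (hXY : X ≠ 0 ∨ Y ≠ 0)
    (hle : upperLength N (deriv (radialPart f z L r)) r ρ X Y ≤ 1) :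
    z + L (sectorMap r (ρ * X) (ρ * Y)) ∈ amoeba ν Ω f x ρ := by
  refine ⟨hc.mem _ _ hX hY, (h.amoebaDist_le hc.symm hc.r_pos hc.map_r hc.δ_le hc.mem
    hc.differentiableAt hX hY (hXY.imp (mul_ne_zero hρ.ne') (mul_ne_zero hρ.ne'))).trans
      (ENNReal.ofReal_le_ofReal ?_)⟩
  have e : ∀ t : ℝ, N (deriv (radialPart f z L r) (t * (ρ * X)) * (ρ * X),
      √((ρ * X) ^ 2 / (1 + 2 * (t * (ρ * X)) / r) + (1 + 2 * (t * (ρ * X)) / r) * (ρ * Y) ^ 2)) =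
      ρ * N (deriv (radialPart f z L r) (t * (ρ * X)) * X,
        √((1 + 2 * (t * (ρ * X)) / r)⁻¹ * X ^ 2 + (1 + 2 * (t * (ρ * X)) / r) * Y ^ 2)) := by
    intro t
    have e1 : (ρ * X) ^ 2 / (1 + 2 * (t * (ρ * X)) / r) +
        (1 + 2 * (t * (ρ * X)) / r) * (ρ * Y) ^ 2 = ρ ^ 2 *
        ((1 + 2 * (t * (ρ * X)) / r)⁻¹ * X ^ 2 + (1 + 2 * (t * (ρ * X)) / r) * Y ^ 2) := by
      ring
    rw [e1, sqrt_mul (sq_nonneg ρ), sqrt_sq hρ.le, ← N.map_mul_mul hρ.le]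
    congr 2
    ring
  simp only [e, intervalIntegral.integral_const_mul]
  exact mul_le_of_le_one_right hρ.le hle

/-- Points of the amoeba have small lower length. -/
theorem IsRadialChart.lowerLength_le (h : IsProfileNorm ν N) (hc : IsRadialChart Ω f z x L r δ)
    (hρ : 0 < ρ) {X Y : ℝ} (hX : |ρ * X| < δ) (hY : |ρ * Y| < δ)
    (hq : z + L (sectorMap r (ρ * X) (ρ * Y)) ∈ amoeba ν Ω f x ρ) :
    lowerLength N (deriv (radialPart f z L r)) r ρ X Y ≤ 1 := by
  have hr := hc.r_pos
  have h1 := h.norm_le_of_mem_amoeba hc.contDiffOn hρ.le hq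
  have e1 : f (z + L (sectorMap r (ρ * X) (ρ * Y))) - f x =
      ρ * ∫ t in (0 : ℝ)..1, deriv (radialPart f z L r) (t * (ρ * X)) * X := by
    have h0 : |(0 : ℝ)| < δ := by simpa using hc.δ_pos
    have hx : f x = radialPart f z L r 0 := by rw [← hc.apply_eq hc.symm h0 h0, hc.eq_center]
    have hmul : ∀ t ∈ Icc (0 : ℝ) 1, |t * (ρ * X)| < δ := by
      intro t ht
      rw [abs_mul, abs_of_nonneg ht.1]
      exact (mul_le_of_le_one_left (abs_nonneg _) ht.2).trans_lt hX
    have h3 : ∫ t in (0 : ℝ)..1, deriv (radialPart f z L r) (t * (ρ * X)) * (ρ * X) =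
        radialPart f z L r (1 * (ρ * X)) - radialPart f z L r (0 * (ρ * X)) := by
      refine intervalIntegral.integral_eq_sub_of_hasDerivAt
        (f := fun t => radialPart f z L r (t * (ρ * X))) (fun t ht => ?_) ?_
      · rw [uIcc_of_le zero_le_one] at ht
        have h4 := (hc.differentiableAt _ (hmul t ht)).hasDerivAt.comp t
          ((hasDerivAt_id t).mul_const (ρ * X))
        rw [one_mul] at h4
        exact h4
      · refine ContinuousOn.intervalIntegrable ?_
        rw [uIcc_of_le zero_le_one]
        refine ContinuousOn.mul ?_ continuousOn_const
        exact hc.continuousOn_deriv.comp (by fun_prop) fun t ht => abs_lt.1 (hmul t ht)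
    rw [one_mul, zero_mul] at h3
    rw [hc.apply_eq hc.symm hX hY, hx, ← h3, ← intervalIntegral.integral_const_mul]
    refine intervalIntegral.integral_congr fun t _ => ?_
    ring
  have e2 : ‖z + L (sectorMap r (ρ * X) (ρ * Y)) - x‖ = ‖sectorMap r (ρ * X) (ρ * Y) - r‖ := by
    rw [← L.norm_map (_ - _), map_sub, hc.map_r]
    congr 1
    abel
  rw [e1, e2] at h1
  have h2 := le_norm_sectorMap_sub hr (hc.abs_lt_of_le hX) (hc.abs_lt_of_le hY)
  have e3 : ((ρ * X) ^ 2 + (1 + 2 * (ρ * X) / r) * ((ρ * Y) ^ 2 * (1 - (ρ * Y) ^ 2 / r ^ 2))) /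
      (1 + ρ * X / r) = ρ ^ 2 * ((1 + ρ * X / r)⁻¹ * X ^ 2 + ((1 + 2 * (ρ * X) / r) *
        (1 - (ρ * Y) ^ 2 / r ^ 2) * (1 + ρ * X / r)⁻¹) * Y ^ 2) := by
    ring
  rw [e3, sqrt_mul (sq_nonneg ρ), sqrt_sq hρ.le] at h2
  have h4 := (h.mono_snd _ (by positivity) h2).trans h1
  rw [N.map_mul_mul hρ.le] at h4
  exact le_of_mul_le_mul_left (by rw [mul_one]; exact h4) hρ

end Area

/-- A differentiable function stays below a threshold on one side of a nearby level. -/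
theorem eventually_lt_of_side {U : ℝ → ℝ} {U₁ σ c κ : ℝ} (hU : HasStrictDerivAt U U₁ 0)
    (hU1 : U₁ ≠ 0) (hσ : σ * U₁ = -|U₁|) (hσ1 : |σ| = 1) (hκ : U₁ * c < κ) :
    ∀ᶠ ρ in 𝓝[>] (0 : ℝ), ∀ w, 0 ≤ w → w ≤ 4 → U (ρ * (σ * w + c * ρ)) < U 0 + κ * ρ ^ 2 := by
  -- The error tolerance is `|U₁|` itself: compared with the value at `c * ρ ^ 2`, the linear
  -- decrease `|U₁| * ρ * w` compensates the error. Strict differentiability is used because both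
  -- points vary.
  have h1 := hU.hasStrictFDerivAt.isLittleO.def (abs_pos.2 hU1)
  obtain ⟨δ, hδ, h2⟩ := Metric.eventually_nhds_iff.1 h1
  have h3 : HasDerivAt (fun t => U (c * t)) (U₁ * c) 0 := by
    have : HasDerivAt (fun t : ℝ => c * t) c 0 := by simpa using (hasDerivAt_id (0 : ℝ)).const_mul c
    exact HasDerivAt.comp (h₂ := U) 0 (by simpa using hU.hasDerivAt) this
  have h4 := ((hasDerivAt_iff_tendsto_slope.1 h3).mono_left
    (nhdsWithin_mono 0 fun x (hx : 0 < x) => hx.ne')).eventually (Iio_mem_nhds hκ)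
  have h5 : Tendsto (fun ρ : ℝ => ρ ^ 2) (𝓝[>] 0) (𝓝[>] 0) := by
    refine tendsto_nhdsWithin_iff.2 ⟨?_, ?_⟩
    · have : Continuous fun ρ : ℝ => ρ ^ 2 := by fun_prop
      simpa using (this.tendsto 0).mono_left nhdsWithin_le_nhds
    · filter_upwards [self_mem_nhdsWithin] with ρ hρ using pow_pos (mem_Ioi.1 hρ) 2
  have h6 : ∀ᶠ ρ in 𝓝[>] (0 : ℝ), ρ * (4 + |c| * ρ) < δ := by
    have : Continuous fun ρ : ℝ => ρ * (4 + |c| * ρ) := by fun_prop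
    exact (this.continuousAt.eventually (Iio_mem_nhds (by simpa using hδ))).filter_mono
      nhdsWithin_le_nhds
  filter_upwards [h5.eventually h4, h6, self_mem_nhdsWithin] with ρ h7 h8 hρ w hw hw4
  have hρ : 0 < ρ := hρ
  rw [slope_def_field, mul_zero, sub_zero, div_lt_iff₀ (by positivity)] at h7
  have ha : |ρ * (σ * w + c * ρ)| < δ := by
    refine lt_of_le_of_lt ?_ h8
    rw [abs_mul, abs_of_pos hρ]
    gcongr
    refine (abs_add_le _ _).trans ?_
    rw [abs_mul, abs_mul, hσ1, one_mul, abs_of_nonneg hw, abs_of_pos hρ]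
    linarith
  have hb : |c * ρ ^ 2| < δ := by
    refine lt_of_le_of_lt ?_ h8
    rw [abs_mul, abs_of_nonneg (sq_nonneg ρ)]
    nlinarith
  have h9 := h2 (y := (ρ * (σ * w + c * ρ), c * ρ ^ 2)) (by
    rw [Prod.dist_eq]
    simp only [dist_zero_right, Real.norm_eq_abs, max_lt_iff]
    exact ⟨ha, hb⟩)
  simp only [Real.norm_eq_abs, ContinuousLinearMap.toSpanSingleton_apply, smul_eq_mul] at h9
  have e : ρ * (σ * w + c * ρ) - c * ρ ^ 2 = ρ * w * σ := by ring
  rw [e, abs_mul (ρ * w) σ, hσ1, mul_one, abs_of_nonneg (by positivity : 0 ≤ ρ * w)] at h9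
  have h10 := (abs_le.1 h9).2
  have e2 : ρ * w * σ * U₁ = -(ρ * w * |U₁|) := by
    rw [mul_assoc, hσ]
    ring
  rw [e2] at h10
  linarith

/-- The leading terms of the two halves cancel, and the first-order terms have opposite signs.
Allowing different families `l` and `m` permits an inner bound for one half to be compared with an
outer bound for the other. -/
theorem IsFirstOrderLength.eventually_halfArea_lt {ν : ℝ → ℝ} {N : Seminorm ℝ (ℝ × ℝ)}
    {r a b c σ : ℝ} {l m : ℝ → ℝ → ℝ → ℝ} (h : IsProfileNorm ν N)
    (hl : IsFirstOrderLength ν N r a b l) (hm : IsFirstOrderLength ν N r a b m) (hr : 0 < r)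
    (hσ : σ = 1 ∨ σ = -1) (hd : a ≠ 0 ∨ DifferentiableAt ℝ ν 0 ∨ b = 0)
    (hneg : σ * (∫ ϑ in (-(π / 2))..(π / 2), deformation ν r a b c ϑ / ν (a * cos ϑ) ^ 2) < 0) :
    ∀ᶠ ρ in 𝓝[>] (0 : ℝ), halfArea m (-σ) c ρ < halfArea l σ c ρ := by
  have hσ' : -σ = 1 ∨ -σ = -1 := by rcases hσ with rfl | rfl <;> simp
  have h1 := (hm.tendsto_halfArea h hr hσ' c hd).sub (hl.tendsto_halfArea h hr hσ c hd)
  rw [neg_mul, neg_neg, sub_neg_eq_add] at h1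
  have h2 := h1.eventually (Iio_mem_nhds (add_neg hneg hneg))
  filter_upwards [h2, self_mem_nhdsWithin] with ρ h3 hρ
  rw [← sub_div, sub_sub_sub_cancel_right] at h3
  by_contra h4
  exact h3.not_ge (div_nonneg (by linarith) (le_of_lt hρ))

section Area

variable {ν : ℝ → ℝ} {N : Seminorm ℝ (ℝ × ℝ)} {Ω : Set Plane} {f u : Plane → ℝ} {z x : Plane}
  {L : ℂ ≃ₗᵢ[ℝ] Plane} {r δ a b c σ ρ : ℝ}

theorem mem_halfRegion_bounds {l : ℝ → ℝ → ℝ → ℝ} (hσ : |σ| = 1) (hρ : 0 < ρ)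
    (hcρ : |c| * ρ < 1 / 2) (h8 : 4 * ρ < δ) {p : ℝ × ℝ} (hp : p ∈ halfRegion l σ c ρ) :
    |ρ * (σ * (p.1 * cos p.2) + c * ρ)| < δ ∧ |ρ * (p.1 * sin p.2)| < δ := by
  have h1 := hp.1.1
  have hC : |p.1 * cos p.2| ≤ 3 := by
    rw [abs_mul, abs_of_pos h1.1]
    nlinarith [abs_cos_le_one p.2, abs_nonneg (cos p.2), h1.1, h1.2]
  have hS : |p.1 * sin p.2| ≤ 3 := by
    rw [abs_mul, abs_of_pos h1.1]
    nlinarith [abs_sin_le_one p.2, abs_nonneg (sin p.2), h1.1, h1.2]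
  rw [abs_mul, abs_mul, abs_of_pos hρ]
  constructor
  · have : |σ * (p.1 * cos p.2) + c * ρ| ≤ 4 := by
      refine (abs_add_le _ _).trans ?_
      rw [abs_mul, hσ, one_mul, abs_mul c ρ, abs_of_pos hρ]
      linarith
    nlinarith
  · nlinarith

theorem IsRadialChart.volume_image_halfRegion (hc : IsRadialChart Ω f z x L r δ)
    {l : ℝ → ℝ → ℝ → ℝ} (hl : IsFirstOrderLength ν N r a b l) (hσ : |σ| = 1) (hρ : 0 < ρ)
    (hcρ : |c| * ρ < 1 / 2) (h8 : 4 * ρ < δ) :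
    volume ((fun p => z + L (amoebaChart r σ c ρ p)) '' halfRegion l σ c ρ) =
      ENNReal.ofReal (ρ ^ 2 * halfArea l σ c ρ) := by
  rw [volume_amoebaChart_image hc.r_pos hσ hρ (measurableSet_halfRegion hl σ c ρ) ?_ ?_ ?_,
    lintegral_halfRegion hl]
  · rintro p ⟨⟨h1, h2⟩, -⟩
    exact ⟨h1.1, by linarith [h2.1, pi_pos], by linarith [h2.2, pi_pos]⟩
  · exact fun p hp => hc.abs_lt_of_le (mem_halfRegion_bounds hσ hρ hcρ h8 hp).1
  · exact fun p hp => hc.abs_lt_of_le (mem_halfRegion_bounds hσ hρ hcρ h8 hp).2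

/-- The half region of the upper length maps into the amoeba, on the side of the cut where `u` is
below `m`. Only `x` itself may be missed, as the coordinate line to it is not regular, and a point
has no area. -/
theorem IsRadialChart.le_volume_lower (h : IsProfileNorm ν N) (hc : IsRadialChart Ω f z x L r δ)
    (hu : IsRotSymmOn u Ω z) (hl : IsFirstOrderLength ν N r a b
      (upperLength N (deriv (radialPart f z L r)) r)) (hσ : |σ| = 1) (hρ : 0 < ρ)
    (hcρ : |c| * ρ < 1 / 2) (h8 : 4 * ρ < δ) {m : ℝ}
    (hm : ∀ w, 0 ≤ w → w ≤ 4 → radialPart u z L r (ρ * (σ * w + c * ρ)) < m) :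
    ENNReal.ofReal (ρ ^ 2 * halfArea (upperLength N (deriv (radialPart f z L r)) r) σ c ρ) ≤
      volume {q | q ∈ amoeba ν Ω f x ρ ∧ u q < m} := by
  rw [← hc.volume_image_halfRegion hl hσ hρ hcρ h8]
  have hsub : (fun p => z + L (amoebaChart r σ c ρ p)) ''
      halfRegion (upperLength N (deriv (radialPart f z L r)) r) σ c ρ ⊆
      {q | q ∈ amoeba ν Ω f x ρ ∧ u q < m} ∪ {x} := by
    rintro _ ⟨p, hp, rfl⟩
    obtain ⟨h1, h2⟩ := mem_halfRegion_bounds hσ hρ hcρ h8 hp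
    by_cases h0 : σ * (p.1 * cos p.2) + c * ρ ≠ 0 ∨ p.1 * sin p.2 ≠ 0
    · left
      refine ⟨hc.mem_amoeba h hρ h1 h2 h0 hp.2, ?_⟩
      simp only [amoebaChart]
      rw [hc.apply_eq hu h1 h2]
      have hcos : 0 ≤ cos p.2 := (cos_pos_of_mem_Ioo hp.1.2).le
      refine hm _ (mul_nonneg hp.1.1.1.le hcos) ?_
      nlinarith [cos_le_one p.2, hp.1.1.1, hp.1.1.2]
    · right
      push Not at h0
      simp only [amoebaChart, mem_singleton_iff]
      rw [h0.1, h0.2, mul_zero, hc.eq_center]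
  refine (measure_mono hsub).trans ((measure_union_le _ _).trans ?_)
  simp

theorem exists_polar_right {v Y : ℝ} (hv : 0 < v) :
    ∃ s ϑ : ℝ, 0 < s ∧ ϑ ∈ Ioo (-(π / 2)) (π / 2) ∧ s * cos ϑ = v ∧ s * sin ϑ = Y ∧
      s ^ 2 = v ^ 2 + Y ^ 2 := by
  set w : ℂ := ⟨v, Y⟩ with hw
  have hw0 : w ≠ 0 := fun h => hv.ne' (congrArg Complex.re h)
  refine ⟨‖w‖, w.arg, norm_pos_iff.2 hw0, ?_, Complex.norm_mul_cos_arg w,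
    Complex.norm_mul_sin_arg w, ?_⟩
  · exact abs_lt.1 (Complex.abs_arg_lt_pi_div_two_iff.2 (Or.inl hv))
  · rw [Complex.sq_norm, Complex.normSq_mk]
    ring

/-- A point of the amoeba that is not below `m` cannot lie on side `σ` of the cut or on the cut
itself. It lies strictly on the other side, and its lower length is at most one. -/
theorem IsRadialChart.volume_upper_le (h : IsProfileNorm ν N) (hc : IsRadialChart Ω f z x L r δ)
    (hu : IsRotSymmOn u Ω z) (hl : IsFirstOrderLength ν N r a b
      (lowerLength N (deriv (radialPart f z L r)) r)) (hσ : |σ| = 1) (hρ : 0 < ρ)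
    (hcρ : |c| * ρ < 1 / 2) (h8 : 4 * ρ < δ) {m : ℝ}
    (hm : ∀ w, 0 ≤ w → w ≤ 4 → radialPart u z L r (ρ * (σ * w + c * ρ)) < m) :
    volume {q | q ∈ amoeba ν Ω f x ρ ∧ ¬ u q < m} ≤
      ENNReal.ofReal (ρ ^ 2 *
        halfArea (lowerLength N (deriv (radialPart f z L r)) r) (-σ) c ρ) := by
  have hσ2 : σ ^ 2 = 1 := by rw [← sq_abs, hσ, one_pow]
  rw [← hc.volume_image_halfRegion hl (by rwa [abs_neg]) hρ hcρ h8]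
  refine measure_mono ?_
  rintro q ⟨hq, hqm⟩
  have hδr := hc.δ_le
  have h1 : ‖q - x‖ ≤ ρ := by
    have := (h.abs_le _ _).trans (h.norm_le_of_mem_amoeba hc.contDiffOn hρ.le hq)
    rwa [abs_norm] at this
  have h2 : ‖L.symm (q - z) - r‖ ≤ ρ := by
    rw [← L.norm_map, map_sub, hc.map_r, L.apply_symm_apply]
    simpa using h1
  obtain ⟨k, y, h3, h4⟩ := exists_sectorMap_eq hc.r_pos (by linarith [hc.r_pos]) h2
  have hq' : z + L (sectorMap r k y) = q := by
    rw [h3, L.apply_symm_apply, add_sub_cancel]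
  have hk : k = ρ * (k / ρ) := by field_simp
  have hy : y = ρ * (y / ρ) := by field_simp
  set K := k / ρ with hK
  set Y := y / ρ with hY
  have h5 : K ^ 2 + Y ^ 2 ≤ 4 := by
    rw [hk, hy] at h4
    have : ρ ^ 2 * (K ^ 2 + Y ^ 2) ≤ ρ ^ 2 * 4 := by linarith
    exact le_of_mul_le_mul_left this (by positivity)
  have hK2 : |K| ≤ 2 := abs_le_of_sq_le_sq (by nlinarith [sq_nonneg Y]) (by norm_num)
  have hY2 : |Y| ≤ 2 := abs_le_of_sq_le_sq (by nlinarith [sq_nonneg K]) (by norm_num)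
  have hkδ : |ρ * K| < δ := by
    rw [abs_mul, abs_of_pos hρ]
    nlinarith
  have hyδ : |ρ * Y| < δ := by
    rw [abs_mul, abs_of_pos hρ]
    nlinarith
  rw [hk, hy] at hq'
  have hcρ' : |c * ρ| < 1 / 2 := by rwa [abs_mul, abs_of_pos hρ]
  have hv : 0 < -σ * (K - c * ρ) := by
    by_contra hv
    refine hqm ?_
    rw [← hq', hc.apply_eq hu hkδ hyδ]
    have h6 := hm (σ * (K - c * ρ)) (by linarith) (by
      refine (le_abs_self _).trans ?_
      rw [abs_mul, hσ, one_mul]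
      refine (abs_sub _ _).trans (by linarith))
    have e : σ * (σ * (K - c * ρ)) + c * ρ = K := by linear_combination (K - c * ρ) * hσ2
    rwa [e] at h6
  obtain ⟨s, ϑ, hs, hϑ, e1, e2, e3⟩ := exists_polar_right (Y := Y) hv
  have e4 : -σ * (s * cos ϑ) + c * ρ = K := by
    rw [e1]
    linear_combination (K - c * ρ) * hσ2
  refine ⟨(s, ϑ), ⟨⟨⟨hs, ?_⟩, hϑ⟩, ?_⟩, ?_⟩
  -- Here the cut-off radius `3` is justified: moving the origin by at most `1 / 2` raises the bound
  -- `4` for `K ^ 2 + Y ^ 2` to at most `4 + 2 + 1 / 4`.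
  · have h7 : s ^ 2 < 3 ^ 2 := by
      have e5 : (-σ * (K - c * ρ)) ^ 2 = K ^ 2 - 2 * K * (c * ρ) + (c * ρ) ^ 2 := by
        linear_combination (K - c * ρ) ^ 2 * hσ2
      have h9 : -(K * (c * ρ)) ≤ 2 * (1 / 2) := by
        refine (neg_le_abs _).trans ?_
        rw [abs_mul]
        gcongr
      have h10 : (c * ρ) ^ 2 ≤ (1 / 2) ^ 2 := sq_le_sq' (by linarith [abs_lt.1 hcρ'])
        (by linarith [abs_lt.1 hcρ'])
      rw [e3, e5]
      linarith
    exact lt_of_pow_lt_pow_left₀ 2 (by norm_num) h7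
  · simp only
    rw [e4, e2]
    refine hc.lowerLength_le h hρ hkδ hyδ ?_
    rw [hq']
    exact hq
  · simp only [amoebaChart]
    rw [e4, e2, hq']

/-- If the threshold `κ` exceeds the critical value, then the values below `u x + κ * ρ ^ 2` fill
more than half of the amoeba of radius `ρ`. -/
theorem IsRadialChart.eventually_half_lt (h : IsProfileNorm ν N)
    (hc : IsRadialChart Ω f z x L r δ) (hu : IsRotSymmOn u Ω z)
    (hb : HasDerivAt (deriv (radialPart f z L r)) b 0)
    (hd : deriv (radialPart f z L r) 0 ≠ 0 ∨ DifferentiableAt ℝ ν 0 ∨ b = 0) {U₁ κ C : ℝ}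
    (hU : HasStrictDerivAt (radialPart u z L r) U₁ 0) (hU1 : U₁ ≠ 0)
    (hC : ∀ c, ∫ ϑ in (-(π / 2))..(π / 2),
      deformation ν r (deriv (radialPart f z L r) 0) b c ϑ /
        ν (deriv (radialPart f z L r) 0 * cos ϑ) ^ 2 = 2 * (c - C))
    (hκ : U₁ * C < κ) :
    ∀ᶠ ρ in 𝓝[>] (0 : ℝ), volume (amoeba ν Ω f x ρ) / 2 <
      volume {q | q ∈ amoeba ν Ω f x ρ ∧ u q < u x + κ * ρ ^ 2} := by
  -- The side towards which `u` decreases.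
  obtain ⟨σ, hσ, hσU⟩ : ∃ σ : ℝ, (σ = 1 ∨ σ = -1) ∧ σ * U₁ = -|U₁| := by
    rcases le_total 0 U₁ with h0 | h0
    · exact ⟨-1, Or.inr rfl, by rw [abs_of_nonneg h0, neg_one_mul]⟩
    · exact ⟨1, Or.inl rfl, by rw [abs_of_nonpos h0, neg_neg, one_mul]⟩
  have hσ1 : |σ| = 1 := by rcases hσ with rfl | rfl <;> simp
  -- The cut is placed so that `U₁ * c` is midway between `U₁ * C` and `κ`: strictly past balance,
  -- yet with values of `u` still below the threshold.
  set c := (U₁ * C + κ) / (2 * U₁) with hcdef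
  have hUc : U₁ * c = (U₁ * C + κ) / 2 := by
    rw [hcdef]
    field_simp
  have hneg : σ * (2 * (c - C)) < 0 := by
    have h1 : 0 < U₁ * (c - C) := by
      rw [mul_sub, hUc]
      linarith
    have h2 : (σ * (2 * (c - C))) * U₁ ^ 2 = -(2 * |U₁| * (U₁ * (c - C))) := by
      linear_combination (2 * (c - C) * U₁) * hσU
    have h3 : 0 < |U₁| := abs_pos.2 hU1
    have h4 : 0 < U₁ ^ 2 := by positivity
    by_contra h5
    have h6 : 0 ≤ (σ * (2 * (c - C))) * U₁ ^ 2 := mul_nonneg (not_lt.1 h5) h4.le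
    have h7 : 0 < 2 * |U₁| * (U₁ * (c - C)) := by positivity
    linarith
  have hm := (measurable_deriv (radialPart f z L r))
  have hup := h.isFirstOrderLength_upperLength hm hb rfl hc.r_pos
  have hlo := h.isFirstOrderLength_lowerLength hm hb rfl hc.r_pos
  have hlt := hup.eventually_halfArea_lt (c := c) (σ := σ) h hlo hc.r_pos hσ hd
    (by rw [hC]; exact hneg)
  have hside := eventually_lt_of_side hU hU1 hσU hσ1 (c := c) (κ := κ) (by rw [hUc]; linarith)
  have ev1 : ∀ᶠ ρ in 𝓝[>] (0 : ℝ), |c| * ρ < 1 / 2 := by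
    have : Continuous fun ρ : ℝ => |c| * ρ := by fun_prop
    exact (this.continuousAt.eventually (Iio_mem_nhds (by simp))).filter_mono nhdsWithin_le_nhds
  have ev2 : ∀ᶠ ρ in 𝓝[>] (0 : ℝ), 4 * ρ < δ := by
    have : Continuous fun ρ : ℝ => 4 * ρ := by fun_prop
    exact (this.continuousAt.eventually (Iio_mem_nhds (by simpa using hc.δ_pos))).filter_mono
      nhdsWithin_le_nhds
  have hux : u x = radialPart u z L r 0 := by
    have h0 : |(0 : ℝ)| < δ := by simpa using hc.δ_pos
    rw [← hc.apply_eq hu h0 h0, hc.eq_center]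
  filter_upwards [hlt, hside, ev1, ev2, self_mem_nhdsWithin] with ρ g1 g2 g3 g4 hρ
  have hρ : 0 < ρ := hρ
  rw [← hux] at g2
  have hP := hc.le_volume_lower h hu hup hσ1 hρ g3 g4 g2
  have hQ := hc.volume_upper_le h hu hlo hσ1 hρ g3 g4 g2
  set A := amoeba ν Ω f x ρ with hA
  set P := volume {q | q ∈ A ∧ u q < u x + κ * ρ ^ 2} with hPdef
  set Q := volume {q | q ∈ A ∧ ¬ u q < u x + κ * ρ ^ 2} with hQdef
  -- Subadditivity suffices, so measurability of the amoeba is not needed.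
  have hAle : volume A ≤ P + Q := by
    refine (measure_mono fun q hq => ?_).trans (measure_union_le _ _)
    by_cases hqu : u q < u x + κ * ρ ^ 2
    · exact Or.inl ⟨hq, hqu⟩
    · exact Or.inr ⟨hq, hqu⟩
  have hQP : Q < P := by
    refine hQ.trans_lt (lt_of_lt_of_le ?_ hP)
    refine (ENNReal.ofReal_lt_ofReal_iff_of_nonneg ?_).2 (by gcongr)
    exact mul_nonneg (sq_nonneg ρ) halfArea_nonneg
  have hAfin : volume A ≠ ⊤ := by
    refine ((measure_mono (fun q hq => ?_)).trans_lt
      (measure_closedBall_lt_top (x := x) (r := ρ))).ne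
    have := (h.abs_le _ _).trans (h.norm_le_of_mem_amoeba hc.contDiffOn hρ.le hq)
    rwa [abs_norm, ← dist_eq_norm] at this
  have hPfin : P ≠ ⊤ := ((measure_mono fun q hq => hq.1).trans_lt hAfin.lt_top).ne
  rw [ENNReal.div_lt_iff (by simp) (by simp)]
  refine hAle.trans_lt ?_
  rw [mul_two]
  exact ENNReal.add_lt_add_left hPfin hQP

end Area

/-! ### Existence of medians and the squeezing argument. -/

/-- A function that is continuous around and bounded below on a set has a median there if some
sublevel set covers more than half of the set. -/
theorem exists_isMedianOn {u : Plane → ℝ} {A O : Set Plane} (hO : IsOpen O) (hAO : A ⊆ O)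
    (hu : ContinuousOn u O) {B κ : ℝ} (hB : ∀ q ∈ A, B ≤ u q)
    (hκ : volume A / 2 < volume {q | q ∈ A ∧ u q < κ}) : ∃ m, IsMedianOn u A m := by
  -- The median is the supremum of the thresholds with at most half of the area below them.
  set M : Set ℝ := {m | volume {q | q ∈ A ∧ u q < m} ≤ volume A / 2} with hM
  have hmono : ∀ {m m' : ℝ}, m ≤ m' →
      volume {q | q ∈ A ∧ u q < m} ≤ volume {q | q ∈ A ∧ u q < m'} := fun hmm =>
    measure_mono fun q hq => ⟨hq.1, hq.2.trans_le hmm⟩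
  have hne : M.Nonempty := by
    refine ⟨B, ?_⟩
    have : {q | q ∈ A ∧ u q < B} = ∅ := by
      ext q
      simp only [mem_ofPred_eq, mem_empty_iff_false, iff_false, not_and, not_lt]
      exact hB q
    change volume {q | q ∈ A ∧ u q < B} ≤ volume A / 2
    rw [this, measure_empty]
    exact bot_le
  have hbdd : BddAbove M := by
    refine ⟨κ, fun m hm => ?_⟩
    by_contra h
    exact absurd (hκ.trans_le ((hmono (not_le.1 h).le).trans hm)) (lt_irrefl _)
  refine ⟨sSup M, ?_, ?_⟩
  · obtain ⟨w, hw, hwt, hwM⟩ := exists_seq_tendsto_sSup hne hbdd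
    have hsub : {q | q ∈ A ∧ u q < sSup M} ⊆ ⋃ n, {q | q ∈ A ∧ u q < w n} := by
      rintro q ⟨hq, hqm⟩
      obtain ⟨n, hn⟩ := (hwt.eventually (Ioi_mem_nhds hqm)).exists
      exact mem_iUnion.2 ⟨n, hq, hn⟩
    refine (measure_mono hsub).trans ?_
    have hmon : Monotone fun n => {q | q ∈ A ∧ u q < w n} := fun i j hij q hq =>
      ⟨hq.1, hq.2.trans_le (hw hij)⟩
    rw [hmon.measure_iUnion]
    exact iSup_le hwM
  · have hsub : {q | q ∈ A ∧ sSup M < u q} ⊆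
        ⋃ n : ℕ, {q | q ∈ A ∧ sSup M + 1 / ((n : ℝ) + 1) ≤ u q} := by
      rintro q ⟨hq, hqm⟩
      obtain ⟨n, hn⟩ := exists_nat_one_div_lt (sub_pos.2 hqm)
      exact mem_iUnion.2 ⟨n, hq, by linarith⟩
    refine (measure_mono hsub).trans ?_
    have hmon : Monotone fun n : ℕ => {q | q ∈ A ∧ sSup M + 1 / ((n : ℝ) + 1) ≤ u q} := by
      intro i j hij q hq
      refine ⟨hq.1, le_trans ?_ hq.2⟩
      gcongr
    rw [hmon.measure_iUnion]
    refine iSup_le fun n => ?_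
    set m := sSup M + 1 / ((n : ℝ) + 1) with hm
    have hmM : m ∉ M := fun h => by
      have h1 := le_csSup hbdd h
      have h2 : 0 < 1 / ((n : ℝ) + 1) := by positivity
      linarith
    have hlt : volume A / 2 < volume {q | q ∈ A ∧ u q < m} := not_le.1 hmM
    -- Continuity makes the cutting set measurable, and a measurable set splits the outer measure of
    -- an arbitrary `A` additively.
    have hT : MeasurableSet (O ∩ u ⁻¹' Iio m) := (hu.isOpen_inter_preimage hO isOpen_Iio).measurableSet
    have hsplit := measure_inter_add_sdiff (μ := volume) A hT
    have e1 : A ∩ (O ∩ u ⁻¹' Iio m) = {q | q ∈ A ∧ u q < m} := by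
      ext q
      exact ⟨fun hq => ⟨hq.1, hq.2.2⟩, fun hq => ⟨hq.1, hAO hq.1, hq.2⟩⟩
    have e2 : A \ (O ∩ u ⁻¹' Iio m) = {q | q ∈ A ∧ m ≤ u q} := by
      ext q
      exact ⟨fun hq => ⟨hq.1, not_lt.1 fun h => hq.2 ⟨hAO hq.1, h⟩⟩,
        fun hq => ⟨hq.1, fun h => absurd h.2 (not_lt.2 hq.2)⟩⟩
    rw [e1, e2] at hsplit
    by_contra h
    rw [not_le] at h
    have := ENNReal.add_lt_add hlt h
    rw [ENNReal.add_halves, hsplit] at this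
    exact lt_irrefl _ this

/-- A criterion for the asymptotic behaviour of the amoeba median filter: thresholds that deviate to
first order from the claimed limit have more than half of the amoeba on their far side. -/
theorem amoebaStepApproximates_of_half_lt {ν : ℝ → ℝ} {Ω : Set Plane} {f u : Plane → ℝ} {x : Plane}
    {R : ℝ} (hx : x ∈ interior Ω) (hu : ContinuousOn u Ω)
    (hA : ∀ ρ, 0 ≤ ρ → amoeba ν Ω f x ρ ⊆ Metric.closedBall x ρ)
    (hup : ∀ κ, R / 6 < κ → ∀ᶠ ρ in 𝓝[>] (0 : ℝ), volume (amoeba ν Ω f x ρ) / 2 <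
      volume {q | q ∈ amoeba ν Ω f x ρ ∧ u q < u x + κ * ρ ^ 2})
    (hlo : ∀ κ, κ < R / 6 → ∀ᶠ ρ in 𝓝[>] (0 : ℝ), volume (amoeba ν Ω f x ρ) / 2 <
      volume {q | q ∈ amoeba ν Ω f x ρ ∧ u x + κ * ρ ^ 2 < u q}) :
    AmoebaStepApproximates ν Ω f u x R := by
  refine ⟨?_, fun μ hμ => ?_⟩
  · obtain ⟨ε, hε, hεΩ⟩ := Metric.isOpen_iff.1 isOpen_interior x hx
    have h1 : ∀ᶠ ρ in 𝓝[>] (0 : ℝ), ρ < ε := nhdsWithin_le_nhds (Iio_mem_nhds hε)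
    filter_upwards [hup (R / 6 + 1) (by linarith), h1, self_mem_nhdsWithin] with ρ h2 h3 h4
    have h4 : 0 < ρ := h4
    have h5 : Metric.closedBall x ρ ⊆ interior Ω := (Metric.closedBall_subset_ball h3).trans hεΩ
    have hu' : ContinuousOn u (interior Ω) := hu.mono interior_subset
    obtain ⟨B, hB⟩ := (isCompact_closedBall x ρ).bddBelow_image (hu'.mono h5)
    exact exists_isMedianOn isOpen_interior ((hA ρ h4.le).trans h5) hu' (B := B)
      (fun q hq => hB (mem_image_of_mem u (hA ρ h4.le hq))) h2
  · rw [tendsto_order]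
    constructor
    · intro R' hR'
      filter_upwards [hμ, hlo (R' / 6) (by linarith), self_mem_nhdsWithin] with ρ h1 h2 h3
      have h3 : 0 < ρ := h3
      have h4 : u x + R' / 6 * ρ ^ 2 < μ ρ := by
        by_contra h4
        refine absurd h1.2 (not_le.2 (h2.trans_le (measure_mono fun q hq => ?_)))
        exact ⟨hq.1, (not_lt.1 h4).trans_lt hq.2⟩
      rw [lt_div_iff₀ (by positivity)]
      linarith
    · intro R' hR'
      filter_upwards [hμ, hup (R' / 6) (by linarith), self_mem_nhdsWithin] with ρ h1 h2 h3
      have h3 : 0 < ρ := h3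
      have h4 : μ ρ < u x + R' / 6 * ρ ^ 2 := by
        by_contra h4
        refine absurd h1.1 (not_le.2 (h2.trans_le (measure_mono fun q hq => ?_)))
        exact ⟨hq.1, hq.2.trans_le (not_lt.1 h4)⟩
      rw [div_lt_iff₀ (by positivity)]
      linarith

/-! ### Rotationally symmetric functions and their restrictions to rays. -/

/-- There is an isometry of the plane with the complex numbers that maps a given vector to its
norm. -/
theorem exists_linearIsometryEquiv_norm (v : Plane) : ∃ L : ℂ ≃ₗᵢ[ℝ] Plane, L ‖v‖ = v := by
  set w := Complex.orthonormalBasisOneI.repr.symm v with hw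
  refine ⟨(rotation (Circle.exp w.arg)).trans Complex.orthonormalBasisOneI.repr, ?_⟩
  have h1 : rotation (Circle.exp w.arg) ‖v‖ = w := by
    rw [rotation_apply, Circle.coe_exp, mul_comm]
    have : ‖v‖ = ‖w‖ := by rw [hw, LinearIsometryEquiv.norm_map]
    rw [this]
    exact Complex.norm_mul_exp_arg_mul_I w
  rw [LinearIsometryEquiv.trans_apply, h1, hw, LinearIsometryEquiv.apply_symm_apply]

/-- The gradient of a rotationally symmetric function vanishes at the centre. -/
theorem IsRotSymmOn.gradient_eq_zero {u : Plane → ℝ} {Ω : Set Plane} {z : Plane}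
    (hu : IsRotSymmOn u Ω z) (hz : z ∈ interior Ω) (hd : DifferentiableAt ℝ u z) : ∇ u z = 0 := by
  have hc : Continuous fun q : Plane => z + z - q := by fun_prop
  have h1 : ∀ᶠ q in 𝓝 z, q ∈ interior Ω := isOpen_interior.mem_nhds hz
  have h2 : ∀ᶠ q in 𝓝 z, z + z - q ∈ interior Ω := by
    refine hc.continuousAt.eventually (p := fun q => q ∈ interior Ω) ?_
    change ∀ᶠ y in 𝓝 (z + z - z), y ∈ interior Ω
    rw [add_sub_cancel_right]
    exact h1
  -- The point reflection in the centre preserves `u`, hence the derivative at the centre equals its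
  -- negative.
  have h3 : (fun q => u (z + z - q)) =ᶠ[𝓝 z] u := by
    filter_upwards [h1, h2] with q g1 g2
    refine hu _ (interior_subset g2) _ (interior_subset g1) ?_
    rw [dist_eq_norm, dist_eq_norm, ← norm_neg]
    congr 1
    abel
  have h4 : HasFDerivAt (fun q : Plane => z + z - q) (-(ContinuousLinearMap.id ℝ Plane)) z :=
    (hasFDerivAt_id z).const_sub (z + z)
  have h5 : HasFDerivAt u (fderiv ℝ u z) (z + z - z) := by
    rw [add_sub_cancel_right]
    exact hd.hasFDerivAt
  have h6 := (h5.comp z h4).congr_of_eventuallyEq h3.symm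
  have h7 := hd.hasFDerivAt.unique h6
  have h8 : fderiv ℝ u z = 0 := by
    ext v
    have := congrArg (fun φ : Plane →L[ℝ] ℝ => φ v) h7
    simp at this
    simp
    linarith
  rw [gradient, h8, map_zero]

/-- The restriction of a function to a ray. -/
noncomputable def rayPart (f : Plane → ℝ) (z : Plane) (L : ℂ ≃ₗᵢ[ℝ] Plane) (t : ℝ) : ℝ :=
  f (z + L (t : ℂ))

section Ray

variable {Ω : Set Plane} {f u : Plane → ℝ} {z x : Plane} {L : ℂ ≃ₗᵢ[ℝ] Plane} {r : ℝ}

theorem radialPart_eq_rayPart (f : Plane → ℝ) (z : Plane) (L : ℂ ≃ₗᵢ[ℝ] Plane) (r k : ℝ) :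
    radialPart f z L r k = rayPart f z L √(r ^ 2 + 2 * r * k) := by
  rw [radialPart, rayPart, sectorMap_zero_right]

theorem contDiff_ray (z : Plane) (L : ℂ ≃ₗᵢ[ℝ] Plane) :
    ContDiff ℝ ∞ fun t : ℝ => z + L (t : ℂ) :=
  contDiff_const.add (L.toContinuousLinearEquiv.contDiff.comp Complex.ofRealCLM.contDiff)

theorem ContDiffOn.contDiffAt_rayPart (hf : ContDiffOn ℝ ∞ f Ω) {t : ℝ}
    (ht : z + L (t : ℂ) ∈ interior Ω) : ContDiffAt ℝ ∞ (rayPart f z L) t :=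
  (hf.contDiffAt (mem_interior_iff_mem_nhds.1 ht)).comp t (contDiff_ray z L).contDiffAt

theorem ContDiffAt.contDiffAt_deriv {g : ℝ → ℝ} {t : ℝ} (hg : ContDiffAt ℝ ∞ g t) :
    ContDiffAt ℝ ∞ (deriv g) t := by
  have h1 : ContDiffAt ℝ ∞ (fderiv ℝ g) t := hg.fderiv_right (by simp)
  exact h1.clm_apply contDiffAt_const

theorem ContDiffOn.contDiffAt_radialPart (hf : ContDiffOn ℝ ∞ f Ω) {k : ℝ}
    (hk : z + L (sectorMap r k 0) ∈ interior Ω) (hpos : 0 < r ^ 2 + 2 * r * k) :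
    ContDiffAt ℝ ∞ (radialPart f z L r) k := by
  have h1 : radialPart f z L r = fun k => rayPart f z L √(r ^ 2 + 2 * r * k) :=
    funext fun k => radialPart_eq_rayPart f z L r k
  rw [h1]
  rw [sectorMap_zero_right] at hk
  refine ContDiffAt.comp (g := rayPart f z L) (f := fun k => √(r ^ 2 + 2 * r * k)) k
    (hf.contDiffAt_rayPart hk) (ContDiffAt.sqrt (f := fun k => r ^ 2 + 2 * r * k) ?_ hpos.ne')
  exact contDiffAt_const.add (contDiffAt_const.mul contDiffAt_id)

/-- Area-preserving polar coordinates exist around every interior point other than the centre. -/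
theorem exists_isRadialChart (hf : ContDiffOn ℝ ∞ f Ω) (hfz : IsRotSymmOn f Ω z)
    (hx : x ∈ interior Ω) (hr : 0 < r) (hL : L r = x - z) :
    ∃ δ, IsRadialChart Ω f z x L r δ := by
  have hc : Continuous fun p : ℝ × ℝ => z + L (sectorMap r p.1 p.2) :=
    continuous_const.add (L.continuous.comp (continuous_sectorMap r))
  have h0 : z + L (sectorMap r (0 : ℝ × ℝ).1 (0 : ℝ × ℝ).2) ∈ interior Ω := by
    simp only [Prod.fst_zero, Prod.snd_zero]
    rwa [sectorMap_zero hr, hL, add_sub_cancel]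
  obtain ⟨ε, hε, hεΩ⟩ := Metric.eventually_nhds_iff.1
    (hc.continuousAt.eventually (isOpen_interior.mem_nhds h0))
  have hmem : ∀ k y, |k| < min ε (r / 4) → |y| < min ε (r / 4) →
      z + L (sectorMap r k y) ∈ interior Ω := by
    intro k y hk hy
    refine hεΩ (y := (k, y)) ?_
    rw [dist_zero_right, Prod.norm_def]
    exact max_lt (hk.trans_le (min_le_left _ _)) (hy.trans_le (min_le_left _ _))
  have hpos : 0 < min ε (r / 4) := by positivity
  have hsm : ∀ k, |k| < min ε (r / 4) → ContDiffAt ℝ ∞ (radialPart f z L r) k := fun k hk =>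
    hf.contDiffAt_radialPart (hmem k 0 hk (by simpa using ⟨hε, hr⟩))
      (sectorMap_radicand_pos hr (hk.trans_le (min_le_right _ _)))
  refine ⟨min ε (r / 4), hr, hL, hpos, min_le_right _ _, fun k y hk hy =>
    interior_subset (hmem k y hk hy), hfz, hf.of_le (by simp), fun k hk =>
    (hsm k hk).differentiableAt (by simp), fun k hk => ?_⟩
  exact (hsm k (abs_lt.2 hk)).contDiffAt_deriv.continuousAt.continuousWithinAt

/-- The first two derivatives of the radial part in terms of those along the ray. -/
theorem hasDerivAt_deriv_radialPart (hr : 0 < r)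
    (hf : ∀ᶠ t in 𝓝 r, ContDiffAt ℝ ∞ (rayPart f z L) t) :
    deriv (radialPart f z L r) 0 = deriv (rayPart f z L) r ∧
    HasDerivAt (deriv (radialPart f z L r))
      (deriv (deriv (rayPart f z L)) r - deriv (rayPart f z L) r / r) 0 := by
  have hR : ∀ᶠ k in 𝓝 (0 : ℝ), 0 < r ^ 2 + 2 * r * k := by
    have : Continuous fun k : ℝ => r ^ 2 + 2 * r * k := by fun_prop
    exact this.continuousAt.eventually (Ioi_mem_nhds (by simp; positivity))
  have hR0 : √(r ^ 2 + 2 * r * 0) = r := by rw [mul_zero, add_zero, sqrt_sq hr.le]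
  have hRd : ∀ k, 0 < r ^ 2 + 2 * r * k →
      HasDerivAt (fun k => √(r ^ 2 + 2 * r * k)) (r / √(r ^ 2 + 2 * r * k)) k := by
    intro k hk
    have h := ((hasDerivAt_id k).const_mul (2 * r)).const_add (r ^ 2)
    refine (h.sqrt (by simpa using hk.ne')).congr_deriv ?_
    simp only [id, mul_one]
    have := sqrt_pos.2 hk
    field_simp
  have hRc : ContinuousAt (fun k => √(r ^ 2 + 2 * r * k)) 0 := by fun_prop
  have hev' : ∀ᶠ k in 𝓝 (0 : ℝ), ContDiffAt ℝ ∞ (rayPart f z L) √(r ^ 2 + 2 * r * k) := by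
    refine hRc.eventually (p := fun t => ContDiffAt ℝ ∞ (rayPart f z L) t) ?_
    change ∀ᶠ t in 𝓝 √(r ^ 2 + 2 * r * 0), ContDiffAt ℝ ∞ (rayPart f z L) t
    rwa [hR0]
  have hfun : radialPart f z L r = fun k => rayPart f z L √(r ^ 2 + 2 * r * k) :=
    funext fun k => radialPart_eq_rayPart f z L r k
  -- The factor `r / R` equals `1` at `k = 0` and has derivative `-1 / r` there, which is the source
  -- of the correction in the second derivative.
  have hder : ∀ᶠ k in 𝓝 (0 : ℝ), deriv (radialPart f z L r) k =
      deriv (rayPart f z L) √(r ^ 2 + 2 * r * k) * (r / √(r ^ 2 + 2 * r * k)) := by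
    filter_upwards [hR, hev'] with k h1 h2
    rw [hfun]
    have h3 := (h2.differentiableAt (by simp)).hasDerivAt
    exact (h3.comp k (hRd k h1)).deriv
  have hpos0 : 0 < r ^ 2 + 2 * r * 0 := by simp; positivity
  constructor
  · rw [hder.self_of_nhds, hR0, div_self hr.ne', mul_one]
  · have h1 : HasDerivAt (deriv (rayPart f z L)) (deriv (deriv (rayPart f z L)) r)
        √(r ^ 2 + 2 * r * 0) := by
      rw [hR0]
      exact (hf.self_of_nhds.contDiffAt_deriv.differentiableAt (by simp)).hasDerivAt
    have h2 := hRd 0 hpos0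
    have h3 := (h1.comp (0 : ℝ) h2).mul ((hasDerivAt_const (0 : ℝ) r).div h2
      (by rw [hR0]; exact hr.ne'))
    refine (h3.congr_of_eventuallyEq hder).congr_deriv ?_
    simp only [Function.comp, Pi.div_apply, hR0]
    field_simp
    ring

end Ray

section Radial

variable {z x : Plane} {φ : ℝ → ℝ} {φ' : ℝ}

theorem hasFDerivAt_norm_sub (hx : x ≠ z) :
    HasFDerivAt (fun q : Plane => ‖q - z‖) (‖x - z‖⁻¹ • innerSL ℝ (x - z)) x := by
  have hpos : 0 < ‖x - z‖ := norm_pos_iff.2 (sub_ne_zero.2 hx)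
  have h1 := ((hasFDerivAt_id x).sub_const z).norm_sq.sqrt (by simpa using hpos.ne')
  simp only [id, sqrt_sq (norm_nonneg _)] at h1
  refine h1.congr_fderiv ?_
  ext v
  simp
  field_simp

/-- The derivative of a radial vector field. -/
theorem hasFDerivAt_radial (hx : x ≠ z) (hφ : HasDerivAt φ φ' ‖x - z‖) :
    HasFDerivAt (fun q : Plane => φ ‖q - z‖ • (q - z))
      (φ ‖x - z‖ • ContinuousLinearMap.id ℝ Plane +
        (φ' • ‖x - z‖⁻¹ • innerSL ℝ (x - z)).smulRight (x - z)) x :=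
  (hφ.comp_hasFDerivAt x (hasFDerivAt_norm_sub hx)).smul ((hasFDerivAt_id x).sub_const z)

theorem divergence_radial (hx : x ≠ z) (hφ : HasDerivAt φ φ' ‖x - z‖) :
    divergence (fun q : Plane => φ ‖q - z‖ • (q - z)) x = 2 * φ ‖x - z‖ + φ' * ‖x - z‖ := by
  have hpos : 0 < ‖x - z‖ := norm_pos_iff.2 (sub_ne_zero.2 hx)
  have h2 : ‖x - z‖ ^ 2 = (x - z) 0 ^ 2 + (x - z) 1 ^ 2 := by
    rw [EuclideanSpace.norm_sq_eq, Fin.sum_univ_two]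
    simp
  have h3 : φ' * ‖x - z‖ = φ' * ‖x - z‖⁻¹ * ((x - z) 0 ^ 2 + (x - z) 1 ^ 2) := by
    rw [← h2]
    field_simp
  rw [divergence, (hasFDerivAt_radial hx hφ).fderiv, Fin.sum_univ_two, h3]
  simp [EuclideanSpace.inner_single_right]
  ring

variable {Ω : Set Plane} {f : Plane → ℝ} {L : ℂ ≃ₗᵢ[ℝ] Plane}

theorem tendsto_norm_sub (z x : Plane) : Tendsto (fun q : Plane => ‖q - z‖) (𝓝 x) (𝓝 ‖x - z‖) := by
  have : Continuous fun q : Plane => ‖q - z‖ := by fun_prop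
  exact this.tendsto x

theorem eventually_ray_mem (hx : x ∈ interior Ω) (hL : L ‖x - z‖ = x - z) :
    ∀ᶠ t : ℝ in 𝓝 ‖x - z‖, z + L (t : ℂ) ∈ interior Ω := by
  have h1 : Tendsto (fun t : ℝ => z + L (t : ℂ)) (𝓝 ‖x - z‖) (𝓝 x) := by
    have := (contDiff_ray z L).continuous.tendsto ‖x - z‖
    rwa [hL, add_sub_cancel] at this
  exact h1.eventually (isOpen_interior.mem_nhds hx)

theorem IsRotSymmOn.eventually_eq_rayPart (hf : IsRotSymmOn f Ω z) (hx : x ∈ interior Ω)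
    (hL : L ‖x - z‖ = x - z) : ∀ᶠ q in 𝓝 x, f q = rayPart f z L ‖q - z‖ := by
  filter_upwards [isOpen_interior.mem_nhds hx,
    (tendsto_norm_sub z x).eventually (eventually_ray_mem hx hL)] with q h1 h2
  refine hf _ (interior_subset h1) _ (interior_subset h2) ?_
  simp [dist_eq_norm]

/-- The gradient of a rotationally symmetric function. -/
theorem IsRotSymmOn.eventually_gradient_eq (hf : IsRotSymmOn f Ω z) (hx : x ∈ interior Ω)
    (hxz : x ≠ z) (hL : L ‖x - z‖ = x - z)
    (hd : ∀ᶠ t in 𝓝 ‖x - z‖, ContDiffAt ℝ ∞ (rayPart f z L) t) :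
    ∀ᶠ q in 𝓝 x, q ≠ z ∧
      ∇ f q = (deriv (rayPart f z L) ‖q - z‖ / ‖q - z‖) • (q - z) := by
  filter_upwards [(hf.eventually_eq_rayPart hx hL).eventually_nhds,
    (tendsto_norm_sub z x).eventually hd, isOpen_ne.mem_nhds hxz] with q h1 h2 h3
  refine ⟨h3, HasGradientAt.gradient ?_⟩
  rw [hasGradientAt_iff_hasFDerivAt]
  replace h1 : f =ᶠ[𝓝 q] rayPart f z L ∘ fun q => ‖q - z‖ := h1
  have h4 := ((h2.differentiableAt (by simp)).hasDerivAt.comp_hasFDerivAt q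
    (hasFDerivAt_norm_sub h3)).congr_of_eventuallyEq h1
  refine h4.congr_fderiv ?_
  ext v
  simp
  ring

theorem norm_radial {q : Plane} (hq : q ≠ z) (a : ℝ) : ‖(a / ‖q - z‖) • (q - z)‖ = |a| := by
  have hpos : 0 < ‖q - z‖ := norm_pos_iff.2 (sub_ne_zero.2 hq)
  rw [norm_smul, norm_div, norm_norm, div_mul_cancel₀ _ hpos.ne', Real.norm_eq_abs]

/-- The second radial derivative vanishes where the derivative of the gradient does. -/
theorem IsRotSymmOn.deriv_deriv_rayPart_eq_zero (hf : IsRotSymmOn f Ω z) (hx : x ∈ interior Ω)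
    (hxz : x ≠ z) (hL : L ‖x - z‖ = x - z)
    (hd : ∀ᶠ t in 𝓝 ‖x - z‖, ContDiffAt ℝ ∞ (rayPart f z L) t) (h0 : fderiv ℝ (∇ f) x = 0) :
    deriv (deriv (rayPart f z L)) ‖x - z‖ = 0 := by
  have hpos : 0 < ‖x - z‖ := norm_pos_iff.2 (sub_ne_zero.2 hxz)
  have h1 : HasDerivAt (fun t => deriv (rayPart f z L) t / t) _ ‖x - z‖ :=
    (hd.self_of_nhds.contDiffAt_deriv.differentiableAt (by simp)).hasDerivAt.fun_div
      (hasDerivAt_id ‖x - z‖) hpos.ne'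
  have h2 := (hasFDerivAt_radial hxz h1).congr_of_eventuallyEq
    ((hf.eventually_gradient_eq hx hxz hL hd).mono fun q hq => hq.2)
  -- Evaluated in the radial direction, the derivative of the gradient multiplies `x - z` by the
  -- second derivative along the ray.
  have h3 := congrArg (fun A : Plane →L[ℝ] Plane => A (x - z)) (h2.fderiv.symm.trans h0)
  simp only [add_apply, smul_apply,
    ContinuousLinearMap.id_apply, ContinuousLinearMap.smulRight_apply, innerSL_apply_apply,
    real_inner_self_eq_norm_sq, zero_apply, smul_eq_mul] at h3
  rw [← add_smul, smul_eq_zero] at h3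
  rcases h3 with h3 | h3
  · field_simp at h3
    rw [mul_zero, add_sub_cancel] at h3
    exact (mul_eq_zero.1 h3).resolve_left hpos.ne'
  · exact absurd h3 (sub_ne_zero.2 hxz)

end Radial

/-! ### The right-hand side of the equation along a ray. -/

namespace IsProfileNorm

variable {ν : ℝ → ℝ} {N : Seminorm ℝ (ℝ × ℝ)}

theorem edgeStopping_abs (h : IsProfileNorm ν N) (a : ℝ) :
    edgeStopping ν |a| = edgeStopping ν a := by
  rcases abs_choice a with e | e
  · rw [e]
  · rw [e, h.edgeStopping_eq, h.edgeStopping_eq]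
    simp only [neg_mul, h.even]

theorem abs_inv_pow_sub_le (h : IsProfileNorm ν N) (s t : ℝ) :
    |(ν s)⁻¹ ^ 3 - (ν t)⁻¹ ^ 3| ≤ 3 * (N (1, 0) * |s - t|) := by
  have hs := h.one_le s
  have ht := h.one_le t
  have hs1 : (ν s)⁻¹ ≤ 1 := inv_le_one_of_one_le₀ hs
  have ht1 : (ν t)⁻¹ ≤ 1 := inv_le_one_of_one_le₀ ht
  have hs0 : 0 < (ν s)⁻¹ := inv_pos.2 (h.pos s)
  have ht0 : 0 < (ν t)⁻¹ := inv_pos.2 (h.pos t)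
  have e : (ν s)⁻¹ ^ 3 - (ν t)⁻¹ ^ 3 = ((ν s)⁻¹ ^ 2 + (ν s)⁻¹ * (ν t)⁻¹ + (ν t)⁻¹ ^ 2) *
      ((ν s)⁻¹ * (ν t)⁻¹ * (ν t - ν s)) := by
    have := (h.pos s).ne'
    have := (h.pos t).ne'
    field_simp
    ring
  rw [e, abs_mul, abs_mul, abs_sub_comm]
  have h1 : |(ν s)⁻¹ ^ 2 + (ν s)⁻¹ * (ν t)⁻¹ + (ν t)⁻¹ ^ 2| ≤ 3 := by
    rw [abs_of_pos (by positivity)]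
    nlinarith
  have h2 : |(ν s)⁻¹ * (ν t)⁻¹| ≤ 1 := by
    rw [abs_of_pos (by positivity)]
    nlinarith
  have h3 : |(ν s)⁻¹ * (ν t)⁻¹| * |ν s - ν t| ≤ 1 * (N (1, 0) * |s - t|) := by
    gcongr
    exact h.lipschitz s t
  rw [one_mul] at h3
  gcongr

/-- The derivative of the edge-stopping function along a `C^1` function. The outer function need
not be differentiable where the inner one has a double zero. -/
theorem hasDerivAt_edgeStopping_comp (h : IsProfileNorm ν N) {A : ℝ → ℝ} {r : ℝ}
    (hA : ContDiffAt ℝ 1 A r) (hd : A r ≠ 0 ∨ DifferentiableAt ℝ ν 0 ∨ deriv A r = 0) :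
    HasDerivAt (fun t => edgeStopping ν (A t))
      (-(3 / 2) * deriv A r * ∫ ϑ in (-(π / 2))..(π / 2),
        deriv ν (A r * cos ϑ) * (cos ϑ ^ 2 * (ν (A r * cos ϑ))⁻¹ ^ 4)) r := by
  obtain ⟨K, s, hs, hK⟩ := hA.exists_lipschitzOnWith
  have hA' := (hA.differentiableAt one_ne_zero).hasDerivAt
  have hIoo : ∀ᵐ ϑ : ℝ, ϑ ∈ uIoc (-(π / 2)) (π / 2) → ϑ ∈ Ioo (-(π / 2)) (π / 2) := by
    have h0 : ∀ᵐ ϑ : ℝ, ϑ ≠ π / 2 := by simp [ae_iff]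
    filter_upwards [h0] with ϑ h1 h2
    rw [uIoc_of_le (by linarith [pi_pos])] at h2
    exact ⟨h2.1, lt_of_le_of_ne h2.2 h1⟩
  have hdiff : ∀ᵐ ϑ : ℝ, ϑ ∈ Ioo (-(π / 2)) (π / 2) →
      DifferentiableAt ℝ ν (A r * cos ϑ) ∨ deriv A r = 0 := by
    by_cases ha : A r = 0
    · rcases hd with h1 | h1 | h1
      · exact absurd ha h1
      · exact Eventually.of_forall fun ϑ _ => Or.inl (by rwa [ha, zero_mul])
      · exact Eventually.of_forall fun ϑ _ => Or.inr h1
    · filter_upwards [h.ae_differentiableAt ha] with ϑ h1 h2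
      exact Or.inl (h1 h2)
  have hcont : ∀ a, Continuous fun ϑ => cos ϑ * (ν (a * cos ϑ))⁻¹ ^ 3 := fun a => by
    have := h.continuous
    exact continuous_cos.mul
      (Continuous.pow (Continuous.inv₀ (by fun_prop) fun ϑ => (h.pos _).ne') 3)
  -- The formula without the derivative of `ν` has a Lipschitz integrand, so differentiation under
  -- the integral needs a pointwise derivative only for almost every angle.
  have key := (intervalIntegral.hasDerivAt_integral_of_dominated_loc_of_lip (μ := volume)
    (a := -(π / 2)) (b := π / 2) (F := fun t ϑ => cos ϑ * (ν (A t * cos ϑ))⁻¹ ^ 3)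
    (F' := fun ϑ => -3 * deriv A r * (deriv ν (A r * cos ϑ) *
      (cos ϑ ^ 2 * (ν (A r * cos ϑ))⁻¹ ^ 4)))
    (bound := fun _ => 3 * (N (1, 0) * K)) hs
    (Eventually.of_forall fun t => (hcont (A t)).aestronglyMeasurable)
    ((hcont (A r)).intervalIntegrable _ _) ?_ ?_ intervalIntegrable_const ?_).2
  · rw [intervalIntegral.integral_const_mul] at key
    have h1 : (fun t => edgeStopping ν (A t)) = fun t =>
        1 / 2 * ∫ ϑ in (-(π / 2))..(π / 2), cos ϑ * (ν (A t * cos ϑ))⁻¹ ^ 3 :=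
      funext fun t => h.edgeStopping_eq (A t)
    rw [h1]
    refine (key.const_mul (1 / 2)).congr_deriv ?_
    ring
  · rw [uIoc_of_le (by linarith [pi_pos])]
    exact ((h.intervalIntegrable_deriv_trig (A r) (-(π / 2)) (π / 2)
      (continuous_cos.pow 2) 4).const_mul _).1.aestronglyMeasurable
  · refine Eventually.of_forall fun ϑ _ => LipschitzOnWith.of_dist_le_mul fun t ht t' ht' => ?_
    have hN : 0 ≤ N (1, 0) := apply_nonneg N _
    have h1 := hK.dist_le_mul t ht t' ht'
    have h2 := h.abs_inv_pow_sub_le (A t * cos ϑ) (A t' * cos ϑ)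
    have h3 := abs_cos_le_one ϑ
    rw [Real.dist_eq, Real.dist_eq] at h1
    rw [Real.dist_eq, Real.dist_eq, Real.coe_nnabs, ← mul_sub, abs_mul (cos ϑ),
      abs_of_nonneg (a := 3 * (N (1, 0) * K)) (by positivity)]
    rw [← sub_mul, abs_mul] at h2
    calc |cos ϑ| * |(ν (A t * cos ϑ))⁻¹ ^ 3 - (ν (A t' * cos ϑ))⁻¹ ^ 3|
        ≤ 1 * (3 * (N (1, 0) * (K * |t - t'| * 1))) := by
          refine mul_le_mul h3 (h2.trans ?_) (abs_nonneg _) zero_le_one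
          gcongr
      _ = 3 * (N (1, 0) * K) * |t - t'| := by ring
  · filter_upwards [hIoo, hdiff] with ϑ h1 h2 h3
    have h4 := h.hasDerivAt_comp (hA'.mul_const (cos ϑ))
      ((h2 (h1 h3)).imp id fun e => by rw [e, zero_mul])
    refine (((h4.fun_inv (h.pos _).ne').fun_pow 3).const_mul (cos ϑ)).congr_deriv ?_
    have := (h.pos (A r * cos ϑ)).ne'
    simp only [Nat.add_one_sub_one, Nat.cast_ofNat]
    field_simp

end IsProfileNorm

theorem ContinuousAt.eventually_div_abs_eq {g : ℝ → ℝ} {r : ℝ} (hg : ContinuousAt g r)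
    (h0 : g r ≠ 0) : ∀ᶠ t in 𝓝 r, g t / |g t| = g r / |g r| := by
  rcases lt_or_gt_of_ne h0 with h1 | h1
  · filter_upwards [hg.eventually (Iio_mem_nhds h1)] with t ht
    rw [abs_of_neg ht, abs_of_neg h1, div_neg, div_neg, div_self (ne_of_lt ht), div_self h0]
  · filter_upwards [hg.eventually (Ioi_mem_nhds h1)] with t ht
    rw [abs_of_pos ht, abs_of_pos h1, div_self (ne_of_gt ht), div_self h0]

/-- The right-hand side of the geodesic active contour equation for rotationally symmetric
functions. -/
theorem IsProfileNorm.gacRHS_radial {ν : ℝ → ℝ} {N : Seminorm ℝ (ℝ × ℝ)} (h : IsProfileNorm ν N)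
    {Ω : Set Plane} {f u : Plane → ℝ} {z x : Plane} {L : ℂ ≃ₗᵢ[ℝ] Plane}
    (hf : IsRotSymmOn f Ω z) (hu : IsRotSymmOn u Ω z) (hx : x ∈ interior Ω) (hxz : x ≠ z)
    (hL : L ‖x - z‖ = x - z) (hfd : ∀ᶠ t in 𝓝 ‖x - z‖, ContDiffAt ℝ ∞ (rayPart f z L) t)
    (hud : ∀ᶠ t in 𝓝 ‖x - z‖, ContDiffAt ℝ ∞ (rayPart u z L) t)
    (hd : deriv (rayPart f z L) ‖x - z‖ ≠ 0 ∨ DifferentiableAt ℝ ν 0 ∨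
      deriv (deriv (rayPart f z L)) ‖x - z‖ = 0) (hU : deriv (rayPart u z L) ‖x - z‖ ≠ 0) :
    DifferentiableAt ℝ (gacFlux (edgeStopping ν) f u) x ∧
      gacRHS (edgeStopping ν) f u x = deriv (rayPart u z L) ‖x - z‖ *
        (edgeStopping ν (deriv (rayPart f z L) ‖x - z‖) / ‖x - z‖ -
          3 / 2 * deriv (deriv (rayPart f z L)) ‖x - z‖ * ∫ ϑ in (-(π / 2))..(π / 2),
            deriv ν (deriv (rayPart f z L) ‖x - z‖ * cos ϑ) *
              (cos ϑ ^ 2 * (ν (deriv (rayPart f z L) ‖x - z‖ * cos ϑ))⁻¹ ^ 4)) := by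
  have hpos : 0 < ‖x - z‖ := norm_pos_iff.2 (sub_ne_zero.2 hxz)
  set F := deriv (rayPart f z L) with hF
  set U := deriv (rayPart u z L) with hUdef
  have hG := h.hasDerivAt_edgeStopping_comp (hfd.self_of_nhds.contDiffAt_deriv.of_le (by simp)) hd
  have hgf := hf.eventually_gradient_eq hx hxz hL hfd
  have hgu := hu.eventually_gradient_eq hx hxz hL hud
  have hsgn := (tendsto_norm_sub z x).eventually
    (hud.self_of_nhds.contDiffAt_deriv.continuousAt.eventually_div_abs_eq hU)
  -- The normalised gradient of `u` is the radial unit vector with a locally constant sign. This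
  -- makes the flux a radial field, with divergence `g / R` plus the radial derivative of `g`, up to
  -- that sign.
  have hflux : gacFlux (edgeStopping ν) f u =ᶠ[𝓝 x] fun q =>
      (U ‖x - z‖ / |U ‖x - z‖| * edgeStopping ν (F ‖q - z‖) / ‖q - z‖) • (q - z) := by
    filter_upwards [hgf, hgu, hsgn] with q h1 h2 h3
    rw [gacFlux, h1.2, h2.2, norm_radial h1.1, norm_radial h1.1, h.edgeStopping_abs, smul_smul,
      ← h3]
    congr 1
    ring
  have hφ := (hG.const_mul (U ‖x - z‖ / |U ‖x - z‖|)).fun_div (hasDerivAt_id' ‖x - z‖) hpos.ne'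
  constructor
  · exact ((hasFDerivAt_radial hxz hφ).congr_of_eventuallyEq hflux).differentiableAt
  · have h1 := divergence_radial hxz hφ
    rw [gacRHS, divergence, hflux.fderiv_eq, ← divergence]
    rw [h1, hgu.self_of_nhds.2, norm_radial hxz]
    have := abs_pos.2 hU
    field_simp
    ring

/-! ### Assembly of the geometric expansion and the differential side. -/

theorem corollary4 (ν : ℝ → ℝ) (hν : IsAmoebaProfile ν) (hν0 : ν 0 = 1)
    (Ω : Set Plane) (f u : Plane → ℝ)
    (hf : ContDiffOn ℝ ∞ f Ω) (hu : ContDiffOn ℝ ∞ u Ω)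
    (z : Plane) (hfz : IsRotSymmOn f Ω z) (huz : IsRotSymmOn u Ω z)
    (x : Plane) (hx : x ∈ interior Ω) (hux : ∇ u x ≠ 0)
    (hfx : ∇ f x ≠ 0 ∨ DifferentiableAt ℝ ν 0 ∨ fderiv ℝ (∇ f) x = 0) :
    DifferentiableAt ℝ (gacFlux (edgeStopping ν) f u) x ∧
      AmoebaStepApproximates ν Ω f u x (gacRHS (edgeStopping ν) f u x) := by
  obtain ⟨N, h⟩ := hν.exists_isProfileNorm hν0
  have hxz : x ≠ z := by
    rintro rfl
    exact hux (huz.gradient_eq_zero hx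
      ((hu.contDiffAt (mem_interior_iff_mem_nhds.1 hx)).differentiableAt (by simp)))
  have hpos : 0 < ‖x - z‖ := norm_pos_iff.2 (sub_ne_zero.2 hxz)
  obtain ⟨L, hL⟩ := exists_linearIsometryEquiv_norm (x - z)
  have hfd : ∀ᶠ t in 𝓝 ‖x - z‖, ContDiffAt ℝ ∞ (rayPart f z L) t :=
    (eventually_ray_mem hx hL).mono fun t ht => hf.contDiffAt_rayPart ht
  have hud : ∀ᶠ t in 𝓝 ‖x - z‖, ContDiffAt ℝ ∞ (rayPart u z L) t :=
    (eventually_ray_mem hx hL).mono fun t ht => hu.contDiffAt_rayPart ht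
  have hU : deriv (rayPart u z L) ‖x - z‖ ≠ 0 := by
    intro e
    apply hux
    rw [(huz.eventually_gradient_eq hx hxz hL hud).self_of_nhds.2, e, zero_div, zero_smul]
  have hF : deriv (rayPart f z L) ‖x - z‖ ≠ 0 ∨ DifferentiableAt ℝ ν 0 ∨
      deriv (deriv (rayPart f z L)) ‖x - z‖ = 0 := by
    refine hfx.imp (fun h1 e => h1 ?_) (Or.imp_right fun h1 =>
      hfz.deriv_deriv_rayPart_eq_zero hx hxz hL hfd h1)
    rw [(hfz.eventually_gradient_eq hx hxz hL hfd).self_of_nhds.2, e, zero_div, zero_smul]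
  obtain ⟨hdiff, hR⟩ := h.gacRHS_radial hfz huz hx hxz hL hfd hud hF hU
  refine ⟨hdiff, ?_⟩
  obtain ⟨δ, hc⟩ := exists_isRadialChart hf hfz hx hpos hL
  obtain ⟨ha, hb⟩ := hasDerivAt_deriv_radialPart hpos hfd
  -- Where the first derivative vanishes, the second derivatives in `k` and along the ray coincide,
  -- so the alternatives carry over.
  have hd : deriv (radialPart f z L ‖x - z‖) 0 ≠ 0 ∨ DifferentiableAt ℝ ν 0 ∨
      deriv (deriv (rayPart f z L)) ‖x - z‖ - deriv (rayPart f z L) ‖x - z‖ / ‖x - z‖ = 0 := by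
    rw [ha]
    by_cases e : deriv (rayPart f z L) ‖x - z‖ = 0
    · rw [e, zero_div, sub_zero]
      rwa [e] at hF
    · exact Or.inl e
  have hU' : HasStrictDerivAt (radialPart u z L ‖x - z‖) (deriv (rayPart u z L) ‖x - z‖) 0 := by
    have h1 : ContDiffAt ℝ ∞ (radialPart u z L ‖x - z‖) 0 := by
      refine hu.contDiffAt_radialPart ?_ (by rw [mul_zero, add_zero]; positivity)
      rwa [sectorMap_zero hpos, hL, add_sub_cancel]
    have h2 := h1.hasStrictDerivAt (by simp)
    rwa [(hasDerivAt_deriv_radialPart hpos hud).1] at h2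
  -- The balance point of the two halves is the right-hand side divided by `6` times the radial
  -- slope of `u`; this fixes the step size `ρ ^ 2 / 6`.
  obtain ⟨C, hC6, hC⟩ : ∃ C, gacRHS (edgeStopping ν) f u x / 6 =
      deriv (rayPart u z L) ‖x - z‖ * C ∧ ∀ c, ∫ ϑ in (-(π / 2))..(π / 2),
        deformation ν ‖x - z‖ (deriv (radialPart f z L ‖x - z‖) 0)
          (deriv (deriv (rayPart f z L)) ‖x - z‖ - deriv (rayPart f z L) ‖x - z‖ / ‖x - z‖) c ϑ /
          ν (deriv (radialPart f z L ‖x - z‖) 0 * cos ϑ) ^ 2 = 2 * (c - C) := by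
    refine ⟨edgeStopping ν (deriv (rayPart f z L) ‖x - z‖) / (6 * ‖x - z‖) -
      1 / 4 * deriv (deriv (rayPart f z L)) ‖x - z‖ * ∫ ϑ in (-(π / 2))..(π / 2),
        deriv ν (deriv (rayPart f z L) ‖x - z‖ * cos ϑ) *
          (cos ϑ ^ 2 * (ν (deriv (rayPart f z L) ‖x - z‖ * cos ϑ))⁻¹ ^ 4), ?_, fun c => ?_⟩
    · rw [hR]
      field_simp
      ring
    · rw [h.integral_deformation hpos, ha, sub_add_cancel]
      field_simp
      ring
  refine amoebaStepApproximates_of_half_lt hx hu.continuousOn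
    (fun ρ hρ q hq => ?_) (fun κ hκ => ?_) fun κ hκ => ?_
  · rw [mem_closedBall_iff_norm]
    exact (le_abs_self _).trans
      ((h.abs_le _ _).trans (h.norm_le_of_mem_amoeba (hf.of_le (by simp)) hρ hq))
  · exact hc.eventually_half_lt h huz hb hd hU' hU hC (by rwa [← hC6])
  -- Negating `u` turns superlevel sets into sublevel sets, while `C` depends on `f` only and stays
  -- the same.
  · have hneg : IsRotSymmOn (fun q => -u q) Ω z :=
      fun p hp q hq e => congrArg Neg.neg (huz p hp q hq e)
    refine (hc.eventually_half_lt h hneg hb hd hU'.neg (neg_ne_zero.2 hU) hC (κ := -κ)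
      (by rw [neg_mul, ← hC6]; exact neg_lt_neg hκ)).mono fun ρ hρ => ?_
    convert hρ using 5 with q
    rw [neg_mul, ← neg_add, neg_lt_neg_iff]
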